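/- Let $\mathfrak g$ be a finite-dimensional real Lie algebra with basis $e_1,\dots,e_n$, let $\xi_1,\dots,\xi_n$ be the corresponding linear coordinates on $\mathfrak g^*$, let $\hat x(\xi)=\xi(x)$ for $x\in\mathfrak g$, and let $\{f,h\}=\sum_{i,j}\xi([e_i,e_j])\,\frac{\partial f}{\partial\xi_i}\frac{\partial h}{\partial\xi_j}$ be the linear Poisson bracket on $C^\infty(\mathfrak g^*)$ (real-valued functions). Let $\sigma_\nu:\mathrm{Pol}(\mathfrak g^*)[\nu]\to U(\mathfrak g)[\nu]$ be the $\mathbb R[\nu]$-linear symmetrization map $\sigma_\nu(\hat x_1\cdots\hat x_k)=\frac{\nu^k}{k!}\sum_{\pi\in S_k}x_{\pi(1)}\bullet\cdots\bullet x_{\pi(k)}$. The BCH (Gutt) star product $\star$ is defined on polynomials by $\sigma_\nu(p\star q)=\sigma_\nu(p)\bullet\sigma_\nu(q)$; its $\nu^r$-part $C_r$ is a bidifferential operator of order at most $r$ in each argument, and $\star=\sum_r\nu^rC_r$ is extended accordingly to $C^\infty(\mathfrak g^*)[[\nu]]$. Put $[F,H]_\star=F\star H-H\star F$. Let $\mathcal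 D\subseteq C^\infty(\mathfrak g^*)$ be a linear subspace and $\tau=\sum_r\nu^r\tau_r:\mathcal D[[\nu]]\to\mathbb R[[\nu]]$ an $\mathbb R[[\nu]]$-linear functional, with $\tau_r:\mathcal D\to\mathbb R$. Call $\tau$ a *$\star$-trace on $\mathcal D[[\nu]]$* if $\mathcal D[[\nu]]$ is a two-sided ideal of $(C^\infty(\mathfrak g^*)[[\nu]],\star)$ and $\tau([A,B]_\star)=0$ for all $A\in C^\infty(\mathfrak g^*)[[\nu]]$, $B\in\mathcal D[[\nu]]$; a *Poisson trace on $\mathcal D$* if $\mathcal D$ is a Poisson ideal of $C^\infty(\mathfrak g^*)$ (an ideal for the pointwise product and for the bracket) and $\tau(\{f,h\})=0$ for all $f\in C^\infty(\mathfrak g^*)$, $h\in\mathcal D$; and *$\mathfrak g$-invariant* if $\{\hat x,h\}\in\mathcal D$ and $\tau(\{\hat x,h\})=0$ for all $x\in\mathfrak g$, $h\in\mathcal D$. **Theorem.** (a) Let $\mathcal D\subseteq C^\infty(\mathfrak g^*)$ be a subspace such that $\mathcal D[[\nu]]$ is a two-sided ideal with respect to $\star$, and let $\tau=\sum_r\nu^r\tau_r$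 be an $\mathbb R[[\nu]]$-linear functional on $\mathcal D[[\nu]]$ with the following property: for all $f\in C^\infty(\mathfrak g^*)$, $h\in\mathcal D$ and every sequence of polynomials $p_m$ with $p_m\to f$ locally uniformly together with all derivatives, one has $\tau_r([p_m,h]_\star)\to\tau_r([f,h]_\star)$ in each order of $\nu$, for every $r$. Then $\tau$ is a $\star$-trace on $\mathcal D[[\nu]]$ if and only if $\tau$ is a Poisson trace on $\mathcal D$, and this is the case if and only if $\tau$ is $\mathfrak g$-invariant. (b) Let $\Gamma$ be a group of automorphisms of the Lie algebra $\mathfrak g$ that contains $e^{\operatorname{ad}x}$ for all $x\in\mathfrak g$ (for example $\Gamma=\mathrm{Ad}(G)$ for a Lie group $G$ with Lie algebra $\mathfrak g$), and let $\mathcal O=\{\xi\circ\gamma\mid\gamma\in\Gamma\}\subseteq\mathfrak g^*$ be a coadjoint orbit which is a (not necessarily closed) embedded submanifold of $\mathfrak g^*$, with tangent spaces $T_\eta\mathcal O=\{\operatorname{ad}^*_x\eta\mid x\in\mathfrak g\}$. Let $\Omega_{\mathcal O}$ be its Liouville measure, i.e. the measure $|\omega^m/m!|$ of the Kirillov–Kostant–Souriau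 form $\omega_\eta(\operatorname{ad}^*_x\eta,\operatorname{ad}^*_y\eta)=\eta([x,y])$, $2m=\dim\mathcal O$, and let $C^\infty_{\mathcal O}(\mathfrak g^*)$ be the space of all $f\in C^\infty(\mathfrak g^*)$ such that $\mathcal O\cap\operatorname{supp}f$ is compact. Then the functional $f\mapsto\int_{\mathcal O}f\,\Omega_{\mathcal O}$ is well defined on $C^\infty_{\mathcal O}(\mathfrak g^*)$ and its $\mathbb R[[\nu]]$-linear extension is a $\star$-trace on $C^\infty_{\mathcal O}(\mathfrak g^*)[[\nu]]$. If $\Delta$ is a differential operator on $\mathfrak g^*$ (of finite order, with smooth coefficients) that is $\mathfrak g$-invariant, i.e. $\Delta\{\hat x,f\}=\{\hat x,\Delta f\}$ for all $x\in\mathfrak g$ and $f\in C^\infty(\mathfrak g^*)$, then the same holds for the functional $f\mapsto\int_{\mathcal O}\Delta f\,\Omega_{\mathcal O}$. -/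

import Mathlib

open scoped ContDiff
open MeasureTheory Filter Topology

noncomputable section

/- Throughout, `g` is a finite-dimensional real Lie algebra with a basis `b = (e_1, …, e_n)`, and the
dual space `g*` is described by the linear coordinates `ξ = (ξ_1, …, ξ_n)` of the dual basis, so
that `ξ : Fin n → ℝ` is the functional with `ξ (e_i) = ξ_i`. -/

namespace BCHStar

/-- Real functions on `g*`, in linear coordinates. -/
abbrev Fn (n : ℕ) : Type := (Fin n → ℝ) → ℝ

/-! ### Linear functions and the linear Poisson bracket -/

section Poisson

variable {n : ℕ} {g : Type*} [LieRing g] [LieAlgebra ℝ g]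

/-- The linear function `x̂ (ξ) = ξ (x)` on `g*` given by `x ∈ g`. -/
def linearFn (b : Module.Basis (Fin n) ℝ g) (x : g) : Fn n :=
  fun ξ => ∑ i, b.repr x i * ξ i

/-- The partial derivative `∂f/∂ξ_i`. -/
def pderiv (i : Fin n) (f : Fn n) : Fn n :=
  fun ξ => fderiv ℝ f ξ (Pi.single i 1)

/-- The linear Poisson bracket `{f, h} = ξ_k c^k_{ij} ∂f/∂ξ_i ∂h/∂ξ_j`, where
`c^k_{ij} = e^k ([e_i, e_j])`. -/
def poisson (b : Module.Basis (Fin n) ℝ g) (f h : Fn n) : Fn n :=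
  fun ξ => ∑ i, ∑ j, ∑ k, ξ k * b.repr ⁅b i, b j⁆ k * pderiv i f ξ * pderiv j h ξ

end Poisson

/-! ### The star product -/

section Star

variable {n : ℕ} {g : Type*} [LieRing g] [LieAlgebra ℝ g]

/-- The symmetrization `(1/k!) ∑_{τ ∈ S_k} y_{τ(1)} • ⋯ • y_{τ(k)}` in the universal enveloping
algebra of the monomial `y_1 ∨ ⋯ ∨ y_k` in the basis vectors with exponent vector `a`. -/
def symMonomial (b : Module.Basis (Fin n) ℝ g) (a : Fin n →₀ ℕ) : UniversalEnvelopingAlgebra ℝ g :=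
  ((a.degree.factorial : ℝ))⁻¹ •
    ((Finsupp.toMultiset a).toList.permutations.map
      (fun l => (l.map (fun i => UniversalEnvelopingAlgebra.ι ℝ (b i))).prod)).sum

/-- The total symmetrization map `σ_ν : Pol(g*)[ν] → U(g)[ν]`, which is `ℝ[ν]`-linear and sends a
monomial of degree `k` to `ν^k` times its symmetrization. The polynomial variable is `ν`. -/
def sigma (b : Module.Basis (Fin n) ℝ g) (P : Polynomial (MvPolynomial (Fin n) ℝ)) :
    Polynomial (UniversalEnvelopingAlgebra ℝ g) :=
  ∑ m ∈ P.support, ∑ a ∈ (P.coeff m).support,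
    Polynomial.monomial (m + a.degree) ((P.coeff m).coeff a • symMonomial b a)

/-- The star product of polynomials: `σ_ν (P ⋆ Q) = σ_ν (P) • σ_ν (Q)`. By the
Poincaré–Birkhoff–Witt theorem `σ_ν` is injective, and its range is a subalgebra. -/
def polyStar (b : Module.Basis (Fin n) ℝ g) (P Q : Polynomial (MvPolynomial (Fin n) ℝ)) :
    Polynomial (MvPolynomial (Fin n) ℝ) :=
  Function.invFun (sigma b) (sigma b P * sigma b Q)

/-- The Taylor polynomial of `f` of order `r` at the point `ξ`. -/
def taylorPoly (r : ℕ) (ξ : Fin n → ℝ) (f : Fn n) : MvPolynomial (Fin n) ℝ :=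
  ∑ k ∈ Finset.range (r + 1), ∑ i : Fin k → Fin n,
    MvPolynomial.C (((k.factorial : ℝ))⁻¹ *
        iteratedFDeriv ℝ k f ξ (fun j => Pi.single (i j) 1)) *
      ∏ j, (MvPolynomial.X (i j) - MvPolynomial.C (ξ (i j)))

/-- The `r`-th bidifferential operator `C_r` of the star product on smooth functions. The operator
`C_r` on polynomials is the `ν^r`-part of `polyStar`; it is a bidifferential operator of order at
most `r` in each argument, so that its unique extension to a bidifferential operator on smooth
functions is computed at `ξ` from the Taylor polynomials of order `r` at `ξ`. -/
def bchCoeff (b : Module.Basis (Fin n) ℝ g) (r : ℕ) (f h : Fn n) : Fn n :=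
  fun ξ => MvPolynomial.eval ξ
    ((polyStar b (Polynomial.C (taylorPoly r ξ f)) (Polynomial.C (taylorPoly r ξ h))).coeff r)

/-- The BCH (Gutt) star product `F ⋆ H = ∑_{r,s,t} ν^{r+s+t} C_r (F_s, H_t)` of formal power series
in `ν` with coefficients in the functions on `g*`. -/
def star (b : Module.Basis (Fin n) ℝ g) (F H : PowerSeries (Fn n)) : PowerSeries (Fn n) :=
  PowerSeries.mk fun m =>
    ∑ p ∈ Finset.HasAntidiagonal.antidiagonal m, ∑ q ∈ Finset.HasAntidiagonal.antidiagonal p.2,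
      bchCoeff b p.1 (PowerSeries.coeff q.1 F) (PowerSeries.coeff q.2 H)

/-- The star commutator `[F, H] = F ⋆ H - H ⋆ F`. -/
def starComm (b : Module.Basis (Fin n) ℝ g) (F H : PowerSeries (Fn n)) : PowerSeries (Fn n) :=
  star b F H - star b H F

end Star

/-! ### Domains `D[[ν]]`, ideals and functionals -/

section Functionals

variable {n : ℕ} {g : Type*} [LieRing g] [LieAlgebra ℝ g]

/-- Membership in `C^∞(g*)[[ν]]`. -/
def IsSmoothSeries (F : PowerSeries (Fn n)) : Prop :=
  ∀ m, ContDiff ℝ ∞ (PowerSeries.coeff m F)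

/-- `D[[ν]]` as an `ℝ[[ν]]`-submodule of the formal power series of functions. -/
def formal (D : Submodule ℝ (Fn n)) : Submodule (PowerSeries ℝ) (PowerSeries (Fn n)) where
  carrier := {F | ∀ m, PowerSeries.coeff m F ∈ D}
  zero_mem' := by
    intro m
    simp
  add_mem' := by
    intro F H hF hH m
    rw [map_add]
    exact D.add_mem (hF m) (hH m)
  smul_mem' := by
    intro a F hF m
    rw [Algebra.smul_def, PowerSeries.coeff_mul]
    refine D.sum_mem fun p _ => ?_
    have h : PowerSeries.coeff p.1 (algebraMap (PowerSeries ℝ) (PowerSeries (Fn n)) a)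
        = algebraMap ℝ (Fn n) (PowerSeries.coeff p.1 a) := by
      exact PowerSeries.coeff_map (algebraMap ℝ (Fn n)) p.1 a
    rw [h, ← Algebra.smul_def]
    exact D.smul_mem _ (hF p.2)

/-- `f ∈ D` as an element of `D[[ν]]`. -/
def const (D : Submodule ℝ (Fn n)) (f : Fn n) (hf : f ∈ D) : formal D :=
  ⟨PowerSeries.C f, by
    intro m
    rw [PowerSeries.coeff_C]
    split_ifs
    · exact hf
    · exact D.zero_mem⟩

/-- `D ⊆ C^∞(g*)`, and `D[[ν]]` is a two-sided ideal of `(C^∞(g*)[[ν]], ⋆)`. -/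
def IsStarIdeal (b : Module.Basis (Fin n) ℝ g) (D : Submodule ℝ (Fn n)) : Prop :=
  (∀ f ∈ D, ContDiff ℝ ∞ f) ∧
    ∀ A, IsSmoothSeries A → ∀ B ∈ formal D, star b A B ∈ formal D ∧ star b B A ∈ formal D

/-- `D ⊆ C^∞(g*)` is a Poisson ideal of the Poisson algebra `C^∞(g*)`. -/
def IsPoissonIdeal (b : Module.Basis (Fin n) ℝ g) (D : Submodule ℝ (Fn n)) : Prop :=
  (∀ f ∈ D, ContDiff ℝ ∞ f) ∧
    ∀ f, ContDiff ℝ ∞ f → ∀ h ∈ D, f * h ∈ D ∧ poisson b f h ∈ D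

/-- `τ` is a trace on `D[[ν]]` for the star product. -/
def IsStarTrace (b : Module.Basis (Fin n) ℝ g) (D : Submodule ℝ (Fn n))
    (τ : formal D →ₗ[PowerSeries ℝ] PowerSeries ℝ) : Prop :=
  IsStarIdeal b D ∧
    ∀ A, IsSmoothSeries A → ∀ B ∈ formal D, ∃ hAB : starComm b A B ∈ formal D,
      τ ⟨starComm b A B, hAB⟩ = 0

/-- (The restriction to `D` of) `τ` is a Poisson trace on `D`. -/
def IsPoissonTrace (b : Module.Basis (Fin n) ℝ g) (D : Submodule ℝ (Fn n))
    (τ : formal D →ₗ[PowerSeries ℝ] PowerSeries ℝ) : Prop :=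
  IsPoissonIdeal b D ∧
    ∀ f, ContDiff ℝ ∞ f → ∀ h ∈ D, ∃ hfh : poisson b f h ∈ D, τ (const D _ hfh) = 0

/-- `τ` is `g`-invariant: it vanishes on `{x̂, h}` for all `x ∈ g` and `h ∈ D`. -/
def IsLieInvariant (b : Module.Basis (Fin n) ℝ g) (D : Submodule ℝ (Fn n))
    (τ : formal D →ₗ[PowerSeries ℝ] PowerSeries ℝ) : Prop :=
  ∀ x : g, ∀ h ∈ D, ∃ hxh : poisson b (linearFn b x) h ∈ D, τ (const D _ hxh) = 0

/-- The component `τ_r : D → ℝ` of `τ = ∑ ν^r τ_r`. -/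
def component (D : Submodule ℝ (Fn n)) (τ : formal D →ₗ[PowerSeries ℝ] PowerSeries ℝ)
    (r : ℕ) (f : Fn n) (hf : f ∈ D) : ℝ :=
  PowerSeries.coeff r (τ (const D f hf))

/-- The polynomial function on `g*` given by `p`. -/
def polyFn (p : MvPolynomial (Fin n) ℝ) : Fn n := fun ξ => MvPolynomial.eval ξ p

/-- Convergence in the locally convex topology of smooth functions: locally uniform convergence
of all derivatives. -/
def SmoothTendsto (F : ℕ → Fn n) (f : Fn n) : Prop :=
  ∀ k : ℕ, ∀ K : Set (Fin n → ℝ), IsCompact K →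
    TendstoUniformlyOn (fun m => iteratedFDeriv ℝ k (F m)) (iteratedFDeriv ℝ k f) atTop K

/-- The continuity property: `τ_r ([p_m, h]) → τ_r ([f, h])` in each order `ν^s` of the star
commutators, whenever the polynomials `p_m` converge to `f` as smooth functions and `h ∈ D`. -/
def HasPolyContinuity (b : Module.Basis (Fin n) ℝ g) (D : Submodule ℝ (Fn n))
    (τ : formal D →ₗ[PowerSeries ℝ] PowerSeries ℝ) : Prop :=
  ∀ f, ContDiff ℝ ∞ f → ∀ h ∈ D, ∀ p : ℕ → MvPolynomial (Fin n) ℝ,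
    SmoothTendsto (fun m => polyFn (p m)) f →
    ∀ (r s : ℕ)
      (hp : ∀ m, PowerSeries.coeff s
        (starComm b (PowerSeries.C (polyFn (p m))) (PowerSeries.C h)) ∈ D)
      (hf : PowerSeries.coeff s (starComm b (PowerSeries.C f) (PowerSeries.C h)) ∈ D),
      Tendsto (fun m => component D τ r _ (hp m)) atTop (𝓝 (component D τ r _ hf))

end Functionals

/-! ### Coadjoint orbits and the Liouville measure -/

section Orbits

variable {n : ℕ} {g : Type*} [LieRing g] [LieAlgebra ℝ g]

/-- `Γ` is a group of Lie algebra automorphisms of `g` which contains all inner automorphisms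
`e^{ad x}`. For a Lie group `G` with Lie algebra `g` the group `Ad(G)` has this property. -/
structure IsAdjointGroup (b : Module.Basis (Fin n) ℝ g) (Γ : Subgroup (g ≃ₗ[ℝ] g)) : Prop where
  map_lie : ∀ γ ∈ Γ, ∀ x y : g, γ ⁅x, y⁆ = ⁅γ x, γ y⁆
  exp_ad : ∀ x : g, ∃ γ ∈ Γ, LinearMap.toMatrix b b (γ : g →ₗ[ℝ] g) =
    NormedSpace.exp (LinearMap.toMatrix b b (LieAlgebra.ad ℝ g x))

/-- The coadjoint orbit of `ξ`: all functionals `ξ ∘ γ` with `γ ∈ Γ`, in coordinates. -/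
def coadjointOrbit (b : Module.Basis (Fin n) ℝ g) (Γ : Subgroup (g ≃ₗ[ℝ] g)) (ξ : Fin n → ℝ) :
    Set (Fin n → ℝ) :=
  {η | ∃ γ ∈ Γ, ∀ i, η i = linearFn b (γ (b i)) ξ}

/-- The coadjoint action of the Lie algebra: `(ad*_x ξ) (y) = -ξ ([x, y])`, in coordinates. -/
def coad (b : Module.Basis (Fin n) ℝ g) (x : g) (ξ : Fin n → ℝ) : Fin n → ℝ :=
  fun i => -linearFn b ⁅x, b i⁆ ξ

/-- A smooth local parametrization, as an embedded submanifold of `g*`, of a set `O` which is a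
coadjoint orbit: an injective immersion from an open set of `ℝ^d` which is a homeomorphism onto a
relatively open subset of `O`; the tangent space at `ξ ∈ O` is `{ad*_x ξ | x ∈ g}`. -/
structure OrbitChart (b : Module.Basis (Fin n) ℝ g) (O : Set (Fin n → ℝ)) where
  dim : ℕ
  source : Set (Fin dim → ℝ)
  toFun : (Fin dim → ℝ) → (Fin n → ℝ)
  isOpen_source : IsOpen source
  contDiffOn : ContDiffOn ℝ ∞ toFun source
  injOn : Set.InjOn toFun source
  injective_fderiv : ∀ u ∈ source, Function.Injective (fderiv ℝ toFun u)
  range_fderiv : ∀ u ∈ source,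
    Set.range (fderiv ℝ toFun u) = Set.range (fun x : g => coad b x (toFun u))
  open_image : ∀ W ⊆ source, IsOpen W → ∃ V : Set (Fin n → ℝ), IsOpen V ∧ toFun '' W = O ∩ V

/-- The orbit `O` is an embedded submanifold of `g*`. -/
def IsEmbeddedOrbit (b : Module.Basis (Fin n) ℝ g) (O : Set (Fin n → ℝ)) : Prop :=
  ∀ ξ ∈ O, ∃ c : OrbitChart b O, ξ ∈ c.toFun '' c.source

/-- An element `x ∈ g` with `ad*_x φ(u) = ∂φ/∂u_i (u)`, for a local parametrization `φ`. -/
def OrbitChart.generator {b : Module.Basis (Fin n) ℝ g} {O : Set (Fin n → ℝ)}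
    (c : OrbitChart b O) (u : Fin c.dim → ℝ) (i : Fin c.dim) : g :=
  Function.invFun (fun x : g => coad b x (c.toFun u)) (fderiv ℝ c.toFun u (Pi.single i 1))

/-- The matrix of the Kirillov–Kostant–Souriau symplectic form
`ω_ξ (ad*_x ξ, ad*_y ξ) = ξ ([x, y])` in a local parametrization. -/
def OrbitChart.kksMatrix {b : Module.Basis (Fin n) ℝ g} {O : Set (Fin n → ℝ)}
    (c : OrbitChart b O) (u : Fin c.dim → ℝ) : Matrix (Fin c.dim) (Fin c.dim) ℝ :=
  Matrix.of fun i j => linearFn b ⁅c.generator u i, c.generator u j⁆ (c.toFun u)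

/-- The Liouville measure `|ω^m / m!| = √(det ω_{ij}) du_1 ⋯ du_{2m}` of the part of the orbit
covered by a local parametrization. -/
def OrbitChart.measure {b : Module.Basis (Fin n) ℝ g} {O : Set (Fin n → ℝ)}
    (c : OrbitChart b O) : Measure (Fin n → ℝ) :=
  ((volume.restrict c.source).withDensity
    (fun u => ENNReal.ofReal (Real.sqrt (c.kksMatrix u).det))).map c.toFun

/-- The Liouville measure of the orbit `O`, as a measure on `g*` concentrated on `O`: the least
measure that dominates the local Liouville measures. As these agree on overlaps, it restricts to
the local Liouville measure on the image of each local parametrization. -/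
def liouville (b : Module.Basis (Fin n) ℝ g) (O : Set (Fin n → ℝ)) : Measure (Fin n → ℝ) :=
  ⨆ c : OrbitChart b O, c.measure

/-- The space `C^∞_O(g*)` of smooth functions `f` such that `O ∩ supp f` is compact. -/
def compactOn (O : Set (Fin n → ℝ)) : Submodule ℝ (Fn n) where
  carrier := {f | ContDiff ℝ ∞ f ∧ IsCompact (O ∩ tsupport f)}
  zero_mem' := by
    refine ⟨contDiff_const, ?_⟩
    have h : tsupport (0 : Fn n) = ∅ := by simp [tsupport]
    rw [h, Set.inter_empty]
    exact isCompact_empty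
  add_mem' := by
    rintro f h ⟨hf, hfO⟩ ⟨hh, hhO⟩
    refine ⟨hf.add hh, ?_⟩
    have hle : tsupport (f + h) ⊆ tsupport f ∪ tsupport h := tsupport_add f h
    have hsub : O ∩ tsupport (f + h) =
        (O ∩ tsupport f ∪ O ∩ tsupport h) ∩ tsupport (f + h) := by
      rw [← Set.inter_union_distrib_left, Set.inter_assoc,
        Set.inter_eq_self_of_subset_right hle]
    rw [hsub]
    exact (hfO.union hhO).inter_right (isClosed_tsupport _)
  smul_mem' := by
    rintro a f ⟨hf, hfO⟩
    refine ⟨contDiff_const.smul hf, ?_⟩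
    have hle : tsupport (a • f) ⊆ tsupport f :=
      closure_mono (Function.support_const_smul_subset a f)
    have hsub : O ∩ tsupport (a • f) = (O ∩ tsupport f) ∩ tsupport (a • f) := by
      rw [Set.inter_assoc, Set.inter_eq_self_of_subset_right hle]
    rw [hsub]
    exact hfO.inter_right (isClosed_tsupport _)

/-- `Δ` is a (linear, finite order, smooth coefficient) differential operator on `g*`. -/
def IsDiffOp (Δ : Fn n → Fn n) : Prop :=
  ∃ (N : ℕ) (a : (k : ℕ) → (Fin k → Fin n) → Fn n), (∀ k i, ContDiff ℝ ∞ (a k i)) ∧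
    ∀ f, ContDiff ℝ ∞ f → ∀ ξ, Δ f ξ = ∑ k ∈ Finset.range (N + 1), ∑ i : Fin k → Fin n,
      a k i ξ * iteratedFDeriv ℝ k f ξ (fun j => Pi.single (i j) 1)

/-- `Δ` is `g`-invariant: it commutes with `{x̂, ·}` for all `x ∈ g`. -/
def IsInvariantOp (b : Module.Basis (Fin n) ℝ g) (Δ : Fn n → Fn n) : Prop :=
  ∀ x : g, ∀ f, ContDiff ℝ ∞ f →
    Δ (poisson b (linearFn b x) f) = poisson b (linearFn b x) (Δ f)

/-- The functional `f ↦ ∫ (Δ f) dμ` is well defined on `D` and its `ℝ[[ν]]`-linear extension is a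
trace on `D[[ν]]` for the star product. -/
def IntegralIsTrace (b : Module.Basis (Fin n) ℝ g) (D : Submodule ℝ (Fn n))
    (μ : Measure (Fin n → ℝ)) (Δ : Fn n → Fn n) : Prop :=
  (∀ f ∈ D, Integrable (Δ f) μ) ∧
    ∃ τ : formal D →ₗ[PowerSeries ℝ] PowerSeries ℝ,
      (∀ (F : formal D) (m : ℕ), PowerSeries.coeff m (τ F) =
        ∫ ξ, Δ (PowerSeries.coeff m (F : PowerSeries (Fn n))) ξ ∂μ) ∧
      IsStarTrace b D τ

end Orbits

end BCHStar

end

/-! Part (a) rests on one computation. Write L and R for left and right star multiplication by a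
linear function ŷ. Since `σ_ν` sends ŷ^m to (ν y)^m, the polynomial ŷ^m is the m-th star power of ŷ,
so [ŷ^m, h]_⋆ = (L^m - R^m) h. The commutator with ν y in U(g)[ν] is ν{ŷ,·}, hence L - R = ν{ŷ,·}
exactly; and L commutes with R. Therefore [ŷ^m, h]_⋆ = ν{ŷ, G h} with G = ∑ L^i R^(m-1-i), and G
preserves the ideal `D[[ν]]`. A g-invariant functional thus kills every commutator with ŷ^m, hence
with every polynomial, because powers of linear forms span (`IsLieInvariant.traceConst_polyFn`).
Density of polynomials and the continuity hypothesis extend this to smooth functions. The ν^1 part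
of the commutator is the Poisson bracket, so the Poisson trace property follows as well. Conversely,
both kinds of trace vanish on {x̂, h}, since [x̂, h]_⋆ = ν{x̂, h}.

To make sense of L, Gutt's formula L_x = ∑ ν^l (B_l/l!) T_l(x) is taken as a definition, where
T_l(x) is linear in the coordinates and of order l in the derivatives. A Bernoulli series identity
gives [L_x, L_z] = ν L_[x,z] (`IsWeyl.leftMul_commutator`), so x ↦ ν⁻¹ L_x represents U(g) by
Laurent series of differential operators. Acting on the constant 1 inverts the symmetrization. This
proves Poincaré–Birkhoff–Witt, and it shows that C_r has order at most r in each argument, so that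
it is computed from Taylor polynomials.

For part (b), automorphisms of g map orbit charts to orbit charts without changing the Kirillov
matrix, so the Liouville measure is Γ-invariant (`liouville_map`). The flow of {x̂,·} is ξ ↦ ξ ∘
e^{t ad x}; differentiating the constant t ↦ ∫ h(ξ ∘ e^{t ad x}) at t = 0 gives ∫ {x̂, h} = 0.
Continuity holds because commutators with h are supported in supp h and converge uniformly on the
compact set O ∩ supp h, which has finite measure. Part (a) then applies, also after composition with
an invariant Δ. -/

noncomputable section

namespace BCHStar

/-! ### The Bernoulli series identity -/

section Bernoulli

/-- The coefficients `B_l / l!` of `t / (e^t - 1)`. -/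
def toddCoeff (l : ℕ) : ℝ := algebraMap ℚ ℝ (bernoulli l / l.factorial)

theorem toddCoeff_zero : toddCoeff 0 = 1 := by simp [toddCoeff]

theorem toddCoeff_one : toddCoeff 1 = -1 / 2 := by simp [toddCoeff, bernoulli_one]

/-- The identity `G φ(v) + H φ(u) = -t φ(u + v)` for `φ (t) = t / (e^t - 1)`, where
`v G = φ(u + v) - φ(u)` and `u H = φ(u + v) - φ(v)`, in each power of `t`. -/
theorem sum_toddCoeff_mvPolynomial (N : ℕ) :
    let u : MvPolynomial (Fin 2) ℝ := MvPolynomial.X 0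
    let v : MvPolynomial (Fin 2) ℝ := MvPolynomial.X 1
    ∑ p ∈ Finset.HasAntidiagonal.antidiagonal (N + 1), MvPolynomial.C (toddCoeff p.1 * toddCoeff p.2) *
      ((∑ i ∈ Finset.range p.1, (u + v) ^ i * u ^ (p.1 - 1 - i)) * v ^ p.2 +
        (∑ i ∈ Finset.range p.2, (u + v) ^ i * v ^ (p.2 - 1 - i)) * u ^ p.1)
      = -(MvPolynomial.C (toddCoeff N) * (u + v) ^ N) := by
  intro u v
  -- The coefficients live in the domain K = ℝ[u, v]; `φ w` is the series tw / (e^{tw} - 1) and `e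
  -- w` is e^{tw}.
  let K := MvPolynomial (Fin 2) ℝ
  let φ : K → PowerSeries K := fun w => PowerSeries.mk fun l => MvPolynomial.C (toddCoeff l) * w ^ l
  let e : K → PowerSeries K := fun w => PowerSeries.rescale w (PowerSeries.exp K)
  have hφ : ∀ w, φ w = PowerSeries.rescale w (bernoulliPowerSeries K) := by
    intro w
    ext1 l
    rw [PowerSeries.coeff_rescale, bernoulliPowerSeries, PowerSeries.coeff_mk, PowerSeries.coeff_mk,
      mul_comm, IsScalarTower.algebraMap_apply ℚ ℝ K]
    rfl
  have hφe : ∀ w, φ w * (e w - 1) = PowerSeries.C w * PowerSeries.X := by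
    intro w
    rw [hφ]
    have := congrArg (PowerSeries.rescale w) (bernoulliPowerSeries_mul_exp_sub_one K)
    simpa [e] using this
  have hee : e u * e v = e (u + v) := PowerSeries.exp_mul_exp_eq_exp_add u v
  let G : PowerSeries K := PowerSeries.mk fun l => MvPolynomial.C (toddCoeff l) *
    ∑ i ∈ Finset.range l, (u + v) ^ i * u ^ (l - 1 - i)
  let H : PowerSeries K := PowerSeries.mk fun l => MvPolynomial.C (toddCoeff l) *
    ∑ i ∈ Finset.range l, (u + v) ^ i * v ^ (l - 1 - i)
  have hG : PowerSeries.C v * G = φ (u + v) - φ u := by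
    ext1 l
    have := (Commute.all (u + v) u).geom_sum₂_mul l
    rw [add_sub_cancel_left] at this
    simp only [G, φ, PowerSeries.coeff_C_mul, PowerSeries.coeff_mk, map_sub]
    linear_combination MvPolynomial.C (toddCoeff l) * this
  have hH : PowerSeries.C u * H = φ (u + v) - φ v := by
    ext1 l
    have := (Commute.all (u + v) v).geom_sum₂_mul l
    rw [add_sub_cancel_right] at this
    simp only [H, φ, PowerSeries.coeff_C_mul, PowerSeries.coeff_mk, map_sub]
    linear_combination MvPolynomial.C (toddCoeff l) * this
  have hu0 : u ≠ 0 := MvPolynomial.X_ne_zero 0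
  have hv0 : v ≠ 0 := MvPolynomial.X_ne_zero 1
  have hC : ∀ w : K, w ≠ 0 → PowerSeries.C w ≠ (0 : PowerSeries K) := fun w hw h => hw (by
    simpa using congrArg (PowerSeries.coeff 0) h)
  have he : ∀ w : K, w ≠ 0 → e w - 1 ≠ 0 := by
    intro w hw h
    have := hφe w
    rw [h, mul_zero] at this
    exact mul_ne_zero (hC w hw) PowerSeries.X_ne_zero this.symm
  have key : G * φ v + H * φ u = -(PowerSeries.X * φ (u + v)) := by
    have h1 := hφe u
    have h2 := hφe v
    have h3 := hφe (u + v)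
    rw [← hee, map_add] at h3
    -- K[[t]] is a domain, so the identity may be multiplied by u v (e^{tu} - 1)(e^{tv} - 1). It
    -- then follows from the defining relations of G, H and φ together with e^{tu} e^{tv} =
    -- e^{t(u+v)}.
    have hne : PowerSeries.C u * PowerSeries.C v * ((e u - 1) * (e v - 1)) ≠ 0 :=
      mul_ne_zero (mul_ne_zero (hC u hu0) (hC v hv0)) (mul_ne_zero (he u hu0) (he v hv0))
    apply mul_left_cancel₀ hne
    generalize e u = U at *
    generalize e v = V at *
    generalize φ u = a at *
    generalize φ v = b at *
    generalize φ (u + v) = c at *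
    generalize PowerSeries.C u = x at *
    generalize PowerSeries.C v = y at *
    generalize (PowerSeries.X : PowerSeries K) = t at *
    clear_value G H
    linear_combination (x * b * (U - 1) * (V - 1)) * hG + (y * a * (U - 1) * (V - 1)) * hH +
      (y * (U - 1) * a * 0) * h1 + (x * (c - a) * (U - 1)) * h2 + (y * (c - b) * (V - 1)) * h1
      - (x * y * t) * h1 - (x * y * t) * h2 + (x * y * t) * h3
  have := congrArg (PowerSeries.coeff (N + 1)) key
  rw [map_neg, PowerSeries.coeff_succ_X_mul, map_add, PowerSeries.coeff_mul, mul_comm H,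
    PowerSeries.coeff_mul, ← Finset.sum_add_distrib] at this
  simp only [G, H, φ, PowerSeries.coeff_mk] at this
  rw [← this]
  refine Finset.sum_congr rfl fun p _ => ?_
  rw [map_mul]
  ring

end Bernoulli

/-! ### Canonical commutation relations and the operators T_l(x) -/

section Weyl

variable {n : ℕ} {g : Type*} [LieRing g] [LieAlgebra ℝ g] (b : Module.Basis (Fin n) ℝ g)
  {W : Type*} [Ring W] [Algebra ℝ W]

/-- The operator `f ↦ ∑ i, f ⁅e_i, ·⁆ ∂_i`. -/
def adDeriv (d : Fin n → W) (f : g →ₗ[ℝ] W) : g →ₗ[ℝ] W :=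
  ∑ i, LinearMap.mulRight ℝ (d i) ∘ₗ f ∘ₗ (LieAlgebra.ad ℝ g (b i))

theorem adDeriv_apply (d : Fin n → W) (f : g →ₗ[ℝ] W) (x : g) :
    adDeriv b d f x = ∑ i, f ⁅b i, x⁆ * d i := by
  simp [adDeriv]

/-- `∑ i_1 … i_l, f (ad e_{i_1} ⋯ ad e_{i_l} x) ∂_{i_1} ⋯ ∂_{i_l}`. -/
def adDerivPow (d : Fin n → W) (f : g →ₗ[ℝ] W) (l : ℕ) : g →ₗ[ℝ] W := (adDeriv b d)^[l] f

theorem adDerivPow_succ (d : Fin n → W) (f : g →ₗ[ℝ] W) (l : ℕ) (x : g) :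
    adDerivPow b d f (l + 1) x = ∑ i, adDerivPow b d f l ⁅b i, x⁆ * d i := by
  rw [adDerivPow, Function.iterate_succ_apply', adDeriv_apply]
  rfl

/-- The coordinate functionals with values in the scalars of `W`. -/
def coordScalar (W : Type*) [Ring W] [Algebra ℝ W] (k : Fin n) : g →ₗ[ℝ] W :=
  (Algebra.linearMap ℝ W) ∘ₗ b.coord k

theorem coordScalar_apply (k : Fin n) (x : g) :
    coordScalar b W k x = algebraMap ℝ W (b.repr x k) := rfl

theorem sum_mul_coordScalar (f : g →ₗ[ℝ] W) (x : g) :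
    ∑ k, f (b k) * coordScalar b W k x = f x := by
  conv_rhs => rw [← b.sum_repr x]
  rw [map_sum]
  refine Finset.sum_congr rfl fun k _ => ?_
  rw [coordScalar_apply, map_smul, Algebra.smul_def, Algebra.commutes]

theorem sum_lie_mul_coordScalar (f : g →ₗ[ℝ] W) (x z : g) :
    ∑ k, f ⁅b k, x⁆ * coordScalar b W k z = f ⁅z, x⁆ := by
  have := sum_mul_coordScalar b (-(f ∘ₗ (LieAlgebra.ad ℝ g x))) z
  simpa [← map_neg, lie_skew] using this

/-- The canonical commutation relations for linear functions `x̂` and partial derivatives. -/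
structure IsWeyl (X : g →ₗ[ℝ] W) (d : Fin n → W) : Prop where
  comm_X : ∀ x z, X x * X z = X z * X x
  comm_d : ∀ i j, d i * d j = d j * d i
  comm_dX : ∀ i x, d i * X x = X x * d i + coordScalar b W i x

namespace IsWeyl

variable {b} {X : g →ₗ[ℝ] W} {d : Fin n → W} (h : IsWeyl b X d)

include h

/-- Starting from a scalar seed, `adDerivPow` is a polynomial in the commuting `d i` with scalar
coefficients: a constant coefficient operator. -/
theorem coord_comm_d (k : Fin n) (l : ℕ) (x : g) (i : Fin n) :
    adDerivPow b d (coordScalar b W k) l x * d i = d i * adDerivPow b d (coordScalar b W k) l x := by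
  induction l generalizing x with
  | zero => exact Algebra.commutes _ _
  | succ l ih =>
    rw [adDerivPow_succ, Finset.sum_mul, Finset.mul_sum]
    refine Finset.sum_congr rfl fun j _ => ?_
    rw [← mul_assoc, ← ih, mul_assoc, mul_assoc, h.comm_d]

theorem coord_comm_coord (k k' : Fin n) (l m : ℕ) (x z : g) :
    adDerivPow b d (coordScalar b W k) l x * adDerivPow b d (coordScalar b W k') m z =
      adDerivPow b d (coordScalar b W k') m z * adDerivPow b d (coordScalar b W k) l x := by
  induction l generalizing x with
  | zero => exact Algebra.commutes _ _
  | succ l ih =>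
    rw [adDerivPow_succ, Finset.sum_mul, Finset.mul_sum]
    refine Finset.sum_congr rfl fun j _ => ?_
    rw [← mul_assoc, ← ih, mul_assoc, mul_assoc, h.coord_comm_d]

omit h in
-- Normal ordering: the single factor linear in `X` is separated from a constant coefficient
-- operator, and all commutators below reduce to moving one past the other.
theorem adDerivPow_eq_sum (l : ℕ) (x : g) :
    adDerivPow b d X l x = ∑ k, X (b k) * adDerivPow b d (coordScalar b W k) l x := by
  induction l generalizing x with
  | zero => exact (sum_mul_coordScalar b X x).symm
  | succ l ih =>
    simp only [adDerivPow_succ, ih, Finset.sum_mul, Finset.mul_sum]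
    rw [Finset.sum_comm]
    simp only [mul_assoc]

/-- Exactly one factor of `adDerivPow b d X m z` fails to commute with `d i`, namely `X`; the
commutator replaces `X` by the i-th coordinate. -/
theorem d_mul_adDerivPow (i : Fin n) (m : ℕ) (z : g) :
    d i * adDerivPow b d X m z =
      adDerivPow b d X m z * d i + adDerivPow b d (coordScalar b W i) m z := by
  induction m generalizing z with
  | zero => exact h.comm_dX i z
  | succ m ih =>
    simp only [adDerivPow_succ, Finset.mul_sum, Finset.sum_mul, ← Finset.sum_add_distrib]
    refine Finset.sum_congr rfl fun j _ => ?_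
    rw [← mul_assoc, ih, add_mul, mul_assoc, mul_assoc, h.comm_d]

end IsWeyl

/-! ### Commutators of the T_l through two commuting operators on functions of (x, z) -/

section Bilinear

/-- The operator `f ↦ ∑ i, f (⁅e_i, ·⁆, ·) ∂_i`. -/
def adDerivFst (d : Fin n → W) : Module.End ℝ (g → g → W) where
  toFun f x z := ∑ i, f ⁅b i, x⁆ z * d i
  map_add' f f' := by
    ext x z
    simp [add_mul, Finset.sum_add_distrib]
  map_smul' c f := by
    ext x z
    simp [Finset.smul_sum]

/-- The operator `f ↦ ∑ i, f (·, ⁅e_i, ·⁆) ∂_i`. -/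
def adDerivSnd (d : Fin n → W) : Module.End ℝ (g → g → W) where
  toFun f x z := ∑ i, f x ⁅b i, z⁆ * d i
  map_add' f f' := by
    ext x z
    simp [add_mul, Finset.sum_add_distrib]
  map_smul' c f := by
    ext x z
    simp [Finset.smul_sum]

/-- Exchange of the two arguments. -/
def flipFn (g W : Type*) [Ring W] [Algebra ℝ W] : Module.End ℝ (g → g → W) where
  toFun f x z := f z x
  map_add' _ _ := rfl
  map_smul' _ _ := rfl

variable {b} {X : g →ₗ[ℝ] W} {d : Fin n → W}

theorem flipFn_mul_adDerivFst : flipFn g W * adDerivFst b d = adDerivSnd b d * flipFn g W := rfl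

theorem flipFn_mul_adDerivSnd : flipFn g W * adDerivSnd b d = adDerivFst b d * flipFn g W := rfl

/-- The function `(x, z) ↦ f ⁅x, z⁆`. -/
def bracketFn (f : g →ₗ[ℝ] W) : g → g → W := fun x z => f ⁅x, z⁆

theorem flipFn_bracketFn (f : g →ₗ[ℝ] W) : flipFn g W (bracketFn f) = -bracketFn f := by
  ext x z
  simp [flipFn, bracketFn, ← map_neg]

/-- This is the Jacobi identity ⁅⁅e, x⁆, z⁆ + ⁅x, ⁅e, z⁆⁆ = ⁅e, ⁅x, z⁆⁆. With u = `adDerivFst` and v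
= `adDerivSnd`, it makes powers of u + v act on the bracket as a whole. -/
theorem add_bracketFn (f : g →ₗ[ℝ] W) :
    (adDerivFst b d + adDerivSnd b d) (bracketFn f) = bracketFn (adDeriv b d f) := by
  ext x z
  simp only [adDerivFst, adDerivSnd, bracketFn, adDeriv_apply, LinearMap.add_apply,
    LinearMap.coe_mk, AddHom.coe_mk, Pi.add_apply, ← Finset.sum_add_distrib, ← add_mul, ← map_add]
  simp

theorem add_pow_bracketFn (f : g →ₗ[ℝ] W) (N : ℕ) :
    ((adDerivFst b d + adDerivSnd b d) ^ N) (bracketFn f) = bracketFn (adDerivPow b d f N) := by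
  induction N with
  | zero => rfl
  | succ N ih =>
    rw [pow_succ', Module.End.mul_apply, ih, add_bracketFn, adDerivPow, adDerivPow,
      Function.iterate_succ_apply']

namespace IsWeyl

variable (h : IsWeyl b X d)

include h

theorem commute_adDeriv : Commute (adDerivFst b d (W := W)) (adDerivSnd b d) := by
  refine LinearMap.ext fun f => ?_
  ext x z
  simp only [Module.End.mul_apply, adDerivFst, adDerivSnd, LinearMap.coe_mk, AddHom.coe_mk,
    Finset.sum_mul]
  rw [Finset.sum_comm]
  simp only [mul_assoc, h.comm_d]

omit h in
-- Contraction over i puts the m-fold adjoint image of z into the slot of `b i`. For m = 0 this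
-- gives a function of ⁅z, x⁆, whence the sign; each further step is one application of v.
theorem crossTerm_eq (l m : ℕ) :
    (fun x z => ∑ i, adDerivPow b d X l ⁅b i, x⁆ * adDerivPow b d (coordScalar b W i) m z) =
      -((adDerivSnd b d ^ m) (((adDerivFst b d + adDerivSnd b d) ^ l) (bracketFn X))) := by
  induction m with
  | zero =>
    rw [add_pow_bracketFn]
    ext x z
    refine (sum_lie_mul_coordScalar b _ x z).trans ?_
    simp [bracketFn, ← map_neg]
  | succ m ih =>
    rw [pow_succ', Module.End.mul_apply, ← map_neg, ← ih]
    ext x z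
    simp only [adDerivPow_succ, adDerivSnd, LinearMap.coe_mk, AddHom.coe_mk, Finset.mul_sum,
      Finset.sum_mul]
    rw [Finset.sum_comm]
    simp only [mul_assoc]

/-- The constant coefficient part of T_l(x) contains l derivatives, each of which can hit the `X` in
T_m(z). Peeling off one derivative applies u to the earlier terms and adds the cross term v^m
(u+v)^l, so a geometric sum in u + v and u builds up. -/
theorem halfCommutator_eq (l m : ℕ) :
    (fun x z => ∑ k, X (b k) * (adDerivPow b d (coordScalar b W k) l x * adDerivPow b d X m z -
        adDerivPow b d X m z * adDerivPow b d (coordScalar b W k) l x)) =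
      -∑ i ∈ Finset.range l, ((adDerivFst b d + adDerivSnd b d) ^ i * adDerivFst b d ^ (l - 1 - i) *
        adDerivSnd b d ^ m) (bracketFn X) := by
  induction l with
  | zero =>
    ext x z
    simp [adDerivPow, coordScalar_apply, Algebra.commutes]
  | succ l ih =>
    have hc := h.commute_adDeriv
    rw [Finset.sum_range_succ]
    have h1 : ∑ i ∈ Finset.range l, ((adDerivFst b d + adDerivSnd b d) ^ i *
        adDerivFst b d ^ (l + 1 - 1 - i) * adDerivSnd b d ^ m) (bracketFn X) =
        adDerivFst b d (∑ i ∈ Finset.range l, ((adDerivFst b d + adDerivSnd b d) ^ i *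
        adDerivFst b d ^ (l - 1 - i) * adDerivSnd b d ^ m) (bracketFn X)) := by
      rw [map_sum]
      refine Finset.sum_congr rfl fun i hi => ?_
      have hi' := Finset.mem_range.1 hi
      rw [← Module.End.mul_apply, ← mul_assoc, ← mul_assoc,
        ((Commute.refl _).add_right hc |>.pow_right i).eq,
        mul_assoc (_ ^ i) (adDerivFst b d), ← pow_succ', show l - 1 - i + 1 = l + 1 - 1 - i by omega]
    rw [h1, neg_add, ← map_neg, ← ih]
    have h2 := crossTerm_eq (b := b) (X := X) (d := d) l m
    have h3 : ((adDerivFst b d + adDerivSnd b d) ^ l *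
        adDerivFst b d ^ (l + 1 - 1 - l) * adDerivSnd b d ^ m) (bracketFn X) =
        ((adDerivSnd b d ^ m) (((adDerivFst b d + adDerivSnd b d) ^ l) (bracketFn X))) := by
      rw [Nat.add_sub_cancel, Nat.sub_self, pow_zero, mul_one,
        ((hc.add_left (Commute.refl _)).pow_pow l m).eq]
      rfl
    rw [h3, ← h2]
    ext x z
    simp only [adDerivFst, LinearMap.coe_mk, AddHom.coe_mk, Pi.add_apply]
    rw [Finset.sum_congr rfl fun i _ => congrArg (· * _) (adDerivPow_eq_sum l ⁅b i, x⁆)]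
    simp only [Finset.sum_mul]
    rw [← Finset.sum_add_distrib]
    simp only [← Finset.sum_add_distrib]
    rw [Finset.sum_comm]
    refine Finset.sum_congr rfl fun k _ => ?_
    rw [adDerivPow_succ, Finset.sum_mul, Finset.mul_sum, ← Finset.sum_sub_distrib, Finset.mul_sum]
    refine Finset.sum_congr rfl fun i _ => ?_
    have := h.d_mul_adDerivPow i m z
    simp only [mul_assoc, this, mul_sub, sub_mul, mul_add]
    abel

/-- After normal ordering only two half commutators survive, one for (l, m) and one for (m, l). The
second is brought to the order (x, z) by `flipFn`, which exchanges u with v and changes the sign of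
the bracket. -/
theorem commutator_eq (l m : ℕ) (x z : g) :
    adDerivPow b d X l x * adDerivPow b d X m z - adDerivPow b d X m z * adDerivPow b d X l x =
      -((((∑ i ∈ Finset.range l, (adDerivFst b d + adDerivSnd b d) ^ i *
          adDerivFst b d ^ (l - 1 - i)) * adDerivSnd b d ^ m +
        (∑ i ∈ Finset.range m, (adDerivFst b d + adDerivSnd b d) ^ i *
          adDerivSnd b d ^ (m - 1 - i)) * adDerivFst b d ^ l) (bracketFn X)) x z) := by
  have h1 := congrFun (congrFun (h.halfCommutator_eq l m) x) z
  have h2 := congrFun (congrFun (congrArg (flipFn g W) (h.halfCommutator_eq m l)) x) z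
  have hf : ∀ i k, flipFn g W * ((adDerivFst b d + adDerivSnd b d) ^ i * adDerivFst b d ^ k *
      adDerivSnd b d ^ l) = ((adDerivFst b d + adDerivSnd b d) ^ i * adDerivSnd b d ^ k *
      adDerivFst b d ^ l) * flipFn g W := by
    intro i k
    have e1 : SemiconjBy (flipFn g W) (adDerivFst b d) (adDerivSnd b d) := flipFn_mul_adDerivFst
    have e2 : SemiconjBy (flipFn g W) (adDerivSnd b d) (adDerivFst b d) := flipFn_mul_adDerivSnd
    have e3 := e1.add_right e2
    rw [add_comm (adDerivSnd b d)] at e3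
    exact ((e3.pow_right i).mul_right (e1.pow_right k)).mul_right (e2.pow_right l)
  have h3 : flipFn g W (-∑ i ∈ Finset.range m, ((adDerivFst b d + adDerivSnd b d) ^ i *
      adDerivFst b d ^ (m - 1 - i) * adDerivSnd b d ^ l) (bracketFn X)) =
      ∑ i ∈ Finset.range m, ((adDerivFst b d + adDerivSnd b d) ^ i *
      adDerivSnd b d ^ (m - 1 - i) * adDerivFst b d ^ l) (bracketFn X) := by
    rw [map_neg, map_sum, ← Finset.sum_neg_distrib]
    refine Finset.sum_congr rfl fun i _ => ?_
    rw [← Module.End.mul_apply, hf, Module.End.mul_apply, flipFn_bracketFn, map_neg, neg_neg]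
  rw [h3] at h2
  simp only [flipFn, LinearMap.coe_mk, AddHom.coe_mk] at h2
  -- Placing one `X` in front and letting the other T follow leaves the same product in both orders,
  -- as the `X` commute among themselves and so do the constant coefficient parts. These terms
  -- cancel.
  have h4 : ∑ k, X (b k) * (adDerivPow b d X m z * adDerivPow b d (coordScalar b W k) l x) =
      ∑ k, X (b k) * (adDerivPow b d X l x * adDerivPow b d (coordScalar b W k) m z) := by
    simp only [adDerivPow_eq_sum (X := X), Finset.sum_mul, Finset.mul_sum]
    rw [Finset.sum_comm]
    refine Finset.sum_congr rfl fun i _ => Finset.sum_congr rfl fun k _ => ?_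
    rw [mul_assoc, h.coord_comm_coord, ← mul_assoc, ← mul_assoc, h.comm_X]
    simp only [mul_assoc]
  have h5 : adDerivPow b d X l x * adDerivPow b d X m z -
      adDerivPow b d X m z * adDerivPow b d X l x =
      (∑ k, X (b k) * (adDerivPow b d (coordScalar b W k) l x * adDerivPow b d X m z -
        adDerivPow b d X m z * adDerivPow b d (coordScalar b W k) l x)) -
      (∑ k, X (b k) * (adDerivPow b d (coordScalar b W k) m z * adDerivPow b d X l x -
        adDerivPow b d X l x * adDerivPow b d (coordScalar b W k) m z)) := by
    simp only [mul_sub, Finset.sum_sub_distrib, h4]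
    simp only [← mul_assoc, ← Finset.sum_mul, ← adDerivPow_eq_sum]
    abel
  rw [h5, h1, h2, LinearMap.add_apply, Finset.sum_mul, Finset.sum_mul, LinearMap.sum_apply,
    LinearMap.sum_apply]
  simp only [Pi.neg_apply, Pi.add_apply]
  abel

/-- The operator series `∑ ν^l (B_l / l!) T_l (x)` of the left star multiplication by `x̂`. -/
def _root_.BCHStar.leftMul (b : Module.Basis (Fin n) ℝ g) (d : Fin n → W) (X : g →ₗ[ℝ] W) (x : g) :
    PowerSeries W :=
  PowerSeries.mk fun l => toddCoeff l • adDerivPow b d X l x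

/-- The coefficient of ν^(N+1) is `sum_toddCoeff_mvPolynomial` evaluated at u and v and applied to
(x, z) ↦ `X ⁅x, z⁆`; the right side (u+v)^N yields T_N(⁅x, z⁆). -/
theorem leftMul_commutator (x z : g) :
    leftMul b d X x * leftMul b d X z - leftMul b d X z * leftMul b d X x =
      PowerSeries.X * leftMul b d X ⁅x, z⁆ := by
  ext1 N
  cases N with
  | zero => simp [leftMul, PowerSeries.coeff_mul, toddCoeff_zero, adDerivPow, h.comm_X]
  | succ N =>
    have hsw : PowerSeries.coeff (N + 1) (leftMul b d X z * leftMul b d X x) =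
        ∑ p ∈ Finset.HasAntidiagonal.antidiagonal (N + 1),
          PowerSeries.coeff p.2 (leftMul b d X z) * PowerSeries.coeff p.1 (leftMul b d X x) := by
      rw [PowerSeries.coeff_mul, ← Finset.Nat.sum_antidiagonal_swap]
      rfl
    rw [map_sub, hsw, PowerSeries.coeff_mul, ← Finset.sum_sub_distrib, PowerSeries.coeff_succ_X_mul]
    simp only [leftMul, PowerSeries.coeff_mk, smul_mul_smul_comm]
    -- Since u and v commute, they generate a commutative algebra in which the two-variable
    -- polynomial identity can be evaluated.
    let A : Subalgebra ℝ (Module.End ℝ (g → g → W)) :=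
      Algebra.adjoin ℝ {adDerivFst b d, adDerivSnd b d}
    have hA : IsMulCommutative A := Algebra.isMulCommutative_adjoin ℝ (by
      have hc := h.commute_adDeriv
      rintro x (rfl | rfl) y (rfl | rfl)
      · rfl
      · exact hc
      · exact hc.symm
      · rfl)
    let _ : CommRing A := { (inferInstance : Ring A) with mul_comm := hA.is_comm.comm }
    let a0 : A := ⟨adDerivFst b d, Algebra.subset_adjoin (by simp)⟩
    let a1 : A := ⟨adDerivSnd b d, Algebra.subset_adjoin (by simp)⟩
    let π : MvPolynomial (Fin 2) ℝ →ₐ[ℝ] Module.End ℝ (g → g → W) :=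
      A.val.comp (MvPolynomial.aeval ![a0, a1])
    have hπ0 : π (MvPolynomial.X 0) = adDerivFst b d := by simp [π, a0]
    have hπ1 : π (MvPolynomial.X 1) = adDerivSnd b d := by simp [π, a1]
    have hπC : ∀ c, π (MvPolynomial.C c) = algebraMap ℝ _ c := fun c => π.commutes c
    have key := congrArg π (sum_toddCoeff_mvPolynomial N)
    simp only [map_sum, map_mul, map_add, map_pow, map_neg, hπ0, hπ1, hπC] at key
    have key2 := congrFun (congrFun (LinearMap.congr_fun key (bracketFn X)) x) z
    rw [LinearMap.neg_apply, Module.End.mul_apply, add_pow_bracketFn, LinearMap.sum_apply,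
      Module.algebraMap_end_apply, Finset.sum_apply, Finset.sum_apply] at key2
    have h6 : bracketFn (adDerivPow b d X N) x z = adDerivPow b d X N ⁅x, z⁆ := rfl
    simp only [Pi.neg_apply, Pi.smul_apply, h6] at key2
    rw [eq_comm, neg_eq_iff_eq_neg, ← Finset.sum_neg_distrib] at key2
    rw [key2]
    refine Finset.sum_congr rfl fun p _ => ?_
    rw [mul_comm (toddCoeff p.2), ← smul_sub, h.commutator_eq, ← map_mul, Module.End.mul_apply,
      Module.algebraMap_end_apply, smul_neg]
    rfl

/-- For l = 1 the two summands of `commutator_eq` are v^m and (u+v)^m - v^m, so that only (u+v)^m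
remains. This is the invariance of T_m under g; at x = z it gives commuting left and right
multiplications. -/
theorem adDerivPow_one_commutator (x z : g) (m : ℕ) :
    adDerivPow b d X 1 x * adDerivPow b d X m z - adDerivPow b d X m z * adDerivPow b d X 1 x =
      -adDerivPow b d X m ⁅x, z⁆ := by
  have hc := h.commute_adDeriv
  rw [h.commutator_eq]
  have h1 := congrFun (congrFun (add_pow_bracketFn (b := b) (d := d) X m) x) z
  have h6 : bracketFn (adDerivPow b d X m) x z = adDerivPow b d X m ⁅x, z⁆ := rfl
  rw [← h6, ← h1]
  have h2 := (hc.add_left (Commute.refl _) :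
    Commute (adDerivFst b d + adDerivSnd b d) (adDerivSnd b d)).geom_sum₂_mul m
  simp only [Finset.range_one, Finset.sum_singleton, pow_zero, mul_one, one_mul, Nat.sub_self,
    pow_one, add_sub_cancel_right] at h2 ⊢
  rw [h2, add_sub_cancel]

end IsWeyl
end Bilinear
end Weyl

/-! ### Permutations of lists and words of monomials -/

section Permutations

/-- Bridge between the lists in `symMonomial` and sums over `Equiv.Perm`: distinct permutations give
distinct lists, and both sides have m! elements. -/
theorem coe_permutations_finRange (m : ℕ) :
    ((List.finRange m).permutations : Multiset (List (Fin m))) =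
      (Finset.univ : Finset (Equiv.Perm (Fin m))).val.map (fun π => List.ofFn (fun j => π j)) := by
  have hnd : (List.finRange m).permutations.Nodup := List.nodup_permutations _ (List.nodup_finRange m)
  have hinj : Function.Injective (fun π : Equiv.Perm (Fin m) => List.ofFn (fun j => π j)) := fun π π' h =>
    Equiv.ext (congrFun (List.ofFn_injective h))
  have : Finset.univ.map ⟨_, hinj⟩ = (List.finRange m).permutations.toFinset := by
    refine Finset.eq_of_subset_of_card_le (fun l hl => ?_) ?_
    · obtain ⟨π, -, rfl⟩ := Finset.mem_map.1 hl
      rw [List.mem_toFinset, List.mem_permutations]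
      exact Equiv.Perm.ofFn_comp_perm π id |>.trans (by rw [List.ofFn_id])
    · rw [List.toFinset_card_of_nodup hnd, List.length_permutations, List.length_finRange,
        Finset.card_map, Finset.card_univ, Fintype.card_perm, Fintype.card_fin]
  have h2 := congrArg Finset.val this
  rw [Finset.map_val, List.toFinset_val, hnd.dedup] at h2
  exact h2.symm

theorem sum_permutations_ofFn {α M : Type*} [AddCommMonoid M] {m : ℕ} (w : Fin m → α)
    (f : List α → M) :
    ((List.ofFn w).permutations.map f).sum = ∑ π : Equiv.Perm (Fin m), f (List.ofFn (w ∘ π)) := by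
  rw [List.ofFn_eq_map, ← List.map_permutations, List.map_map, ← Multiset.sum_coe,
    ← Multiset.map_coe, coe_permutations_finRange, Multiset.map_map]
  simp only [Function.comp_def, List.map_ofFn]
  rfl

theorem sum_permutations_congr {α M : Type*} [AddCommMonoid M] {l l' : List α} (h : l.Perm l')
    (f : List α → M) : (l.permutations.map f).sum = (l'.permutations.map f).sum :=
  ((h.permutations).map f).sum_eq

end Permutations

theorem toMultiset_sum_single_ofFn {α : Type*} {m : ℕ} (w : Fin m → α) :
    Finsupp.toMultiset (∑ j, Finsupp.single (w j) 1) = (List.ofFn w : Multiset α) := by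
  rw [map_sum, ← Fin.univ_val_map, ← Multiset.sum_map_singleton (Multiset.map w _),
    Multiset.map_map]
  simp [Finset.sum, Finsupp.toMultiset_single]

theorem prod_X_eq_monomial {n m : ℕ} (w : Fin m → Fin n) :
    ∏ j, (MvPolynomial.X (w j) : MvPolynomial (Fin n) ℝ) =
      MvPolynomial.monomial (∑ j, Finsupp.single (w j) 1) 1 := by
  rw [MvPolynomial.monomial_sum_one]
  rfl

theorem exists_sum_single_eq {α : Type*} (a : α →₀ ℕ) :
    ∃ w : Fin a.degree → α, ∑ j, Finsupp.single (w j) 1 = a := by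
  have hl : (Finsupp.toMultiset a).toList.length = a.degree := by
    rw [Multiset.length_toList, Finsupp.card_toMultiset]
    rfl
  refine ⟨fun j => (Finsupp.toMultiset a).toList.get (j.cast hl.symm), ?_⟩
  classical
  apply Function.LeftInverse.injective (g := Multiset.toFinsupp) Finsupp.toMultiset_toFinsupp
  rw [toMultiset_sum_single_ofFn]
  conv_rhs => rw [← Multiset.coe_toList (Finsupp.toMultiset a)]
  congr 1
  refine List.ext_get (by simp [hl]) fun i h1 h2 => ?_
  simp

/-! ### The symmetrization map, its range and its commutators -/

section Sigma

attribute [local instance] LieRing.ofAssociativeRing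

variable {n : ℕ} {g : Type*} [LieRing g] [LieAlgebra ℝ g] (b : Module.Basis (Fin n) ℝ g)

local notation "U" => UniversalEnvelopingAlgebra ℝ g
local notation "ι" => UniversalEnvelopingAlgebra.ι ℝ

/-- The linear polynomial `x̂`. -/
def linPoly : g →ₗ[ℝ] MvPolynomial (Fin n) ℝ :=
  b.constr ℝ (fun i => MvPolynomial.X i)

theorem linPoly_basis (i : Fin n) : linPoly b (b i) = MvPolynomial.X i := by simp [linPoly]

theorem linPoly_apply (x : g) :
    linPoly b x = ∑ i, MvPolynomial.C (b.repr x i) * MvPolynomial.X i := by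
  rw [linPoly, Module.Basis.constr_apply_fintype]
  simp [MvPolynomial.smul_eq_C_mul]

/-- The symmetrization `σ_ν` on polynomials. -/
def sigmaPoly : MvPolynomial (Fin n) ℝ →ₗ[ℝ] Polynomial U :=
  (MvPolynomial.basisMonomials (Fin n) ℝ).constr ℝ
    (fun a => Polynomial.monomial a.degree (symMonomial b a))

theorem sigmaPoly_monomial (a : Fin n →₀ ℕ) (c : ℝ) :
    sigmaPoly b (MvPolynomial.monomial a c) = Polynomial.monomial a.degree (c • symMonomial b a) := by
  have h := (MvPolynomial.basisMonomials (Fin n) ℝ).constr_basis ℝ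
    (fun a => Polynomial.monomial a.degree (symMonomial b a)) a
  rw [MvPolynomial.coe_basisMonomials] at h
  have h2 : MvPolynomial.monomial a c = c • MvPolynomial.monomial a (1 : ℝ) := by
    rw [MvPolynomial.smul_monomial, smul_eq_mul, mul_one]
  rw [h2, map_smul, sigmaPoly, h, Polynomial.smul_monomial]

theorem sigmaPoly_eq_sum (p : MvPolynomial (Fin n) ℝ) :
    sigmaPoly b p = ∑ a ∈ p.support, Polynomial.monomial a.degree (p.coeff a • symMonomial b a) := by
  conv_lhs => rw [p.as_sum]
  rw [map_sum]
  exact Finset.sum_congr rfl fun a _ => sigmaPoly_monomial b a _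

/-- The symmetrization `σ_ν` as a linear map. -/
def sigmaLin : Polynomial (MvPolynomial (Fin n) ℝ) →ₗ[ℝ] Polynomial U :=
  Polynomial.lsum fun m => (LinearMap.mulLeft ℝ (Polynomial.X ^ m)) ∘ₗ sigmaPoly b

theorem sigmaLin_apply (P : Polynomial (MvPolynomial (Fin n) ℝ)) : sigmaLin b P = sigma b P := by
  rw [sigmaLin, Polynomial.lsum_apply, Polynomial.sum, sigma]
  refine Finset.sum_congr rfl fun m _ => ?_
  rw [LinearMap.comp_apply, sigmaPoly_eq_sum, LinearMap.mulLeft_apply, Finset.mul_sum]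
  refine Finset.sum_congr rfl fun a _ => ?_
  rw [Polynomial.X_pow_mul_monomial, add_comm]

theorem sigmaLin_monomial (m : ℕ) (p : MvPolynomial (Fin n) ℝ) :
    sigmaLin b (Polynomial.monomial m p) = Polynomial.X ^ m * sigmaPoly b p := by
  rw [sigmaLin, Polynomial.lsum_apply, Polynomial.sum_monomial_index]
  · rfl
  · simp

theorem sigmaLin_C (p : MvPolynomial (Fin n) ℝ) :
    sigmaLin b (Polynomial.C p) = sigmaPoly b p := by
  rw [← Polynomial.monomial_zero_left, sigmaLin_monomial, pow_zero, one_mul]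

theorem sigmaLin_X_mul (P : Polynomial (MvPolynomial (Fin n) ℝ)) :
    sigmaLin b (Polynomial.X * P) = Polynomial.X * sigmaLin b P := by
  induction P using Polynomial.induction_on' with
  | add p q hp hq => rw [mul_add, map_add, map_add, hp, hq, mul_add]
  | monomial m p =>
    rw [Polynomial.X_mul_monomial, sigmaLin_monomial, sigmaLin_monomial, pow_succ', mul_assoc]

/-- Symmetrization of a product of linear functions. -/
theorem sigmaPoly_prod {m : ℕ} (x : Fin m → g) :
    sigmaPoly b (∏ j, linPoly b (x j)) = Polynomial.monomial m
      ((m.factorial : ℝ)⁻¹ • ∑ π : Equiv.Perm (Fin m), (List.ofFn fun j => ι (x (π j))).prod) := by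
  let f₁ : MultilinearMap ℝ (fun _ : Fin m => g) (Polynomial U) :=
    (sigmaPoly b).compMultilinearMap
      ((MultilinearMap.mkPiAlgebra ℝ (Fin m) (MvPolynomial (Fin n) ℝ)).compLinearMap
        fun _ => linPoly b)
  let f₂ : MultilinearMap ℝ (fun _ : Fin m => g) (Polynomial U) :=
    ((Polynomial.monomial m).restrictScalars ℝ).compMultilinearMap
      ((m.factorial : ℝ)⁻¹ • ∑ π : Equiv.Perm (Fin m),
        ((MultilinearMap.mkPiAlgebraFin ℝ m U).compLinearMap
          fun _ => ((UniversalEnvelopingAlgebra.ι ℝ : g →ₗ⁅ℝ⁆ U) : g →ₗ[ℝ] U)).domDomCongr π)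
  have key : f₁ = f₂ := by
    -- Both sides are multilinear in x, so basis vectors suffice; there the claim is the definition
    -- of `symMonomial`.
    refine Module.Basis.ext_multilinear (fun _ => b) fun w => ?_
    simp only [f₁, f₂, LinearMap.compMultilinearMap_apply, MultilinearMap.compLinearMap_apply,
      MultilinearMap.mkPiAlgebra_apply, linPoly_basis, smul_apply,
      sum_apply, MultilinearMap.domDomCongr_apply,
      MultilinearMap.mkPiAlgebraFin_apply, LinearMap.coe_restrictScalars]
    have hprod : ∏ j, (MvPolynomial.X (w j) : MvPolynomial (Fin n) ℝ) =
        MvPolynomial.monomial (∑ j, Finsupp.single (w j) 1) 1 := prod_X_eq_monomial w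
    have hdeg : (∑ j, Finsupp.single (w j) 1 : Fin n →₀ ℕ).degree = m := by
      rw [map_sum]
      simp
    have hms : Finsupp.toMultiset (∑ j, Finsupp.single (w j) 1 : Fin n →₀ ℕ) =
        (List.ofFn w : Multiset (Fin n)) := by
      exact toMultiset_sum_single_ofFn w
    rw [hprod, sigmaPoly_monomial, hdeg, one_smul, symMonomial, hdeg, hms]
    rw [sum_permutations_congr (Multiset.coe_eq_coe.1 (Multiset.coe_toList _)),
      sum_permutations_ofFn]
    simp only [List.map_ofFn]
    rfl
  have h := congrFun (congrArg DFunLike.coe key) x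
  simp only [f₁, f₂, LinearMap.compMultilinearMap_apply, MultilinearMap.compLinearMap_apply,
      MultilinearMap.mkPiAlgebra_apply, smul_apply, sum_apply, MultilinearMap.domDomCongr_apply,
      MultilinearMap.mkPiAlgebraFin_apply, LinearMap.coe_restrictScalars] at h
  exact h

theorem sigmaPoly_pow (y : g) (m : ℕ) :
    sigmaPoly b (linPoly b y ^ m) = Polynomial.monomial m (ι y ^ m) := by
  have h := sigmaPoly_prod b (fun _ : Fin m => y)
  simp only [Finset.prod_const, Finset.card_univ, Fintype.card_fin, List.ofFn_const,
    List.prod_replicate, Finset.sum_const, Fintype.card_perm] at h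
  rw [h, ← Nat.cast_smul_eq_nsmul ℝ, smul_smul, inv_mul_cancel₀, one_smul]
  exact_mod_cast m.factorial_ne_zero

theorem prod_ofFn_update {A : Type*} [Monoid A] (w y : A) {m : ℕ} (p : Fin (m + 1)) :
    (List.ofFn fun j => if j = p then w else y).prod = y ^ (p : ℕ) * w * y ^ (m - p) := by
  induction m with
  | zero => 
    obtain rfl : p = 0 := Fin.fin_one_eq_zero p
    simp
  | succ m ih =>
    rw [List.ofFn_succ, List.prod_cons]
    refine Fin.cases ?_ (fun p => ?_) p
    · simp [Fin.succ_ne_zero, List.ofFn_const, pow_succ']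
    · simp only [Fin.succ_inj, ih]
      rw [if_neg (Fin.succ_ne_zero p).symm, Fin.val_succ, pow_succ', Nat.succ_sub_succ]
      simp only [mul_assoc]

/-- Symmetrization of `ŵ ŷ^m`. -/
theorem sigmaPoly_mul_pow (w y : g) (m : ℕ) :
    sigmaPoly b (linPoly b w * linPoly b y ^ m) = Polynomial.monomial (m + 1)
      (((m + 1 : ℕ) : ℝ)⁻¹ • ∑ i ∈ Finset.range (m + 1), ι y ^ i * ι w * ι y ^ (m - i)) := by
  have h := sigmaPoly_prod b (Fin.cons w (fun _ : Fin m => y) : Fin (m + 1) → g)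
  rw [Fin.prod_univ_succ] at h
  simp only [Fin.cons_zero, Fin.cons_succ, Finset.prod_const, Finset.card_univ,
    Fintype.card_fin] at h
  rw [h]
  congr 1
  -- The word depends only on the position π⁻¹ 0 of w among the m + 1 letters.
  have h1 : ∀ π : Equiv.Perm (Fin (m + 1)),
      (List.ofFn fun j => ι ((Fin.cons w (fun _ : Fin m => y) : Fin (m + 1) → g) (π j))).prod =
      ι y ^ ((π⁻¹ 0 : Fin (m + 1)) : ℕ) * ι w * ι y ^ (m - (π⁻¹ 0 : Fin (m + 1))) := by
    intro π
    rw [← prod_ofFn_update]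
    congr 2
    ext j
    split_ifs with hj
    · rw [hj]
      simp
    · have : π j ≠ 0 := fun h0 => hj (by rw [← h0]; simp)
      obtain ⟨k, hk⟩ := Fin.exists_succ_eq.2 this
      rw [← hk, Fin.cons_succ]
  have h2 := Equiv.sum_comp (Equiv.inv (Equiv.Perm (Fin (m + 1))))
    (fun π : Equiv.Perm (Fin (m + 1)) =>
      ι y ^ ((π 0 : Fin (m + 1)) : ℕ) * ι w * ι y ^ (m - (π 0 : Fin (m + 1))))
  simp only [Equiv.inv_apply] at h2
  -- `decomposeFin` splits a permutation into its value at 0 and a permutation of m letters, so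
  -- every position is counted m! times; this turns 1/(m+1)! into 1/(m+1).
  rw [Finset.sum_congr rfl fun π _ => h1 π, h2,
    ← Equiv.sum_comp (Equiv.Perm.decomposeFin (n := m)).symm]
  rw [Fintype.sum_prod_type]
  simp only [Equiv.Perm.decomposeFin_symm_apply_zero, Finset.sum_const, Finset.card_univ,
    Fintype.card_perm, Fintype.card_fin]
  rw [← Finset.smul_sum, Finset.sum_range fun i => ι y ^ i * ι w * ι y ^ (m - i),
    ← Nat.cast_smul_eq_nsmul ℝ, smul_smul]
  congr 1
  rw [Nat.factorial_succ, Nat.cast_mul, mul_inv, mul_assoc, inv_mul_cancel₀, mul_one]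
  exact_mod_cast m.factorial_ne_zero

/-- Powers of linear forms span the polynomials. -/
theorem span_linPoly_pow :
    Submodule.span ℝ {p | ∃ (y : g) (m : ℕ), p = linPoly b y ^ m} = ⊤ := by
  by_contra hne
  obtain ⟨f, hf0, hf⟩ := Submodule.exists_le_ker_of_lt_top _ (lt_top_iff_ne_top.2 hne)
  apply hf0
  refine (MvPolynomial.basisMonomials (Fin n) ℝ).ext fun a => ?_
  rw [MvPolynomial.coe_basisMonomials, LinearMap.zero_apply]
  set m := a.degree with hm
  -- Q is f((∑ c_i e_i)^m) as a polynomial in the indeterminates c_i. It vanishes at every real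
  -- point, hence identically. Its coefficient at a is the value of f on that monomial times the
  -- number of words with content a, which is not zero.
  let Q : MvPolynomial (Fin n) ℝ := ∑ w : Fin m → Fin n,
    MvPolynomial.monomial (∑ j, Finsupp.single (w j) 1)
      (f (MvPolynomial.monomial (∑ j, Finsupp.single (w j) 1) 1))
  have hQ : Q = 0 := by
    refine MvPolynomial.funext fun c => ?_
    have h1 : f (linPoly b (∑ i, c i • b i) ^ m) = 0 :=
      hf (Submodule.subset_span ⟨_, m, rfl⟩)
    rw [← Fin.prod_const, map_sum, Finset.prod_univ_sum, map_sum] at h1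
    rw [map_zero, ← h1, Fintype.piFinset_univ, map_sum]
    refine Finset.sum_congr rfl fun w _ => ?_
    simp only [map_smul, linPoly_basis]
    rw [Finset.prod_smul, map_smul, prod_X_eq_monomial, smul_eq_mul, mul_comm]
    generalize f _ = t
    rw [← mul_one t, ← smul_eq_mul t 1, ← MvPolynomial.smul_monomial, MvPolynomial.smul_eval,
      ← prod_X_eq_monomial, map_prod]
    simp
  have h2 := congrArg (MvPolynomial.coeff a) hQ
  simp only [Q, MvPolynomial.coeff_sum, MvPolynomial.coeff_monomial, MvPolynomial.coeff_zero] at h2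
  have h3 : ∀ w : Fin m → Fin n, (if (∑ j, Finsupp.single (w j) 1) = a then
      f (MvPolynomial.monomial (∑ j, Finsupp.single (w j) 1) 1) else 0) =
      if (∑ j, Finsupp.single (w j) 1) = a then f (MvPolynomial.monomial a 1) else 0 := by
    intro w
    split_ifs with h
    · rw [h]
    · rfl
  rw [Finset.sum_congr rfl fun w _ => h3 w, ← Finset.sum_filter, Finset.sum_const,
    smul_eq_zero] at h2
  refine h2.resolve_left fun h => ?_
  obtain ⟨w, hw⟩ := exists_sum_single_eq a
  have : w ∈ Finset.univ.filter (fun w : Fin m → Fin n => (∑ j, Finsupp.single (w j) 1) = a) := by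
    simpa using hw
  rw [Finset.card_eq_zero] at h
  rw [h] at this
  exact absurd this (Finset.notMem_empty w)

theorem polynomial_linPoly_induction {P : MvPolynomial (Fin n) ℝ → Prop}
    (pow : ∀ (y : g) (m : ℕ), P (linPoly b y ^ m)) (zero : P 0)
    (add : ∀ p q, P p → P q → P (p + q)) (smul : ∀ (c : ℝ) p, P p → P (c • p))
    (p : MvPolynomial (Fin n) ℝ) : P p := by
  have hp : p ∈ Submodule.span ℝ {p | ∃ (y : g) (m : ℕ), p = linPoly b y ^ m} := by
    rw [span_linPoly_pow]
    trivial
  induction hp using Submodule.span_induction with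
  | mem x hx =>
    obtain ⟨y, m, rfl⟩ := hx
    exact pow y m
  | zero => exact zero
  | add x y _ _ hx hy => exact add x y hx hy
  | smul c x _ hx => exact smul c x hx

theorem ι_mul_ι (x y : g) : ι x * ι y = ι y * ι x + ι ⁅x, y⁆ := by
  rw [LieHom.map_lie, LieRing.of_associative_ring_bracket]
  abel

/-- The element `ν x` of `U(g)[ν]`. -/
def nuMul (x : g) : Polynomial U := Polynomial.monomial 1 (ι x)

/-- Left multiplication by y is the sum of ad y and right multiplication by y. These commute, so
this is the binomial theorem. -/
theorem mul_pow_eq_sum_ad (v y : g) (i : ℕ) :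
    ι y ^ i * ι v = ∑ l ∈ Finset.range (i + 1), (i.choose l) •
      (ι (((LieAlgebra.ad ℝ g y) ^ l) v) * ι y ^ (i - l)) := by
  let D : Module.End ℝ U := LinearMap.mulLeft ℝ (ι y) - LinearMap.mulRight ℝ (ι y)
  have hc : Commute D (LinearMap.mulRight ℝ (ι y)) :=
    Commute.sub_left (LinearMap.ext fun u => by simp [mul_assoc]) (Commute.refl _)
  have hD : ∀ l (w : g), (D ^ l) (ι w) = ι (((LieAlgebra.ad ℝ g y) ^ l) w) := by
    intro l w
    induction l with
    | zero => rfl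
    | succ l ih =>
      rw [pow_succ', Module.End.mul_apply, ih, pow_succ', Module.End.mul_apply]
      simp only [D, LinearMap.sub_apply, LinearMap.mulLeft_apply, LinearMap.mulRight_apply,
        LieAlgebra.ad_apply]
      rw [ι_mul_ι, add_sub_cancel_left]
  have h := LinearMap.congr_fun (hc.add_pow i) (ι v)
  rw [show D + LinearMap.mulRight ℝ (ι y) = LinearMap.mulLeft ℝ (ι y) by simp [D],
    LinearMap.pow_mulLeft, LinearMap.mulLeft_apply, LinearMap.sum_apply] at h
  rw [h]
  refine Finset.sum_congr rfl fun l _ => ?_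
  rw [← nsmul_eq_mul', LinearMap.smul_apply, (hc.pow_pow l (i - l)).eq, Module.End.mul_apply, hD,
    LinearMap.pow_mulRight, LinearMap.mulRight_apply]

/-- All factors `ι y` are moved to the right; the binomial coefficients add up by the hockey-stick
identity. -/
theorem sum_pow_mul_pow (v y : g) (m : ℕ) :
    ∑ i ∈ Finset.range (m + 1), ι y ^ i * ι v * ι y ^ (m - i) =
      ∑ l ∈ Finset.range (m + 1), ((m + 1).choose (l + 1)) •
        (ι (((LieAlgebra.ad ℝ g y) ^ l) v) * ι y ^ (m - l)) := by
  have h1 : ∀ i ∈ Finset.range (m + 1), ι y ^ i * ι v * ι y ^ (m - i) =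
      ∑ l ∈ Finset.range (m + 1), (i.choose l) •
        (ι (((LieAlgebra.ad ℝ g y) ^ l) v) * ι y ^ (m - l)) := by
    intro i hi
    have hi' := Finset.mem_range.1 hi
    rw [mul_pow_eq_sum_ad, Finset.sum_mul]
    refine Finset.sum_subset_zero_on_sdiff (Finset.range_subset_range.2 (by omega)) ?_ ?_
    · intro l hl
      rw [Finset.mem_sdiff, Finset.mem_range, Finset.mem_range] at hl
      rw [Nat.choose_eq_zero_of_lt (by omega), zero_smul]
    · intro l hl
      have hl' := Finset.mem_range.1 hl
      rw [smul_mul_assoc, mul_assoc, ← pow_add, show i - l + (m - i) = m - l by omega]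
  rw [Finset.sum_congr rfl h1, Finset.sum_comm]
  refine Finset.sum_congr rfl fun l hl => ?_
  rw [← Finset.sum_smul]
  congr 1
  clear h1 hl
  induction m with
  | zero =>
    cases l with
    | zero => simp
    | succ l => simp [Nat.choose_eq_zero_of_lt]
  | succ m ih => rw [Finset.sum_range_succ, ih, Nat.choose_succ_succ (m + 1) l, add_comm]

/-- The range of the symmetrization is closed under left multiplication by `ν x`. -/
theorem nuMul_mul_mem_range (x : g) (P : Polynomial (MvPolynomial (Fin n) ℝ)) :
    ∃ Q, sigmaLin b Q = nuMul x * sigmaLin b P := by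
  have hX : ∀ (l : ℕ), ∀ u ∈ LinearMap.range (sigmaLin b),
      Polynomial.X ^ l * u ∈ LinearMap.range (sigmaLin b) := by
    intro l
    induction l with
    | zero => simp
    | succ l ih =>
      intro u hu
      obtain ⟨Q, hQ⟩ := ih u hu
      exact ⟨Polynomial.X * Q, by rw [sigmaLin_X_mul, hQ, pow_succ', mul_assoc]⟩
  -- In `sum_pow_mul_pow` the term l = 0 is (m+1) x y^m. Every other term has fewer factors y and,
  -- compared with its own degree, a surplus power of ν, so it lies in the range by induction.
  have key : ∀ (y : g) (m : ℕ) (x : g),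
      Polynomial.monomial (m + 1) (ι x * ι y ^ m) ∈ LinearMap.range (sigmaLin b) := by
    intro y m
    induction m using Nat.strong_induction_on with
    | _ m ih =>
      intro x
      have h1 := sigmaPoly_mul_pow b x y m
      rw [sum_pow_mul_pow, Finset.sum_range_succ', ← Polynomial.smul_monomial, map_add, map_sum]
        at h1
      have h2 := congrArg (fun u => ((m + 1 : ℕ) : ℝ) • u) h1
      rw [smul_smul, mul_inv_cancel₀ (by positivity), one_smul] at h2
      have h3 : ∑ l ∈ Finset.range m, Polynomial.monomial (m + 1)
          (((m + 1).choose (l + 1 + 1)) • (ι (((LieAlgebra.ad ℝ g y) ^ (l + 1)) x) *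
            ι y ^ (m - (l + 1)))) ∈ LinearMap.range (sigmaLin b) := by
        refine Submodule.sum_mem _ fun l hl => ?_
        have hl' := Finset.mem_range.1 hl
        rw [map_nsmul]
        refine Submodule.smul_of_tower_mem _ _ ?_
        have h4 := hX (l + 1) _ (ih (m - (l + 1)) (by omega) (((LieAlgebra.ad ℝ g y) ^ (l + 1)) x))
        rwa [Polynomial.X_pow_mul_monomial, show m - (l + 1) + 1 + (l + 1) = m + 1 by omega] at h4
      have h5 : ((m + 1 : ℕ) : ℝ) • sigmaPoly b (linPoly b x * linPoly b y ^ m) ∈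
          LinearMap.range (sigmaLin b) :=
        Submodule.smul_mem _ _ ⟨_, sigmaLin_C b _⟩
      rw [h2] at h5
      have h6 := (Submodule.add_mem_iff_right _ h3).1 h5
      rw [map_nsmul, ← Nat.cast_smul_eq_nsmul ℝ, Submodule.smul_mem_iff _ (by simp; positivity)] at h6
      simpa using h6
  change nuMul x * sigmaLin b P ∈ LinearMap.range (sigmaLin b)
  induction P using Polynomial.induction_on' with
  | add p q hp hq => rw [map_add, mul_add]; exact Submodule.add_mem _ hp hq
  | monomial r p =>
    rw [sigmaLin_monomial, ← mul_assoc, (Polynomial.commute_X_pow _ r).symm.eq, mul_assoc]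
    refine hX r _ ?_
    induction p using polynomial_linPoly_induction b with
    | pow y m =>
      rw [sigmaPoly_pow, nuMul, Polynomial.monomial_mul_monomial, add_comm]
      exact key y m x
    | zero => simp
    | add p q hp hq => rw [map_add, mul_add]; exact Submodule.add_mem _ hp hq
    | smul c p hp => rw [map_smul, mul_smul_comm]; exact Submodule.smul_mem _ _ hp

/-- The operator `{x̂, ·}` on polynomials. -/
def adPoly (x : g) : MvPolynomial (Fin n) ℝ →ₗ[ℝ] MvPolynomial (Fin n) ℝ :=
  ∑ j, LinearMap.mulLeft ℝ (linPoly b ⁅x, b j⁆) ∘ₗ (MvPolynomial.pderiv j).toLinearMap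

theorem adPoly_apply (x : g) (p : MvPolynomial (Fin n) ℝ) :
    adPoly b x p = ∑ j, linPoly b ⁅x, b j⁆ * MvPolynomial.pderiv j p := by
  simp [adPoly]

theorem pderiv_linPoly (j : Fin n) (y : g) :
    MvPolynomial.pderiv j (linPoly b y) = MvPolynomial.C (b.repr y j) := by
  rw [linPoly_apply, map_sum, Finset.sum_eq_single j]
  · simp
  · intro i _ hi
    simp [MvPolynomial.pderiv_X_of_ne hi]
  · simp

theorem adPoly_pow (x y : g) (m : ℕ) :
    adPoly b x (linPoly b y ^ m) = (m : ℝ) • (linPoly b ⁅x, y⁆ * linPoly b y ^ (m - 1)) := by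
  have h : linPoly b ⁅x, y⁆ = ∑ j, MvPolynomial.C (b.repr y j) * linPoly b ⁅x, b j⁆ := by
    conv_lhs => rw [← b.sum_repr y, lie_sum, map_sum]
    simp [MvPolynomial.smul_eq_C_mul]
  rw [adPoly_apply, h, Finset.sum_mul, Finset.smul_sum]
  refine Finset.sum_congr rfl fun j _ => ?_
  rw [MvPolynomial.pderiv_pow, pderiv_linPoly, MvPolynomial.smul_eq_C_mul]
  simp only [map_natCast]
  ring

theorem ι_mul_pow_sub (x y : g) (m : ℕ) :
    ι x * ι y ^ m - ι y ^ m * ι x =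
      ∑ i ∈ Finset.range m, ι y ^ i * ι ⁅x, y⁆ * ι y ^ (m - 1 - i) := by
  induction m with
  | zero => simp
  | succ m ih =>
    rw [Finset.sum_range_succ]
    have h1 : ∑ i ∈ Finset.range m, ι y ^ i * ι ⁅x, y⁆ * ι y ^ (m + 1 - 1 - i) =
        (ι x * ι y ^ m - ι y ^ m * ι x) * ι y := by
      rw [ih, Finset.sum_mul]
      refine Finset.sum_congr rfl fun i hi => ?_
      have hi' := Finset.mem_range.1 hi
      rw [mul_assoc _ _ (ι y), ← pow_succ, show m - 1 - i + 1 = m + 1 - 1 - i by omega]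
    have h2 : ι ⁅x, y⁆ = ι x * ι y - ι y * ι x := by rw [ι_mul_ι x y]; abel
    rw [h1, h2]
    simp only [Nat.add_sub_cancel, Nat.sub_self, pow_zero, mul_one, sub_mul, mul_sub, pow_succ,
      mul_assoc]
    abel

/-- The commutator with `ν x` is `ν {x̂, ·}`. -/
theorem nuMul_commutator (x : g) (p : MvPolynomial (Fin n) ℝ) :
    nuMul x * sigmaPoly b p - sigmaPoly b p * nuMul x =
      Polynomial.X * sigmaPoly b (adPoly b x p) := by
  induction p using polynomial_linPoly_induction b with
  | pow y m =>
    -- The Leibniz sum for [x, y^m] is m times the symmetrization of the product of ⁅x, y⁆ and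
    -- y^(m-1).
    rw [sigmaPoly_pow, nuMul, Polynomial.monomial_mul_monomial, Polynomial.monomial_mul_monomial,
      add_comm m 1, ← map_sub, ι_mul_pow_sub, adPoly_pow]
    cases m with
    | zero => simp
    | succ m =>
      rw [map_smul, Nat.add_sub_cancel, sigmaPoly_mul_pow, Polynomial.smul_monomial, smul_smul,
        mul_inv_cancel₀ (by positivity), one_smul, Polynomial.X_mul_monomial, add_comm 1]
  | zero => simp
  | add p q hp hq =>
    simp only [map_add, mul_add, add_mul, ← hp, ← hq]
    abel
  | smul c p hp =>
    simp only [map_smul, mul_smul_comm, smul_mul_assoc, ← hp, smul_sub]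

end Sigma

/-! ### Smooth functions, jets and operators of bounded order -/

section SmoothFunctions

/-- The algebra `C^∞(g*)`. -/
def smoothFn (n : ℕ) : Subalgebra ℝ (Fn n) where
  carrier := {f | ContDiff ℝ ∞ f}
  mul_mem' {f h} hf hh := ContDiff.mul (show ContDiff ℝ ∞ f from hf) (show ContDiff ℝ ∞ h from hh)
  add_mem' {f h} hf hh := ContDiff.add (show ContDiff ℝ ∞ f from hf) (show ContDiff ℝ ∞ h from hh)
  algebraMap_mem' c := (contDiff_const : ContDiff ℝ ∞ fun _ : Fin n → ℝ => c)

variable {n : ℕ}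

instance instCommRingSmoothFn : CommRing (smoothFn n) := inferInstance

instance instModuleSmoothFn : Module ℝ (smoothFn n) := inferInstance

instance instRingEndSmoothFn : Ring (Module.End ℝ (smoothFn n)) := Module.End.instRing

instance instAlgebraEndSmoothFn : Algebra ℝ (Module.End ℝ (smoothFn n)) :=
  Module.End.instAlgebra ℝ ℝ (smoothFn n)

theorem contDiff_pderiv {f : Fn n} (hf : ContDiff ℝ ∞ f) (i : Fin n) : ContDiff ℝ ∞ (pderiv i f) :=
  (hf.fderiv_right (m := ∞) (by simp)).clm_apply contDiff_const

theorem pderiv_add {f h : Fn n} (hf : ContDiff ℝ ∞ f) (hh : ContDiff ℝ ∞ h) (i : Fin n) :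
    pderiv i (f + h) = pderiv i f + pderiv i h := by
  ext ξ
  simp only [pderiv, Pi.add_apply]
  rw [fderiv_add (hf.differentiable (by simp) ξ) (hh.differentiable (by simp) ξ)]
  rfl

theorem pderiv_mul {f h : Fn n} (hf : ContDiff ℝ ∞ f) (hh : ContDiff ℝ ∞ h) (i : Fin n) :
    pderiv i (f * h) = pderiv i f * h + f * pderiv i h := by
  ext ξ
  simp only [pderiv, Pi.add_apply, Pi.mul_apply]
  rw [fderiv_mul (hf.differentiable (by simp) ξ) (hh.differentiable (by simp) ξ)]
  simp
  ring

theorem pderiv_const (c : ℝ) (i : Fin n) : pderiv i (fun _ => c) = 0 := by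
  ext ξ
  simp [pderiv]

theorem pderiv_smul {f : Fn n} (hf : ContDiff ℝ ∞ f) (c : ℝ) (i : Fin n) :
    pderiv i (c • f) = c • pderiv i f := by
  ext ξ
  simp only [pderiv, Pi.smul_apply]
  rw [fderiv_const_smul (hf.differentiable (by simp) ξ)]
  rfl

theorem pderiv_comm {f : Fn n} (hf : ContDiff ℝ ∞ f) (i j : Fin n) :
    pderiv i (pderiv j f) = pderiv j (pderiv i f) := by
  have h : ∀ (i j : Fin n) ξ, pderiv i (pderiv j f) ξ =
      fderiv ℝ (fderiv ℝ f) ξ (Pi.single i 1) (Pi.single j 1) := by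
    intro i j ξ
    have hd : DifferentiableAt ℝ (fderiv ℝ f) ξ :=
      (hf.fderiv_right (m := ∞) (by simp)).differentiable (by simp) ξ
    change fderiv ℝ (fun η => fderiv ℝ f η (Pi.single j 1)) ξ (Pi.single i 1) = _
    rw [fderiv_clm_apply hd (differentiableAt_const _)]
    simp
  ext ξ
  rw [h, h]
  exact (hf.contDiffAt.isSymmSndFDerivAt (by
    rw [minSmoothness_of_isRCLikeNormedField]
    exact WithTop.coe_le_coe.2 (le_top : (2 : ℕ∞) ≤ ⊤))).eq _ _

/-- The partial derivative as an operator on smooth functions. -/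
def pderivOp (i : Fin n) : Module.End ℝ (smoothFn n) where
  toFun f := ⟨pderiv i f, contDiff_pderiv f.2 i⟩
  map_add' f h := Subtype.ext (pderiv_add f.2 h.2 i)
  map_smul' c f := Subtype.ext (pderiv_smul f.2 c i)

theorem pderivOp_mul (i : Fin n) (f h : smoothFn n) :
    pderivOp i (f * h) = pderivOp i f * h + f * pderivOp i h :=
  Subtype.ext (pderiv_mul f.2 h.2 i)

theorem contDiff_polyFn (p : MvPolynomial (Fin n) ℝ) : ContDiff ℝ ∞ (polyFn p) := by
  induction p using MvPolynomial.induction_on with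
  | C a =>
    have : polyFn (MvPolynomial.C a : MvPolynomial (Fin n) ℝ) = fun _ => a := by ext; simp [polyFn]
    rw [this]
    exact contDiff_const
  | add p q hp hq =>
    have : polyFn (p + q) = polyFn p + polyFn q := by ext; simp [polyFn]
    rw [this]
    exact hp.add hq
  | mul_X p i hp =>
    have : polyFn (p * MvPolynomial.X i) = polyFn p * fun ξ => ξ i := by ext; simp [polyFn]
    rw [this]
    exact hp.mul (contDiff_apply ℝ ℝ i)

/-- Polynomials as smooth functions. -/
def polyHom (n : ℕ) : MvPolynomial (Fin n) ℝ →ₐ[ℝ] smoothFn n where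
  toFun p := ⟨polyFn p, contDiff_polyFn p⟩
  map_one' := Subtype.ext (by ext; simp [polyFn])
  map_mul' p q := Subtype.ext (by ext; simp [polyFn])
  map_zero' := Subtype.ext (by ext; simp [polyFn])
  map_add' p q := Subtype.ext (by ext; simp [polyFn])
  commutes' c := Subtype.ext (by ext; simp [polyFn])

theorem coe_polyHom (p : MvPolynomial (Fin n) ℝ) : (polyHom n p : Fn n) = polyFn p := rfl

theorem polyHom_injective : Function.Injective (polyHom n) := by
  intro p q h
  exact MvPolynomial.funext fun ξ => congrFun (congrArg Subtype.val h) ξ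

theorem pderivOp_polyHom (i : Fin n) (p : MvPolynomial (Fin n) ℝ) :
    pderivOp i (polyHom n p) = polyHom n (MvPolynomial.pderiv i p) := by
  induction p using MvPolynomial.induction_on with
  | C a =>
    rw [MvPolynomial.pderiv_C, map_zero]
    refine Subtype.ext ((congrArg (pderiv i) ?_).trans (pderiv_const a i))
    ext
    simp [polyHom]
  | add p q hp hq => simp only [map_add, hp, hq]
  | mul_X p j hp =>
    rw [map_mul, pderivOp_mul, hp, Derivation.leibniz, map_add, smul_eq_mul, smul_eq_mul, map_mul,
      map_mul, MvPolynomial.pderiv_X]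
    have : pderivOp i (polyHom n (MvPolynomial.X j)) =
        polyHom n ((Pi.single i 1 : Fin n → MvPolynomial (Fin n) ℝ) j) := by
      refine Subtype.ext ?_
      ext ξ
      change pderiv i (polyFn (MvPolynomial.X j)) ξ = polyFn _ ξ
      have hX : polyFn (MvPolynomial.X j : MvPolynomial (Fin n) ℝ) = fun ξ => ξ j := by
        ext; simp [polyFn]
      have hd : fderiv ℝ (fun ξ : Fin n → ℝ => ξ j) ξ = ContinuousLinearMap.proj j :=
        (ContinuousLinearMap.proj (R := ℝ) (φ := fun _ : Fin n => ℝ) j).hasFDerivAt.fderiv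
      rw [hX, pderiv, hd]
      by_cases hij : i = j
      · subst hij
        simp [polyFn]
      · simp [polyFn, Ne.symm hij]
    rw [this]
    ring

/-- Smooth functions that vanish to order `k` at `ξ`. -/
def vanishing (ξ : Fin n → ℝ) : ℕ → Submodule ℝ (smoothFn n)
  | 0 => ⊤
  | k + 1 =>
    { carrier := {f | (f : Fn n) ξ = 0 ∧ ∀ i, pderivOp i f ∈ vanishing ξ k}
      zero_mem' := ⟨rfl, fun i => by rw [map_zero]; exact Submodule.zero_mem _⟩
      add_mem' := by
        rintro f h ⟨hf, hf'⟩ ⟨hh, hh'⟩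
        refine ⟨?_, fun i => by rw [map_add]; exact Submodule.add_mem _ (hf' i) (hh' i)⟩
        change (f : Fn n) ξ + (h : Fn n) ξ = 0
        rw [hf, hh, add_zero]
      smul_mem' := by
        rintro c f ⟨hf, hf'⟩
        refine ⟨?_, fun i => by rw [map_smul]; exact Submodule.smul_mem _ _ (hf' i)⟩
        change c * (f : Fn n) ξ = 0
        rw [hf, mul_zero] }

theorem vanishing_succ_le (ξ : Fin n → ℝ) (k : ℕ) : vanishing ξ (k + 1) ≤ vanishing ξ k := by
  induction k with
  | zero => exact le_top
  | succ k ih => exact fun f hf => ⟨hf.1, fun i => ih (hf.2 i)⟩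

theorem vanishing_antitone (ξ : Fin n → ℝ) : Antitone (vanishing ξ) :=
  antitone_nat_of_succ_le (vanishing_succ_le ξ)

theorem mul_mem_vanishing {ξ : Fin n → ℝ} {k : ℕ} (a : smoothFn n) {f : smoothFn n}
    (hf : f ∈ vanishing ξ k) : a * f ∈ vanishing ξ k := by
  induction k generalizing a f with
  | zero => trivial
  | succ k ih =>
    refine ⟨?_, fun i => ?_⟩
    · change (a : Fn n) ξ * (f : Fn n) ξ = 0
      rw [hf.1, mul_zero]
    · rw [pderivOp_mul]
      exact Submodule.add_mem _ (ih _ (vanishing_succ_le ξ k hf)) (ih _ (hf.2 i))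

/-- Operators on smooth functions that behave like differential operators of order `≤ r`. -/
def orderLE (n r : ℕ) : Submodule ℝ (Module.End ℝ (smoothFn n)) where
  carrier := {D | ∀ ξ k, ∀ f ∈ vanishing ξ (k + r), D f ∈ vanishing ξ k}
  zero_mem' _ _ _ _ := Submodule.zero_mem _
  add_mem' hD hE ξ k f hf := Submodule.add_mem _ (hD ξ k f hf) (hE ξ k f hf)
  smul_mem' _ _ hD ξ k f hf := Submodule.smul_mem _ _ (hD ξ k f hf)

theorem mul_mem_orderLE {r s : ℕ} {D E : Module.End ℝ (smoothFn n)} (hD : D ∈ orderLE n r)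
    (hE : E ∈ orderLE n s) : D * E ∈ orderLE n (r + s) := fun ξ k f hf =>
  hD ξ k _ (hE ξ (k + r) f (by rwa [add_assoc]))

theorem pderivOp_mem_orderLE (i : Fin n) : pderivOp i ∈ orderLE n 1 := fun _ _ _ hf => hf.2 i

theorem mulLeft_mem_orderLE (a : smoothFn n) : LinearMap.mulLeft ℝ a ∈ orderLE n 0 :=
  fun _ _ _ hf => mul_mem_vanishing a hf

/-- The value at ξ of an operator of order at most r depends only on the r-jet at ξ; this is what
allows arguments to be exchanged for their Taylor polynomials. -/
theorem apply_eq_of_sub_mem_vanishing {r : ℕ} {D : Module.End ℝ (smoothFn n)} (hD : D ∈ orderLE n r)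
    {ξ : Fin n → ℝ} {f h : smoothFn n} (hfh : f - h ∈ vanishing ξ (r + 1)) :
    (D f : Fn n) ξ = (D h : Fn n) ξ := by
  have := (hD ξ 1 (f - h) (by rwa [add_comm])).1
  rw [map_sub] at this
  exact sub_eq_zero.1 this

end SmoothFunctions

/-! ### Taylor polynomials -/

section Taylor

variable {n : ℕ}

/-- The homogeneous part of degree `k` of the Taylor expansion, without the factor `1 / k!`. -/
def taylorHom (k : ℕ) (ξ : Fin n → ℝ) (f : Fn n) : MvPolynomial (Fin n) ℝ :=
  ∑ i : Fin k → Fin n, MvPolynomial.C (iteratedFDeriv ℝ k f ξ (fun j => Pi.single (i j) 1)) *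
      ∏ j, (MvPolynomial.X (i j) - MvPolynomial.C (ξ (i j)))

theorem taylorPoly_eq_sum (r : ℕ) (ξ : Fin n → ℝ) (f : Fn n) :
    taylorPoly r ξ f = ∑ k ∈ Finset.range (r + 1),
      MvPolynomial.C ((k.factorial : ℝ))⁻¹ * taylorHom k ξ f := by
  rw [taylorPoly]
  refine Finset.sum_congr rfl fun k _ => ?_
  rw [taylorHom, Finset.mul_sum]
  refine Finset.sum_congr rfl fun i _ => ?_
  rw [map_mul, mul_assoc]

theorem taylorHom_zero (ξ : Fin n → ℝ) (f : Fn n) : taylorHom 0 ξ f = MvPolynomial.C (f ξ) := by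
  simp [taylorHom]

theorem iteratedFDeriv_succ_pderiv {f : Fn n} (hf : ContDiff ℝ ∞ f) {k : ℕ} (ξ : Fin n → ℝ)
    (w : Fin k → Fin n) (a : Fin n) :
    iteratedFDeriv ℝ (k + 1) f ξ (fun j => Pi.single ((Fin.snoc w a : Fin (k + 1) → Fin n) j) 1) =
      iteratedFDeriv ℝ k (pderiv a f) ξ (fun j => Pi.single (w j) 1) := by
  rw [iteratedFDeriv_succ_apply_right]
  have h := iteratedFDeriv_clm_apply_const_apply (𝕜 := ℝ) (c := fderiv ℝ f) (n := ∞) (i := k)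
    (hf.fderiv_right (m := ∞) (by simp)) (by exact_mod_cast le_top) (x := ξ)
    (u := (Pi.single a 1 : Fin n → ℝ)) (m := fun j => Pi.single (w j) 1)
  refine Eq.trans ?_ h.symm
  rw [Fin.snoc_last]
  congr 2
  ext j
  simp [Fin.init]

theorem taylorHom_succ {f : Fn n} (hf : ContDiff ℝ ∞ f) (k : ℕ) (ξ : Fin n → ℝ) :
    taylorHom (k + 1) ξ f = ∑ a, (MvPolynomial.X a - MvPolynomial.C (ξ a)) *
      taylorHom k ξ (pderiv a f) := by
  rw [taylorHom, ← Equiv.sum_comp (Fin.snocEquiv (fun _ => Fin n)), Fintype.sum_prod_type]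
  refine Finset.sum_congr rfl fun a _ => ?_
  rw [taylorHom, Finset.mul_sum]
  refine Finset.sum_congr rfl fun w _ => ?_
  have := iteratedFDeriv_succ_pderiv hf ξ w a
  simp only [Fin.snocEquiv, Equiv.coe_fn_mk] at this ⊢
  rw [this, Fin.prod_univ_castSucc]
  simp only [Fin.snoc_castSucc, Fin.snoc_last]
  ring

/-- The derivative may fall on any of the k + 1 linear factors, and by symmetry of partial
derivatives each choice contributes the same. -/
theorem pderiv_taylorHom_succ {f : Fn n} (hf : ContDiff ℝ ∞ f) (k : ℕ) (ξ : Fin n → ℝ)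
    (a : Fin n) : MvPolynomial.pderiv a (taylorHom (k + 1) ξ f) =
      MvPolynomial.C ((k + 1 : ℕ) : ℝ) * taylorHom k ξ (pderiv a f) := by
  have hX : ∀ c, MvPolynomial.pderiv a (MvPolynomial.X c - MvPolynomial.C (ξ c)) =
      (Pi.single a 1 : Fin n → MvPolynomial (Fin n) ℝ) c := by
    intro c
    rw [map_sub, MvPolynomial.pderiv_C, sub_zero, MvPolynomial.pderiv_X]
  have hsum : ∀ F : Fin n → MvPolynomial (Fin n) ℝ,
      ∑ c, F c * (Pi.single a 1 : Fin n → MvPolynomial (Fin n) ℝ) c = F a := by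
    intro F
    simp [Pi.single_apply]
  induction k generalizing f with
  | zero =>
    rw [taylorHom_succ hf, map_sum]
    simp only [Derivation.leibniz, smul_eq_mul, hX, taylorHom_zero, MvPolynomial.pderiv_C, mul_zero,
      zero_add]
    rw [hsum (fun c => MvPolynomial.C (pderiv c f ξ))]
    simp
  | succ k ih =>
    rw [taylorHom_succ hf, map_sum]
    simp only [Derivation.leibniz, smul_eq_mul, hX, Finset.sum_add_distrib]
    rw [hsum (fun c => taylorHom (k + 1) ξ (pderiv c f)),
      taylorHom_succ (contDiff_pderiv hf a)]
    have : ∀ c, MvPolynomial.pderiv a (taylorHom (k + 1) ξ (pderiv c f)) =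
        MvPolynomial.C ((k + 1 : ℕ) : ℝ) * taylorHom k ξ (pderiv c (pderiv a f)) := by
      intro c
      rw [ih (contDiff_pderiv hf c), pderiv_comm hf]
    simp only [this, Finset.mul_sum]
    rw [← Finset.sum_add_distrib]
    refine Finset.sum_congr rfl fun c _ => ?_
    push_cast
    simp only [map_add, map_one, map_natCast]
    ring

theorem pderiv_taylorPoly_succ {f : Fn n} (hf : ContDiff ℝ ∞ f) (r : ℕ) (ξ : Fin n → ℝ)
    (a : Fin n) : MvPolynomial.pderiv a (taylorPoly (r + 1) ξ f) = taylorPoly r ξ (pderiv a f) := by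
  rw [taylorPoly_eq_sum, taylorPoly_eq_sum, Finset.sum_range_succ', map_add, map_sum,
    taylorHom_zero, ← map_mul, MvPolynomial.pderiv_C, add_zero]
  refine Finset.sum_congr rfl fun k _ => ?_
  rw [MvPolynomial.pderiv_C_mul, pderiv_taylorHom_succ hf, ← mul_assoc, ← map_mul]
  congr 2
  rw [Nat.factorial_succ, Nat.cast_mul]
  field_simp

theorem eval_taylorPoly {f : Fn n} (hf : ContDiff ℝ ∞ f) (r : ℕ) (ξ : Fin n → ℝ) :
    MvPolynomial.eval ξ (taylorPoly r ξ f) = f ξ := by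
  rw [taylorPoly_eq_sum, Finset.sum_range_succ', map_add, map_sum, taylorHom_zero]
  rw [Finset.sum_eq_zero]
  · simp
  · intro k _
    rw [taylorHom_succ hf, map_mul, map_sum]
    simp

/-- By induction on r: differentiating the Taylor polynomial gives the Taylor polynomial of the
derivative, of order one less. -/
theorem taylorPoly_sub_mem_vanishing (f : smoothFn n) (r : ℕ) (ξ : Fin n → ℝ) :
    polyHom n (taylorPoly r ξ f) - f ∈ vanishing ξ (r + 1) := by
  induction r generalizing f with
  | zero => 
    refine ⟨?_, fun i => trivial⟩
    change MvPolynomial.eval ξ (taylorPoly 0 ξ f) - (f : Fn n) ξ = 0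
    rw [eval_taylorPoly f.2, sub_self]
  | succ r ih =>
    refine ⟨?_, fun i => ?_⟩
    · change MvPolynomial.eval ξ (taylorPoly (r + 1) ξ f) - (f : Fn n) ξ = 0
      rw [eval_taylorPoly f.2, sub_self]
    · rw [map_sub, pderivOp_polyHom, pderiv_taylorPoly_succ f.2]
      exact ih (pderivOp i f)

end Taylor

/-! ### Representation of U(g)[ν] by operator series, and the Poincaré–Birkhoff–Witt theorem -/

section Operators

variable {n : ℕ} {g : Type*} [LieRing g] [LieAlgebra ℝ g] (b : Module.Basis (Fin n) ℝ g)

attribute [local instance] LieRing.ofAssociativeRing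

local notation "U" => UniversalEnvelopingAlgebra ℝ g
local notation "ι" => UniversalEnvelopingAlgebra.ι ℝ

/-- Multiplication by the linear function `x̂`. -/
def linOp : g →ₗ[ℝ] Module.End ℝ (smoothFn n) :=
  LinearMap.mul ℝ (smoothFn n) ∘ₗ (polyHom n).toLinearMap ∘ₗ linPoly b

theorem linOp_apply (x : g) (f : smoothFn n) : linOp b x f = polyHom n (linPoly b x) * f := rfl

theorem pderivOp_linPoly (i : Fin n) (x : g) :
    pderivOp i (polyHom n (linPoly b x)) = algebraMap ℝ _ (b.repr x i) := by
  rw [pderivOp_polyHom, pderiv_linPoly, ← MvPolynomial.algebraMap_eq, AlgHom.commutes]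

theorem isWeyl_smoothFn : IsWeyl b (linOp b) (pderivOp (n := n)) where
  comm_X x z := LinearMap.ext fun f => by
    simp only [Module.End.mul_apply, linOp_apply]
    ring
  comm_d i j := LinearMap.ext fun f => Subtype.ext (pderiv_comm f.2 i j)
  comm_dX i x := LinearMap.ext fun f => by
    rw [LinearMap.add_apply, Module.End.mul_apply, Module.End.mul_apply, linOp_apply, linOp_apply,
      pderivOp_mul, pderivOp_linPoly, add_comm, coordScalar_apply, Module.algebraMap_end_apply,
      Algebra.smul_def]

/-- The operator series of left star multiplication by `x̂`. -/
abbrev leftOp (x : g) : PowerSeries (Module.End ℝ (smoothFn n)) := leftMul b pderivOp (linOp b) x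

theorem coeff_smul_series {M : Type*} [Ring M] [Algebra ℝ M] (c : ℝ) (F : PowerSeries M) (l : ℕ) :
    PowerSeries.coeff l (c • F) = c • PowerSeries.coeff l F := rfl

theorem leftMul_add_smul (x y : g) (c : ℝ) :
    leftOp b (x + c • y) = leftOp b x + c • leftOp b y := by
  ext1 l
  simp only [leftMul, PowerSeries.coeff_mk, map_add, map_smul, smul_add, coeff_smul_series]
  rw [smul_comm c]

/-- The Lie algebra homomorphism `x ↦ ν⁻¹ L_x`. -/
def laurentHom : g →ₗ⁅ℝ⁆ HahnSeries ℤ (Module.End ℝ (smoothFn n)) where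
  toFun x := HahnSeries.single (-1) 1 * HahnSeries.ofPowerSeries ℤ _ (leftOp b x)
  map_add' x y := by
    have := leftMul_add_smul b x y 1
    rw [one_smul, one_smul] at this
    rw [this, map_add, mul_add]
  map_smul' c x := by
    have h := leftMul_add_smul b 0 x c
    have h0 : leftOp b (0 : g) = 0 := by ext1 l; simp [leftMul]
    rw [zero_add, h0, zero_add] at h
    have h2 : ∀ F : PowerSeries (Module.End ℝ (smoothFn n)), c • F = PowerSeries.C (algebraMap ℝ _ c) * F := by
      intro F
      ext1 l
      rw [coeff_smul_series, PowerSeries.coeff_C_mul, Algebra.smul_def]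
    rw [h, h2, map_mul, HahnSeries.ofPowerSeries_C]
    simp only [RingHom.id_apply, Algebra.smul_def, ← mul_assoc]
    congr 1
    rw [HahnSeries.algebraMap_apply, HahnSeries.C_apply, HahnSeries.single_mul_single,
      HahnSeries.single_mul_single, zero_add, add_zero, one_mul, mul_one]
  map_lie' := by
    intro x y
    have hc : ∀ F : HahnSeries ℤ (Module.End ℝ (smoothFn n)),
        HahnSeries.single (-1) 1 * F = F * HahnSeries.single (-1) 1 := by
      intro F
      ext1
      ext1 a
      rw [HahnSeries.coeff_single_mul, HahnSeries.coeff_mul_single, one_mul, mul_one]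
    -- [L_x, L_y] = ν L_[x,y], multiplied by ν⁻², is the bracket relation. The inverse of ν is why
    -- Hahn series over ℤ are used.
    have h := (isWeyl_smoothFn b).leftMul_commutator x y
    have h2 := congrArg (HahnSeries.ofPowerSeries ℤ _) h
    rw [map_mul, map_sub, map_mul, map_mul, HahnSeries.ofPowerSeries_X] at h2
    rw [LieRing.of_associative_ring_bracket]
    generalize HahnSeries.ofPowerSeries ℤ _ (leftOp b ⁅x, y⁆) = A at *
    generalize HahnSeries.ofPowerSeries ℤ _ (leftOp b x) = B at *
    generalize HahnSeries.ofPowerSeries ℤ _ (leftOp b y) = C at *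
    have h3 : HahnSeries.single (-1) 1 * (HahnSeries.single 1 1 * A) = A := by
      rw [← mul_assoc, HahnSeries.single_mul_single]
      simp
    rw [← h3, ← h2, mul_assoc _ B, mul_assoc _ C, ← mul_assoc B, ← mul_assoc C, ← hc, ← hc, mul_assoc,
      mul_assoc, mul_sub]
    simp only [mul_sub]

/-- The extension to `U(g)[ν]`. -/
def laurentLift : Polynomial U →+* HahnSeries ℤ (Module.End ℝ (smoothFn n)) :=
  Polynomial.eval₂RingHom' (UniversalEnvelopingAlgebra.lift ℝ (laurentHom b) : U →+* _)
    (HahnSeries.single 1 1) (fun a => by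
      refine HahnSeries.ext (funext fun i => ?_)
      rw [HahnSeries.coeff_single_mul, HahnSeries.coeff_mul_single, one_mul, mul_one])

theorem laurentLift_X : laurentLift b Polynomial.X = HahnSeries.ofPowerSeries ℤ _ PowerSeries.X := by
  rw [HahnSeries.ofPowerSeries_X]
  exact Polynomial.eval₂_X _ _

theorem laurentLift_nuMul (x : g) :
    laurentLift b (nuMul x) = HahnSeries.ofPowerSeries ℤ _ (leftOp b x) := by
  rw [nuMul]
  refine (Polynomial.eval₂_monomial _ _).trans ?_
  rw [pow_one]
  refine HahnSeries.ext (funext fun i => ?_)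
  have h : (UniversalEnvelopingAlgebra.lift ℝ (laurentHom b) : U →+* _) (ι x) =
      HahnSeries.single (-1) 1 * HahnSeries.ofPowerSeries ℤ _ (leftOp b x) :=
    UniversalEnvelopingAlgebra.lift_ι_apply ℝ (laurentHom b) x
  rw [h, HahnSeries.coeff_mul_single, HahnSeries.coeff_single_mul, one_mul, mul_one]
  congr 1
  ring

theorem laurentLift_smul (c : ℝ) (u : Polynomial U) :
    laurentLift b (c • u) = HahnSeries.C (algebraMap ℝ _ c) * laurentLift b u := by
  rw [Algebra.smul_def, map_mul]
  congr 1
  refine (Polynomial.eval₂_C _ _).trans ?_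
  refine (AlgHom.commutes _ _).trans ?_
  rw [HahnSeries.algebraMap_apply]

/-- `ν^r ŷ^m` span the polynomials with parameter `ν`. -/
theorem polynomial_nu_induction {Q : Polynomial (MvPolynomial (Fin n) ℝ) → Prop}
    (pow : ∀ (y : g) (m : ℕ), Q (Polynomial.C (linPoly b y ^ m))) (zero : Q 0)
    (add : ∀ p q, Q p → Q q → Q (p + q)) (smul : ∀ (c : ℝ) p, Q p → Q (c • p))
    (X_mul : ∀ p, Q p → Q (Polynomial.X * p)) (P : Polynomial (MvPolynomial (Fin n) ℝ)) : Q P := by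
  induction P using Polynomial.induction_on' with
  | add p q hp hq => exact add p q hp hq
  | monomial r p =>
    induction r with
    | zero =>
      rw [Polynomial.monomial_zero_left]
      induction p using polynomial_linPoly_induction b with
      | pow y m => exact pow y m
      | zero => simpa using zero
      | add p q hp hq => rw [Polynomial.C_add]; exact add _ _ hp hq
      | smul c p hp => rw [← Polynomial.smul_C]; exact smul c _ hp
    | succ r ih =>
      rw [← Polynomial.X_mul_monomial]
      exact X_mul _ ih

theorem nuMul_pow (y : g) (m : ℕ) : nuMul y ^ m = sigmaLin b (Polynomial.C (linPoly b y ^ m)) := by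
  rw [sigmaLin_C, sigmaPoly_pow, nuMul, Polynomial.monomial_pow, one_mul]

/-- The factor ν^k that `sigma` attaches to degree k cancels the poles of ν⁻¹ L_x: the image of ŷ^m
is L_y^m, which has no negative powers. -/
theorem exists_opSeries (P : Polynomial (MvPolynomial (Fin n) ℝ)) :
    ∃ E, HahnSeries.ofPowerSeries ℤ _ E = laurentLift b (sigmaLin b P) := by
  induction P using polynomial_nu_induction b with
  | pow y m =>
    refine ⟨leftOp b y ^ m, ?_⟩
    rw [← nuMul_pow, map_pow, map_pow, laurentLift_nuMul]
  | zero => exact ⟨0, by simp⟩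
  | add p q hp hq =>
    obtain ⟨E, hE⟩ := hp
    obtain ⟨F, hF⟩ := hq
    exact ⟨E + F, by rw [map_add, map_add, map_add, hE, hF]⟩
  | smul c p hp =>
    obtain ⟨E, hE⟩ := hp
    exact ⟨PowerSeries.C (algebraMap ℝ _ c) * E, by
      rw [map_smul, laurentLift_smul, map_mul, HahnSeries.ofPowerSeries_C, hE]⟩
  | X_mul p hp =>
    obtain ⟨E, hE⟩ := hp
    exact ⟨PowerSeries.X * E, by rw [sigmaLin_X_mul, map_mul, map_mul, laurentLift_X, hE]⟩

/-- The operator series of left star multiplication by a polynomial. -/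
def opSeries (P : Polynomial (MvPolynomial (Fin n) ℝ)) : PowerSeries (Module.End ℝ (smoothFn n)) :=
  (exists_opSeries b P).choose

theorem opSeries_spec (P : Polynomial (MvPolynomial (Fin n) ℝ)) :
    HahnSeries.ofPowerSeries ℤ _ (opSeries b P) = laurentLift b (sigmaLin b P) :=
  (exists_opSeries b P).choose_spec

theorem opSeries_eq {P : Polynomial (MvPolynomial (Fin n) ℝ)}
    {E : PowerSeries (Module.End ℝ (smoothFn n))}
    (h : HahnSeries.ofPowerSeries ℤ _ E = laurentLift b (sigmaLin b P)) : opSeries b P = E :=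
  HahnSeries.ofPowerSeries_injective ((opSeries_spec b P).trans h.symm)

theorem opSeries_pow (y : g) (m : ℕ) :
    opSeries b (Polynomial.C (linPoly b y ^ m)) = leftOp b y ^ m :=
  opSeries_eq b (by rw [← nuMul_pow, map_pow, map_pow, laurentLift_nuMul])

theorem opSeries_add (P Q : Polynomial (MvPolynomial (Fin n) ℝ)) :
    opSeries b (P + Q) = opSeries b P + opSeries b Q :=
  opSeries_eq b (by rw [map_add, map_add, map_add, opSeries_spec, opSeries_spec])

theorem opSeries_smul (c : ℝ) (P : Polynomial (MvPolynomial (Fin n) ℝ)) :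
    opSeries b (c • P) = c • opSeries b P := by
  have h2 : c • opSeries b P = PowerSeries.C (algebraMap ℝ _ c) * opSeries b P := by
    ext1 l
    rw [coeff_smul_series, PowerSeries.coeff_C_mul, Algebra.smul_def]
  rw [h2]
  exact opSeries_eq b (by
    rw [map_smul, laurentLift_smul, map_mul, HahnSeries.ofPowerSeries_C, opSeries_spec])

theorem opSeries_X_mul (P : Polynomial (MvPolynomial (Fin n) ℝ)) :
    opSeries b (Polynomial.X * P) = PowerSeries.X * opSeries b P :=
  opSeries_eq b (by rw [sigmaLin_X_mul, map_mul, map_mul, laurentLift_X, opSeries_spec])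

theorem opSeries_zero : opSeries b 0 = 0 := opSeries_eq b (by simp)

/-- The application of a series of operators to a series of functions. -/
def actSeries (E : PowerSeries (Module.End ℝ (smoothFn n))) (F : PowerSeries (smoothFn n)) :
    PowerSeries (smoothFn n) :=
  PowerSeries.mk fun r => ∑ p ∈ Finset.HasAntidiagonal.antidiagonal r,
    PowerSeries.coeff p.1 E (PowerSeries.coeff p.2 F)

theorem actSeries_mul (E E' : PowerSeries (Module.End ℝ (smoothFn n)))
    (F : PowerSeries (smoothFn n)) : actSeries (E * E') F = actSeries E (actSeries E' F) := by
  ext1 r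
  simp only [actSeries, PowerSeries.coeff_mk, PowerSeries.coeff_mul, LinearMap.sum_apply, map_sum,
    Module.End.mul_apply]
  rw [Finset.sum_sigma', Finset.sum_sigma']
  refine Finset.sum_nbij' (fun x => ⟨(x.2.1, x.2.2 + x.1.2), (x.2.2, x.1.2)⟩)
    (fun x => ⟨(x.1.1 + x.2.1, x.2.2), (x.1.1, x.2.1)⟩) ?_ ?_ ?_ ?_ ?_
  · rintro ⟨⟨a, c⟩, d, e⟩ h
    simp only [Finset.mem_sigma, Finset.HasAntidiagonal.mem_antidiagonal] at h ⊢
    obtain ⟨h1, h2⟩ := h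
    subst h2
    exact ⟨by rw [← h1]; ring, trivial⟩
  · rintro ⟨⟨a, c⟩, d, e⟩ h
    simp only [Finset.mem_sigma, Finset.HasAntidiagonal.mem_antidiagonal] at h ⊢
    obtain ⟨h1, h2⟩ := h
    subst h2
    exact ⟨by rw [← h1]; ring, trivial⟩
  · rintro ⟨⟨a, c⟩, d, e⟩ h
    simp only [Finset.mem_sigma, Finset.HasAntidiagonal.mem_antidiagonal] at h
    obtain ⟨h1, h2⟩ := h
    subst h2
    rfl
  · rintro ⟨⟨a, c⟩, d, e⟩ h
    simp only [Finset.mem_sigma, Finset.HasAntidiagonal.mem_antidiagonal] at h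
    obtain ⟨h1, h2⟩ := h
    subst h2
    rfl
  · intros
    rfl

theorem actSeries_add_left (E E' : PowerSeries (Module.End ℝ (smoothFn n)))
    (F : PowerSeries (smoothFn n)) : actSeries (E + E') F = actSeries E F + actSeries E' F := by
  ext1 r
  simp [actSeries, Finset.sum_add_distrib]

theorem actSeries_add_right (E : PowerSeries (Module.End ℝ (smoothFn n)))
    (F F' : PowerSeries (smoothFn n)) : actSeries E (F + F') = actSeries E F + actSeries E F' := by
  ext1 r
  simp [actSeries, Finset.sum_add_distrib]

theorem actSeries_smul_left (c : ℝ) (E : PowerSeries (Module.End ℝ (smoothFn n)))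
    (F : PowerSeries (smoothFn n)) : actSeries (c • E) F = c • actSeries E F := by
  ext1 r
  simp [actSeries, Finset.smul_sum]

theorem actSeries_X_mul_left (E : PowerSeries (Module.End ℝ (smoothFn n)))
    (F : PowerSeries (smoothFn n)) :
    actSeries (PowerSeries.X * E) F = PowerSeries.X * actSeries E F := by
  ext1 r
  cases r with
  | zero => simp [actSeries]
  | succ r =>
    rw [PowerSeries.coeff_succ_X_mul]
    simp [actSeries, Finset.Nat.sum_antidiagonal_succ, PowerSeries.coeff_succ_X_mul]

theorem actSeries_X_mul_right (E : PowerSeries (Module.End ℝ (smoothFn n)))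
    (F : PowerSeries (smoothFn n)) :
    actSeries E (PowerSeries.X * F) = PowerSeries.X * actSeries E F := by
  ext1 r
  cases r with
  | zero => simp [actSeries]
  | succ r =>
    rw [PowerSeries.coeff_succ_X_mul]
    simp [actSeries, Finset.Nat.sum_antidiagonal_succ', PowerSeries.coeff_succ_X_mul]

theorem coeff_actSeries_C (E : PowerSeries (Module.End ℝ (smoothFn n))) (f : smoothFn n) (r : ℕ) :
    PowerSeries.coeff r (actSeries E (PowerSeries.C f)) = PowerSeries.coeff r E f := by
  rw [actSeries, PowerSeries.coeff_mk, Finset.sum_eq_single (r, 0)]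
  · simp
  · rintro ⟨i, j⟩ h1 h2
    rw [Finset.HasAntidiagonal.mem_antidiagonal] at h1
    have : j ≠ 0 := by
      rintro rfl
      exact h2 (by simpa using h1)
    simp [PowerSeries.coeff_C, this]
  · simp

/-- Polynomials with parameter `ν` as series of smooth functions. -/
def seriesHom (n : ℕ) : Polynomial (MvPolynomial (Fin n) ℝ) →+* PowerSeries (smoothFn n) :=
  (PowerSeries.map (polyHom n : MvPolynomial (Fin n) ℝ →+* smoothFn n)).comp
    Polynomial.coeToPowerSeries.ringHom

theorem coeff_seriesHom (P : Polynomial (MvPolynomial (Fin n) ℝ)) (r : ℕ) :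
    PowerSeries.coeff r (seriesHom n P) = polyHom n (P.coeff r) := by
  simp [seriesHom]

theorem seriesHom_C (p : MvPolynomial (Fin n) ℝ) :
    seriesHom n (Polynomial.C p) = PowerSeries.C (polyHom n p) := by
  simp [seriesHom]

theorem seriesHom_X : seriesHom n Polynomial.X = PowerSeries.X := by
  simp [seriesHom]

theorem seriesHom_smul (c : ℝ) (P : Polynomial (MvPolynomial (Fin n) ℝ)) :
    seriesHom n (c • P) = c • seriesHom n P := by
  ext1 r
  rw [coeff_seriesHom, coeff_smul_series, coeff_seriesHom, Polynomial.coeff_smul, map_smul]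

theorem seriesHom_injective : Function.Injective (seriesHom n) := by
  intro P Q h
  ext1 r
  apply polyHom_injective
  rw [← coeff_seriesHom, ← coeff_seriesHom, h]

/-- For l ≥ 1, T_l(y) differentiates ŷ^m in a direction contracted with ⁅e_i, y⁆, which produces ⁅y,
y⁆ = 0. Only the term l = 0, multiplication by ŷ, survives. -/
theorem actSeries_leftOp_pow (y : g) (m : ℕ) :
    actSeries (leftOp b y) (PowerSeries.C (polyHom n (linPoly b y ^ m))) =
      PowerSeries.C (polyHom n (linPoly b y ^ (m + 1))) := by
  ext1 r
  rw [coeff_actSeries_C, leftOp, leftMul, PowerSeries.coeff_mk, PowerSeries.coeff_C]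
  cases r with
  | zero =>
    simp only [toddCoeff_zero, one_smul, if_true]
    change polyHom n (linPoly b y) * _ = _
    rw [← map_mul, pow_succ']
  | succ r =>
    simp only [Nat.succ_ne_zero, if_false]
    rw [LinearMap.smul_apply, adDerivPow_succ, LinearMap.sum_apply]
    have h : ∀ i, (adDerivPow b pderivOp (linOp b) r ⁅b i, y⁆ * pderivOp i)
        (polyHom n (linPoly b y ^ m)) =
        (adDerivPow b pderivOp (linOp b) r ⁅b i, y⁆ * coordScalar b _ i y)
          ((m : ℝ) • polyHom n (linPoly b y ^ (m - 1))) := by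
      intro i
      rw [Module.End.mul_apply, Module.End.mul_apply, pderivOp_polyHom, MvPolynomial.pderiv_pow,
        pderiv_linPoly, coordScalar_apply, Module.algebraMap_end_apply, ← map_smul, ← map_smul]
      congr 2
      rw [MvPolynomial.smul_eq_C_mul, MvPolynomial.smul_eq_C_mul]
      simp only [map_natCast]
      ring
    rw [Finset.sum_congr rfl fun i _ => h i, ← LinearMap.sum_apply, sum_lie_mul_coordScalar, lie_self,
      map_zero, LinearMap.zero_apply, smul_zero]

/-- L_y^m · 1 = ŷ^m, so acting on the constant 1 reads P off from the image of its symmetrization.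
This is the left inverse that makes symmetrization injective. -/
theorem actSeries_opSeries_one (P : Polynomial (MvPolynomial (Fin n) ℝ)) :
    actSeries (opSeries b P) (PowerSeries.C 1) = seriesHom n P := by
  induction P using polynomial_nu_induction b with
  | pow y m =>
    rw [opSeries_pow, seriesHom_C]
    induction m with
    | zero =>
      ext1 r
      rw [coeff_actSeries_C]
      by_cases hr : r = 0 <;> simp [PowerSeries.coeff_one, hr]
    | succ m ih => rw [pow_succ', actSeries_mul, ih, actSeries_leftOp_pow]
  | zero =>
    rw [opSeries_zero, map_zero]
    ext1 r
    simp [actSeries]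
  | add p q hp hq => rw [opSeries_add, actSeries_add_left, hp, hq, map_add]
  | smul c p hp => rw [opSeries_smul, actSeries_smul_left, hp, seriesHom_smul]
  | X_mul p hp => rw [opSeries_X_mul, actSeries_X_mul_left, hp, map_mul, seriesHom_X]

/-- The Poincaré–Birkhoff–Witt theorem: the symmetrization is injective. -/
theorem sigmaLin_injective : Function.Injective (sigmaLin b) := by
  intro P Q h
  apply seriesHom_injective
  rw [← actSeries_opSeries_one b, ← actSeries_opSeries_one b]
  congr 1
  exact opSeries_eq b (by rw [opSeries_spec, h])

theorem mul_mem_range_sigmaLin (P Q : Polynomial (MvPolynomial (Fin n) ℝ)) :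
    ∃ R, sigmaLin b R = sigmaLin b P * sigmaLin b Q := by
  induction P using polynomial_nu_induction b with
  | pow y m =>
    rw [← nuMul_pow]
    induction m with
    | zero => exact ⟨Q, by simp⟩
    | succ m ih =>
      obtain ⟨R, hR⟩ := ih
      rw [pow_succ', mul_assoc, ← hR]
      exact nuMul_mul_mem_range b y R
  | zero => exact ⟨0, by simp⟩
  | add p q hp hq =>
    obtain ⟨R, hR⟩ := hp
    obtain ⟨S, hS⟩ := hq
    exact ⟨R + S, by rw [map_add, map_add, hR, hS, add_mul]⟩
  | smul c p hp =>
    obtain ⟨R, hR⟩ := hp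
    exact ⟨c • R, by rw [map_smul, map_smul, hR, smul_mul_assoc]⟩
  | X_mul p hp =>
    obtain ⟨R, hR⟩ := hp
    exact ⟨Polynomial.X * R, by rw [sigmaLin_X_mul, sigmaLin_X_mul, hR, mul_assoc]⟩

theorem sigmaLin_polyStar (P Q : Polynomial (MvPolynomial (Fin n) ℝ)) :
    sigmaLin b (polyStar b P Q) = sigmaLin b P * sigmaLin b Q := by
  have : sigma b = sigmaLin b := funext fun P => (sigmaLin_apply b P).symm
  rw [polyStar, this]
  exact Function.invFun_eq (mul_mem_range_sigmaLin b P Q)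

theorem polyStar_eq {P Q R : Polynomial (MvPolynomial (Fin n) ℝ)}
    (h : sigmaLin b R = sigmaLin b P * sigmaLin b Q) : polyStar b P Q = R :=
  sigmaLin_injective b (by rw [sigmaLin_polyStar, h])

theorem opSeries_polyStar (P Q : Polynomial (MvPolynomial (Fin n) ℝ)) :
    opSeries b (polyStar b P Q) = opSeries b P * opSeries b Q :=
  opSeries_eq b (by rw [sigmaLin_polyStar, map_mul, map_mul, opSeries_spec, opSeries_spec])

theorem seriesHom_polyStar (P Q : Polynomial (MvPolynomial (Fin n) ℝ)) :
    seriesHom n (polyStar b P Q) = actSeries (opSeries b P) (seriesHom n Q) := by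
  rw [← actSeries_opSeries_one b, opSeries_polyStar, actSeries_mul, actSeries_opSeries_one]

/-- The operator series of right star multiplication by `ŷ`. -/
def rightOp (y : g) : PowerSeries (Module.End ℝ (smoothFn n)) :=
  leftOp b y + PowerSeries.X * PowerSeries.C (adDerivPow b pderivOp (linOp b) 1 y)

theorem polyHom_adPoly (y : g) (p : MvPolynomial (Fin n) ℝ) :
    polyHom n (adPoly b y p) = -adDerivPow b pderivOp (linOp b) 1 y (polyHom n p) := by
  rw [adPoly_apply, map_sum, adDerivPow_succ, LinearMap.sum_apply, ← Finset.sum_neg_distrib]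
  refine Finset.sum_congr rfl fun j _ => ?_
  rw [map_mul, Module.End.mul_apply, pderivOp_polyHom]
  change _ = -(linOp b ⁅b j, y⁆ _)
  rw [linOp_apply, ← lie_skew, map_neg, map_neg, neg_mul]

theorem polyStar_linPoly_right (p : MvPolynomial (Fin n) ℝ) (y : g) :
    polyStar b (Polynomial.C p) (Polynomial.C (linPoly b y)) =
      polyStar b (Polynomial.C (linPoly b y)) (Polynomial.C p) -
        Polynomial.X * Polynomial.C (adPoly b y p) := by
  apply polyStar_eq
  have hy := nuMul_pow b y 1
  rw [pow_one, pow_one] at hy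
  rw [map_sub, sigmaLin_polyStar, sigmaLin_X_mul, ← hy, sigmaLin_C, sigmaLin_C, ← nuMul_commutator]
  abel

theorem seriesHom_polyStar_right (P : Polynomial (MvPolynomial (Fin n) ℝ)) (y : g) :
    seriesHom n (polyStar b P (Polynomial.C (linPoly b y))) =
      actSeries (rightOp b y) (seriesHom n P) := by
  have hadd : ∀ P P' Q, polyStar b (P + P') Q = polyStar b P Q + polyStar b P' Q := fun P P' Q =>
    polyStar_eq b (by rw [map_add, sigmaLin_polyStar, sigmaLin_polyStar, map_add, add_mul])
  have hX : ∀ P Q, polyStar b (Polynomial.X * P) Q = Polynomial.X * polyStar b P Q := fun P Q =>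
    polyStar_eq b (by rw [sigmaLin_X_mul, sigmaLin_X_mul, sigmaLin_polyStar, mul_assoc])
  induction P using Polynomial.induction_on' with
  | add p q hp hq => rw [hadd, map_add, hp, hq, map_add, actSeries_add_right]
  | monomial r p =>
    induction r with
    | zero =>
      rw [Polynomial.monomial_zero_left, polyStar_linPoly_right, map_sub, seriesHom_polyStar,
        rightOp, actSeries_add_left, map_mul, seriesHom_X, seriesHom_C, seriesHom_C, polyHom_adPoly,
        actSeries_X_mul_left, sub_eq_add_neg, ← mul_neg, ← map_neg, neg_neg]
      congr 2
      · have := opSeries_pow b y 1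
        rw [pow_one, pow_one] at this
        rw [this]
      · ext1 r
        rw [coeff_actSeries_C, PowerSeries.coeff_C, PowerSeries.coeff_C]
        split_ifs <;> rfl
    | succ r ih =>
      rw [← Polynomial.X_mul_monomial, hX, map_mul, ih, map_mul, seriesHom_X, actSeries_X_mul_right]

/-- ŷ^m is the m-th star power of ŷ, so associativity reduces right multiplication by it to m
applications of `rightOp`. -/
theorem seriesHom_polyStar_pow (P : Polynomial (MvPolynomial (Fin n) ℝ)) (y : g) (m : ℕ) :
    seriesHom n (polyStar b P (Polynomial.C (linPoly b y ^ m))) =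
      actSeries (rightOp b y ^ m) (seriesHom n P) := by
  induction m generalizing P with
  | zero =>
    rw [pow_zero, pow_zero, show polyStar b P (Polynomial.C 1) = P from polyStar_eq b (by
      rw [← pow_zero (linPoly b y), ← nuMul_pow, pow_zero, mul_one])]
    ext1 r
    rw [actSeries, PowerSeries.coeff_mk, Finset.sum_eq_single (0, r)]
    · simp
    · rintro ⟨i, j⟩ h1 h2
      rw [Finset.HasAntidiagonal.mem_antidiagonal] at h1
      have : i ≠ 0 := by
        rintro rfl
        exact h2 (by simpa using h1)
      simp [PowerSeries.coeff_one, this]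
    · simp
  | succ m ih =>
    have : polyStar b P (Polynomial.C (linPoly b y ^ (m + 1))) =
        polyStar b (polyStar b P (Polynomial.C (linPoly b y))) (Polynomial.C (linPoly b y ^ m)) := by
      apply polyStar_eq
      have hy := nuMul_pow b y 1
      rw [pow_one, pow_one] at hy
      rw [sigmaLin_polyStar, sigmaLin_polyStar, ← nuMul_pow, ← nuMul_pow, ← hy, pow_succ', mul_assoc]
    rw [this, ih, seriesHom_polyStar_right, ← actSeries_mul, ← pow_succ]

end Operators

/-! ### C_r on smooth functions: order bounds, low orders, commutators with powers -/

section Bidifferential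

variable {n : ℕ} {g : Type*} [LieRing g] [LieAlgebra ℝ g] (b : Module.Basis (Fin n) ℝ g)

/-- Operator series `∑ ν^r D_r` such that `D_r` has order at most `r`. -/
def IsGraded (E : PowerSeries (Module.End ℝ (smoothFn n))) : Prop :=
  ∀ r, PowerSeries.coeff r E ∈ orderLE n r

namespace IsGraded

variable {E F : PowerSeries (Module.End ℝ (smoothFn n))}

theorem add (hE : IsGraded E) (hF : IsGraded F) : IsGraded (E + F) := fun r => by
  rw [map_add]
  exact Submodule.add_mem _ (hE r) (hF r)

theorem smul (hE : IsGraded E) (c : ℝ) : IsGraded (c • E) := fun r => by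
  rw [coeff_smul_series]
  exact Submodule.smul_mem _ _ (hE r)

theorem mul (hE : IsGraded E) (hF : IsGraded F) : IsGraded (E * F) := fun r => by
  rw [PowerSeries.coeff_mul]
  refine Submodule.sum_mem _ fun p hp => ?_
  rw [← Finset.HasAntidiagonal.mem_antidiagonal.1 hp]
  exact mul_mem_orderLE (hE _) (hF _)

theorem one : IsGraded (1 : PowerSeries (Module.End ℝ (smoothFn n))) := fun r => by
  rw [PowerSeries.coeff_one]
  split_ifs with h
  · exact fun ξ k f hf => vanishing_antitone ξ (Nat.le_add_right _ _) hf
  · exact Submodule.zero_mem _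

theorem zero : IsGraded (0 : PowerSeries (Module.End ℝ (smoothFn n))) := fun r => by
  rw [map_zero]
  exact Submodule.zero_mem _

theorem pow (hE : IsGraded E) (m : ℕ) : IsGraded (E ^ m) := by
  induction m with
  | zero => exact one
  | succ m ih => exact ih.mul hE

end IsGraded

theorem adDerivPow_mem_orderLE (l : ℕ) (x : g) :
    adDerivPow b pderivOp (linOp b) l x ∈ orderLE n l := by
  induction l generalizing x with
  | zero => exact mulLeft_mem_orderLE _
  | succ l ih =>
    rw [adDerivPow_succ]
    exact Submodule.sum_mem _ fun i _ => mul_mem_orderLE (ih _) (pderivOp_mem_orderLE i)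

theorem isGraded_leftOp (x : g) : IsGraded (leftOp b x) := fun r => by
  rw [leftOp, leftMul, PowerSeries.coeff_mk]
  exact Submodule.smul_mem _ _ (adDerivPow_mem_orderLE b r x)

theorem isGraded_rightOp (x : g) : IsGraded (rightOp b x) := by
  refine (isGraded_leftOp b x).add fun r => ?_
  cases r with
  | zero => 
    rw [PowerSeries.coeff_zero_X_mul]
    exact Submodule.zero_mem _
  | succ r =>
    rw [PowerSeries.coeff_succ_X_mul, PowerSeries.coeff_C]
    split_ifs with h
    · rw [h]
      exact adDerivPow_mem_orderLE b 1 x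
    · exact Submodule.zero_mem _

/-- The operator series of left star multiplication by a polynomial. -/
abbrev leftSeries (p : MvPolynomial (Fin n) ℝ) : PowerSeries (Module.End ℝ (smoothFn n)) :=
  opSeries b (Polynomial.C p)

theorem leftSeries_add (p q : MvPolynomial (Fin n) ℝ) :
    leftSeries b (p + q) = leftSeries b p + leftSeries b q := by
  rw [leftSeries, Polynomial.C_add, opSeries_add]

theorem leftSeries_smul (c : ℝ) (p : MvPolynomial (Fin n) ℝ) :
    leftSeries b (c • p) = c • leftSeries b p := by
  rw [leftSeries, ← Polynomial.smul_C, opSeries_smul]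

theorem leftSeries_pow (y : g) (m : ℕ) : leftSeries b (linPoly b y ^ m) = leftOp b y ^ m :=
  opSeries_pow b y m

theorem isGraded_leftSeries (p : MvPolynomial (Fin n) ℝ) : IsGraded (leftSeries b p) := by
  induction p using polynomial_linPoly_induction b with
  | pow y m => rw [leftSeries_pow]; exact (isGraded_leftOp b y).pow m
  | zero => rw [leftSeries, map_zero, opSeries_zero]; exact IsGraded.zero
  | add p q hp hq => rw [leftSeries_add]; exact hp.add hq
  | smul c p hp => rw [leftSeries_smul]; exact hp.smul c

/-- The bilinear operator `C_r` on polynomials. -/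
def polyCoeff (r : ℕ) (p q : MvPolynomial (Fin n) ℝ) : MvPolynomial (Fin n) ℝ :=
  (polyStar b (Polynomial.C p) (Polynomial.C q)).coeff r

theorem polyCoeff_add_left (r : ℕ) (p p' q : MvPolynomial (Fin n) ℝ) :
    polyCoeff b r (p + p') q = polyCoeff b r p q + polyCoeff b r p' q := by
  rw [polyCoeff, polyCoeff, polyCoeff, ← Polynomial.coeff_add]
  congr 1
  exact polyStar_eq b (by simp only [map_add, sigmaLin_polyStar, add_mul])

theorem polyCoeff_add_right (r : ℕ) (p q q' : MvPolynomial (Fin n) ℝ) :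
    polyCoeff b r p (q + q') = polyCoeff b r p q + polyCoeff b r p q' := by
  rw [polyCoeff, polyCoeff, polyCoeff, ← Polynomial.coeff_add]
  congr 1
  exact polyStar_eq b (by simp only [map_add, sigmaLin_polyStar, mul_add])

theorem polyCoeff_smul_left (r : ℕ) (c : ℝ) (p q : MvPolynomial (Fin n) ℝ) :
    polyCoeff b r (c • p) q = c • polyCoeff b r p q := by
  rw [polyCoeff, polyCoeff, ← Polynomial.coeff_smul]
  congr 1
  exact polyStar_eq b (by
    rw [← Polynomial.smul_C, map_smul, map_smul, sigmaLin_polyStar, smul_mul_assoc])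

theorem polyCoeff_smul_right (r : ℕ) (c : ℝ) (p q : MvPolynomial (Fin n) ℝ) :
    polyCoeff b r p (c • q) = c • polyCoeff b r p q := by
  rw [polyCoeff, polyCoeff, ← Polynomial.coeff_smul]
  congr 1
  exact polyStar_eq b (by
    rw [← Polynomial.smul_C, map_smul, map_smul, sigmaLin_polyStar, mul_smul_comm])

theorem polyHom_polyCoeff (r : ℕ) (p q : MvPolynomial (Fin n) ℝ) :
    polyHom n (polyCoeff b r p q) = PowerSeries.coeff r (leftSeries b p) (polyHom n q) := by
  rw [polyCoeff, ← coeff_seriesHom, seriesHom_polyStar, seriesHom_C, coeff_actSeries_C]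

/-- Powers of linear forms span, and for ŷ^m the series is the m-th power of `rightOp`. The order
bound for the first argument of C_r comes from here. -/
theorem exists_rightSeries (q : MvPolynomial (Fin n) ℝ) :
    ∃ E, IsGraded E ∧ ∀ p r, polyHom n (polyCoeff b r p q) = PowerSeries.coeff r E (polyHom n p) := by
  induction q using polynomial_linPoly_induction b with
  | pow y m =>
    refine ⟨rightOp b y ^ m, (isGraded_rightOp b y).pow m, fun p r => ?_⟩
    rw [polyCoeff, ← coeff_seriesHom, seriesHom_polyStar_pow, seriesHom_C, coeff_actSeries_C]
  | zero =>
    refine ⟨0, IsGraded.zero, fun p r => ?_⟩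
    have := polyCoeff_smul_right b r 0 p 0
    rw [zero_smul, zero_smul] at this
    rw [this]
    simp
  | add q q' hq hq' =>
    obtain ⟨E, hE, h⟩ := hq
    obtain ⟨E', hE', h'⟩ := hq'
    refine ⟨E + E', hE.add hE', fun p r => ?_⟩
    rw [polyCoeff_add_right, map_add, h, h', map_add, LinearMap.add_apply]
  | smul c q hq =>
    obtain ⟨E, hE, h⟩ := hq
    refine ⟨c • E, hE.smul c, fun p r => ?_⟩
    rw [polyCoeff_smul_right, map_smul, h, coeff_smul_series, LinearMap.smul_apply]

/-- The operator series of right star multiplication by a polynomial. -/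
def rightSeries (q : MvPolynomial (Fin n) ℝ) : PowerSeries (Module.End ℝ (smoothFn n)) :=
  (exists_rightSeries b q).choose

theorem isGraded_rightSeries (q : MvPolynomial (Fin n) ℝ) : IsGraded (rightSeries b q) :=
  (exists_rightSeries b q).choose_spec.1

theorem polyHom_polyCoeff' (r : ℕ) (p q : MvPolynomial (Fin n) ℝ) :
    polyHom n (polyCoeff b r p q) = PowerSeries.coeff r (rightSeries b q) (polyHom n p) :=
  (exists_rightSeries b q).choose_spec.2 p r

/-- An operator of order at most r sees only r-jets, and every r-jet is that of a polynomial. -/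
theorem IsGraded.ext_polyHom {E F : PowerSeries (Module.End ℝ (smoothFn n))} (hE : IsGraded E)
    (hF : IsGraded F) (h : ∀ r p, PowerSeries.coeff r E (polyHom n p) =
      PowerSeries.coeff r F (polyHom n p)) : E = F := by
  ext1 r
  refine LinearMap.ext fun f => Subtype.ext (funext fun ξ => ?_)
  have ht := taylorPoly_sub_mem_vanishing f r ξ
  rw [← apply_eq_of_sub_mem_vanishing (hE r) ht, ← apply_eq_of_sub_mem_vanishing (hF r) ht, h]

theorem rightSeries_pow (y : g) (m : ℕ) : rightSeries b (linPoly b y ^ m) = rightOp b y ^ m := by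
  refine (isGraded_rightSeries b _).ext_polyHom ((isGraded_rightOp b y).pow m) fun r p => ?_
  rw [← polyHom_polyCoeff', polyCoeff, ← coeff_seriesHom, seriesHom_polyStar_pow, seriesHom_C,
    coeff_actSeries_C]

theorem bchCoeff_apply (r : ℕ) (f h : Fn n) (ξ : Fin n → ℝ) :
    bchCoeff b r f h ξ =
      (polyHom n (polyCoeff b r (taylorPoly r ξ f) (taylorPoly r ξ h)) : Fn n) ξ := rfl

/-- The two Taylor polynomials are replaced by the true arguments one at a time: the first by the
order bound of right multiplication, the second by that of left multiplication. -/
theorem bchCoeff_polyFn_left (r : ℕ) (p : MvPolynomial (Fin n) ℝ) (h : smoothFn n) :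
    bchCoeff b r (polyFn p) h = (PowerSeries.coeff r (leftSeries b p) h : smoothFn n) := by
  ext ξ
  rw [bchCoeff_apply, polyHom_polyCoeff', ← coe_polyHom p,
    apply_eq_of_sub_mem_vanishing (isGraded_rightSeries b _ r)
    (taylorPoly_sub_mem_vanishing (polyHom n p) r ξ), ← polyHom_polyCoeff', polyHom_polyCoeff,
    apply_eq_of_sub_mem_vanishing (isGraded_leftSeries b _ r) (taylorPoly_sub_mem_vanishing h r ξ)]

theorem bchCoeff_polyFn_right (r : ℕ) (h : smoothFn n) (q : MvPolynomial (Fin n) ℝ) :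
    bchCoeff b r h (polyFn q) = (PowerSeries.coeff r (rightSeries b q) h : smoothFn n) := by
  ext ξ
  rw [bchCoeff_apply, polyHom_polyCoeff, ← coe_polyHom q,
    apply_eq_of_sub_mem_vanishing (isGraded_leftSeries b _ r)
    (taylorPoly_sub_mem_vanishing (polyHom n q) r ξ), ← polyHom_polyCoeff, polyHom_polyCoeff',
    apply_eq_of_sub_mem_vanishing (isGraded_rightSeries b _ r) (taylorPoly_sub_mem_vanishing h r ξ)]

theorem taylorHom_zero_fn (k : ℕ) (ξ : Fin n → ℝ) : taylorHom k ξ (0 : Fn n) = 0 := by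
  have : (0 : Fn n) = fun _ => 0 := rfl
  simp [taylorHom, this]

theorem taylorPoly_zero_fn (r : ℕ) (ξ : Fin n → ℝ) : taylorPoly r ξ (0 : Fn n) = 0 := by
  simp [taylorPoly_eq_sum, taylorHom_zero_fn]

theorem polyCoeff_zero_left (r : ℕ) (q : MvPolynomial (Fin n) ℝ) : polyCoeff b r 0 q = 0 := by
  have := polyCoeff_smul_left b r 0 0 q
  rwa [zero_smul, zero_smul] at this

theorem polyCoeff_zero_right (r : ℕ) (p : MvPolynomial (Fin n) ℝ) : polyCoeff b r p 0 = 0 := by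
  have := polyCoeff_smul_right b r 0 p 0
  rwa [zero_smul, zero_smul] at this

theorem bchCoeff_zero_left (r : ℕ) (h : Fn n) : bchCoeff b r 0 h = 0 := by
  ext ξ
  rw [bchCoeff_apply, taylorPoly_zero_fn, polyCoeff_zero_left, map_zero]
  rfl

theorem bchCoeff_zero_right (r : ℕ) (f : Fn n) : bchCoeff b r f 0 = 0 := by
  ext ξ
  rw [bchCoeff_apply, taylorPoly_zero_fn, polyCoeff_zero_right, map_zero]
  rfl

theorem coeff_star_C (f h : Fn n) (m : ℕ) :
    PowerSeries.coeff m (star b (PowerSeries.C f) (PowerSeries.C h)) = bchCoeff b m f h := by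
  rw [star, PowerSeries.coeff_mk, Finset.sum_eq_single (m, 0)]
  · simp
  · rintro ⟨i, j⟩ h1 h2
    refine Finset.sum_eq_zero ?_
    rintro ⟨k, l⟩ h3
    rw [Finset.HasAntidiagonal.mem_antidiagonal] at h1 h3
    simp only at h1 h3
    rw [PowerSeries.coeff_C, PowerSeries.coeff_C]
    split_ifs with hk hl hl
    · exact absurd (Prod.ext (by simp only; omega) (by simp only; omega)) h2
    · exact bchCoeff_zero_right b _ _
    · exact bchCoeff_zero_left b _ _
    · exact bchCoeff_zero_left b _ _
  · simp

theorem coeff_starComm_C (f h : Fn n) (m : ℕ) :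
    PowerSeries.coeff m (starComm b (PowerSeries.C f) (PowerSeries.C h)) =
      bchCoeff b m f h - bchCoeff b m h f := by
  rw [starComm, map_sub, coeff_star_C, coeff_star_C]

theorem polyCoeff_C_left (r : ℕ) (a : ℝ) (q : MvPolynomial (Fin n) ℝ) :
    polyCoeff b r (MvPolynomial.C a) q = if r = 0 then a • q else 0 := by
  apply polyHom_injective
  have h1 : (MvPolynomial.C a : MvPolynomial (Fin n) ℝ) = a • linPoly b 0 ^ 0 := by
    rw [pow_zero, MvPolynomial.smul_eq_C_mul, mul_one]
  rw [polyHom_polyCoeff, h1, leftSeries_smul, leftSeries_pow, pow_zero, coeff_smul_series,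
    PowerSeries.coeff_one]
  split_ifs
  · rw [map_smul]; rfl
  · simp

theorem polyCoeff_C_right (r : ℕ) (a : ℝ) (p : MvPolynomial (Fin n) ℝ) :
    polyCoeff b r p (MvPolynomial.C a) = if r = 0 then a • p else 0 := by
  apply polyHom_injective
  have h1 : (MvPolynomial.C a : MvPolynomial (Fin n) ℝ) = a • linPoly b 0 ^ 0 := by
    rw [pow_zero, MvPolynomial.smul_eq_C_mul, mul_one]
  rw [h1, polyCoeff_smul_right, map_smul, polyHom_polyCoeff', rightSeries_pow, pow_zero,
    PowerSeries.coeff_one]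
  split_ifs
  · rw [map_smul]; rfl
  · simp

/-- `C_0` is the pointwise product. -/
theorem bchCoeff_zero (f h : Fn n) : bchCoeff b 0 f h = f * h := by
  ext ξ
  have ht : ∀ f : Fn n, taylorPoly 0 ξ f = MvPolynomial.C (f ξ) := by
    intro f
    rw [taylorPoly_eq_sum]
    simp [taylorHom_zero]
  rw [bchCoeff_apply, ht, ht, polyCoeff_C_left, if_pos rfl]
  simp

theorem polyFn_linPoly (x : g) : polyFn (linPoly b x) = linearFn b x := by
  ext ξ
  simp [polyFn, linPoly_apply, linearFn]

theorem polyCoeff_one_linPoly (x z : g) :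
    polyCoeff b 1 (linPoly b x) (linPoly b z) = (1 / 2 : ℝ) • linPoly b ⁅x, z⁆ := by
  apply polyHom_injective
  have h := leftSeries_pow b x 1
  rw [pow_one, pow_one] at h
  have h2 := polyHom_adPoly b x (linPoly b z)
  have h3 := adPoly_pow b x z 1
  rw [pow_one, Nat.sub_self, pow_zero, mul_one, Nat.cast_one, one_smul] at h3
  rw [polyHom_polyCoeff, h, leftOp, leftMul, PowerSeries.coeff_mk, toddCoeff_one,
    LinearMap.smul_apply, ← neg_eq_iff_eq_neg.2 h2, h3, smul_neg, map_smul, ← neg_smul]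
  norm_num

theorem taylorPoly_one {f : Fn n} (hf : ContDiff ℝ ∞ f) (ξ : Fin n → ℝ) :
    ∃ c : ℝ, taylorPoly 1 ξ f = MvPolynomial.C c + linPoly b (∑ i, pderiv i f ξ • b i) := by
  refine ⟨f ξ - ∑ i, pderiv i f ξ * ξ i, ?_⟩
  rw [taylorPoly_eq_sum, Finset.sum_range_succ, Finset.sum_range_one, taylorHom_zero,
    taylorHom_succ hf]
  simp only [taylorHom_zero, Nat.factorial, Nat.cast_one, inv_one, map_one, one_mul, map_sub,
    map_sum, map_smul, linPoly_basis, MvPolynomial.smul_eq_C_mul, map_mul, mul_one]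
  rw [sub_add, ← Finset.sum_sub_distrib, sub_eq_add_neg, ← Finset.sum_neg_distrib]
  congr 1
  refine Finset.sum_congr rfl fun i _ => ?_
  ring

/-- The antisymmetric part of `C_1` is the Poisson bracket. -/
theorem bchCoeff_one_sub {f h : Fn n} (hf : ContDiff ℝ ∞ f) (hh : ContDiff ℝ ∞ h) :
    bchCoeff b 1 f h - bchCoeff b 1 h f = poisson b f h := by
  ext ξ
  obtain ⟨c, hc⟩ := taylorPoly_one b hf ξ
  obtain ⟨e, he⟩ := taylorPoly_one b hh ξ
  rw [Pi.sub_apply, bchCoeff_apply, bchCoeff_apply, hc, he]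
  simp only [polyCoeff_add_left, polyCoeff_add_right, polyCoeff_C_left, polyCoeff_C_right,
    one_ne_zero, if_false, zero_add, polyCoeff_one_linPoly]
  -- C_1 ignores constants, so only the differentials of f and h at ξ matter, read as elements x and
  -- z of g.
  set x := ∑ i, pderiv i f ξ • b i with hx
  set z := ∑ i, pderiv i h ξ • b i with hz
  rw [← lie_skew z x]
  simp only [map_neg, map_smul, smul_neg]
  have h1 : (polyHom n (linPoly b ⁅x, z⁆) : Fn n) ξ = poisson b f h ξ := by
    let L : g →ₗ[ℝ] ℝ := (MvPolynomial.aeval ξ).toLinearMap ∘ₗ linPoly b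
    have hL : ∀ y, L y = linearFn b y ξ := fun y => congrFun (polyFn_linPoly b y) ξ
    change L ⁅x, z⁆ = _
    simp only [hx, hz, sum_lie, lie_sum, smul_lie, lie_smul, map_sum, map_smul]
    simp only [hL, poisson, smul_eq_mul, linearFn, Finset.mul_sum]
    rw [Finset.sum_comm]
    refine Finset.sum_congr rfl fun i _ => Finset.sum_congr rfl fun j _ =>
      Finset.sum_congr rfl fun k _ => ?_
    ring
  rw [← h1]
  change (1 / 2 : ℝ) * _ - -((1 / 2 : ℝ) * _) = _
  ring

/-- The operator `{x̂, ·}`. -/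
theorem poisson_linearFn (x : g) (h : smoothFn n) :
    poisson b (linearFn b x) h = (-adDerivPow b pderivOp (linOp b) 1 x h : smoothFn n) := by
  have hx : ContDiff ℝ ∞ (linearFn b x) := by
    rw [← polyFn_linPoly]; exact contDiff_polyFn _
  rw [← bchCoeff_one_sub b hx h.2, ← polyFn_linPoly, bchCoeff_polyFn_left, bchCoeff_polyFn_right]
  have h1 := leftSeries_pow b x 1
  have h2 := rightSeries_pow b x 1
  rw [pow_one, pow_one] at h1 h2
  rw [h1, h2, rightOp, map_add, PowerSeries.coeff_succ_X_mul, PowerSeries.coeff_zero_C,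
    LinearMap.add_apply]
  ext ξ
  simp

/-- The star commutator with a power of `ŷ`. -/
theorem bchCoeff_pow_sub (y : g) (m s : ℕ) (h : smoothFn n) :
    bchCoeff b s (polyFn (linPoly b y ^ m)) h - bchCoeff b s h (polyFn (linPoly b y ^ m)) =
      (PowerSeries.coeff s (leftOp b y ^ m - rightOp b y ^ m) h : smoothFn n) := by
  rw [bchCoeff_polyFn_left, bchCoeff_polyFn_right, leftSeries_pow, rightSeries_pow, map_sub,
    LinearMap.sub_apply]
  rfl

/-- R_y differs from L_y by ν T_1(y), and T_1(y) commutes with every T_r(y) because ⁅y, y⁆ = 0.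
Commutation is what lets L^m - R^m factor through L - R. -/
theorem commute_leftOp_rightOp (y : g) : Commute (leftOp b y) (rightOp b y) := by
  have hC : Commute (leftOp b y) (PowerSeries.C (adDerivPow b pderivOp (linOp b) 1 y)) := by
    refine PowerSeries.ext fun r => ?_
    have h := (isWeyl_smoothFn b).adDerivPow_one_commutator y y r
    rw [lie_self, map_zero, neg_zero, sub_eq_zero] at h
    rw [PowerSeries.coeff_mul_C, PowerSeries.coeff_C_mul, leftOp, leftMul, PowerSeries.coeff_mk,
      smul_mul_assoc, mul_smul_comm, h]
  rw [rightOp]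
  generalize leftOp b y = A at *
  generalize PowerSeries.C (adDerivPow b pderivOp (linOp b) 1 y) = B at *
  exact (Commute.refl A).add_right ((PowerSeries.commute_X A).mul_right hC)

end Bidifferential

/-! ### Iterated partial derivatives and the topology of smooth functions -/

section Words

variable {n : ℕ}

/-- Iterated partial derivatives. -/
def wordDeriv : List (Fin n) → Fn n → Fn n
  | [], f => f
  | i :: w, f => wordDeriv w (pderiv i f)

theorem wordDeriv_cons (i : Fin n) (w : List (Fin n)) (f : Fn n) :
    wordDeriv (i :: w) f = wordDeriv w (pderiv i f) := rfl

theorem contDiff_wordDeriv {f : Fn n} (hf : ContDiff ℝ ∞ f) (w : List (Fin n)) :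
    ContDiff ℝ ∞ (wordDeriv w f) := by
  induction w generalizing f with
  | nil => exact hf
  | cons i w ih => exact ih (contDiff_pderiv hf i)

theorem wordDeriv_add {f h : Fn n} (hf : ContDiff ℝ ∞ f) (hh : ContDiff ℝ ∞ h)
    (w : List (Fin n)) : wordDeriv w (f + h) = wordDeriv w f + wordDeriv w h := by
  induction w generalizing f h with
  | nil => rfl
  | cons i w ih =>
    rw [wordDeriv_cons, pderiv_add hf hh, ih (contDiff_pderiv hf i) (contDiff_pderiv hh i)]
    rfl

theorem wordDeriv_smul {f : Fn n} (hf : ContDiff ℝ ∞ f) (c : ℝ) (w : List (Fin n)) :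
    wordDeriv w (c • f) = c • wordDeriv w f := by
  induction w generalizing f with
  | nil => rfl
  | cons i w ih =>
    rw [wordDeriv_cons, pderiv_smul hf, ih (contDiff_pderiv hf i)]
    rfl

theorem pderiv_congr {f h : Fn n} {ξ : Fin n → ℝ} (hfh : f =ᶠ[𝓝 ξ] h) (i : Fin n) :
    pderiv i f =ᶠ[𝓝 ξ] pderiv i h :=
  hfh.fderiv.mono fun η hη => by rw [pderiv, pderiv, hη]

theorem wordDeriv_congr {f h : Fn n} {ξ : Fin n → ℝ} (hfh : f =ᶠ[𝓝 ξ] h) (w : List (Fin n)) :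
    wordDeriv w f =ᶠ[𝓝 ξ] wordDeriv w h := by
  induction w generalizing f h with
  | nil => exact hfh
  | cons i w ih => exact ih (pderiv_congr hfh i)

theorem tsupport_pderiv_subset (f : Fn n) (i : Fin n) : tsupport (pderiv i f) ⊆ tsupport f :=
  closure_minimal (fun ξ hξ => support_fderiv_subset ℝ fun h => hξ (by
    rw [pderiv, h]; rfl)) (isClosed_tsupport f)

theorem exists_wordDeriv_eq (k : ℕ) (i : Fin k → Fin n) : ∃ w : List (Fin n),
    ∀ f, ContDiff ℝ ∞ f → ∀ ξ,
      iteratedFDeriv ℝ k f ξ (fun j => Pi.single (i j) 1) = wordDeriv w f ξ := by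
  induction k with
  | zero => exact ⟨[], fun f hf ξ => by rw [iteratedFDeriv_zero_apply]; rfl⟩
  | succ k ih =>
    obtain ⟨w, hw⟩ := ih (Fin.init i)
    refine ⟨i (Fin.last k) :: w, fun f hf ξ => ?_⟩
    rw [wordDeriv_cons, ← hw _ (contDiff_pderiv hf _), ← iteratedFDeriv_succ_pderiv hf,
      Fin.snoc_init_self]

theorem exists_iteratedFDeriv_eq (w : List (Fin n)) : ∃ (k : ℕ) (i : Fin k → Fin n),
    ∀ f, ContDiff ℝ ∞ f → ∀ ξ,
      iteratedFDeriv ℝ k f ξ (fun j => Pi.single (i j) 1) = wordDeriv w f ξ := by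
  induction w with
  | nil => exact ⟨0, Fin.elim0, fun f hf ξ => by rw [iteratedFDeriv_zero_apply]; rfl⟩
  | cons a w ih =>
    obtain ⟨k, i, h⟩ := ih
    refine ⟨k + 1, Fin.snoc i a, fun f hf ξ => ?_⟩
    rw [wordDeriv_cons, ← h _ (contDiff_pderiv hf _), ← iteratedFDeriv_succ_pderiv hf]

theorem norm_multilinear_le_sum (k : ℕ)
    (M : ContinuousMultilinearMap ℝ (fun _ : Fin k => Fin n → ℝ) ℝ) :
    ‖M‖ ≤ ∑ i : Fin k → Fin n, |M fun j => Pi.single (i j) 1| := by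
  refine ContinuousMultilinearMap.opNorm_le_bound (by positivity) fun v => ?_
  have h1 : M v = ∑ i : Fin k → Fin n, (∏ j, v j (i j)) * M fun j => Pi.single (i j) 1 := by
    have h2 : v = fun j => ∑ a, v j a • (Pi.single a 1 : Fin n → ℝ) := by
      ext j a
      simp [Finset.sum_apply, Pi.single_apply]
    conv_lhs => rw [h2]
    rw [M.map_sum]
    refine Finset.sum_congr rfl fun i _ => ?_
    rw [M.map_smul_univ, smul_eq_mul]
  rw [h1, Finset.sum_mul]
  refine (norm_sum_le _ _).trans (Finset.sum_le_sum fun i _ => ?_)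
  rw [norm_mul, mul_comm, Real.norm_eq_abs, norm_prod]
  refine mul_le_mul_of_nonneg_left (Finset.prod_le_prod (fun _ _ => norm_nonneg _) fun j _ =>
    norm_le_pi_norm _ _) (abs_nonneg _)

/-- The norm of a k-linear form is at most the sum of its absolute values on basis tuples, and for
each k there are finitely many of these. -/
theorem smoothTendsto_iff {F : ℕ → Fn n} {f : Fn n} (hF : ∀ m, ContDiff ℝ ∞ (F m))
    (hf : ContDiff ℝ ∞ f) : SmoothTendsto F f ↔ ∀ w : List (Fin n), ∀ K, IsCompact K →
      TendstoUniformlyOn (fun m => wordDeriv w (F m)) (wordDeriv w f) atTop K := by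
  constructor
  · intro h w K hK
    obtain ⟨k, i, hw⟩ := exists_iteratedFDeriv_eq w
    have h1 := (ContinuousMultilinearMap.apply ℝ (fun _ : Fin k => Fin n → ℝ) ℝ
      (fun j => Pi.single (i j) 1)).uniformContinuous.comp_tendstoUniformlyOn (h k K hK)
    refine (h1.congr (Eventually.of_forall fun m ξ _ => ?_)).congr_right fun ξ _ => ?_
    · exact hw _ (hF m) ξ
    · exact hw _ hf ξ
  · intro h k K hK
    rw [Metric.tendstoUniformlyOn_iff]
    intro ε hε
    choose w hw using fun i : Fin k → Fin n => exists_wordDeriv_eq k i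
    have hN : 0 < (Fintype.card (Fin k → Fin n) : ℝ) + 1 := by positivity
    have h1 : ∀ᶠ m in atTop, ∀ i : Fin k → Fin n, ∀ ξ ∈ K,
        dist (wordDeriv (w i) f ξ) (wordDeriv (w i) (F m) ξ) <
          ε / (Fintype.card (Fin k → Fin n) + 1) := by
      rw [eventually_all]
      exact fun i => Metric.tendstoUniformlyOn_iff.1 (h (w i) K hK) _ (div_pos hε hN)
    filter_upwards [h1] with m hm ξ hξ
    rw [dist_eq_norm]
    refine (norm_multilinear_le_sum k _).trans_lt ?_
    calc _ ≤ ∑ i : Fin k → Fin n, ε / ((Fintype.card (Fin k → Fin n) : ℝ) + 1) := by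
          refine Finset.sum_le_sum fun i _ => ?_
          rw [sub_apply, hw i f hf, hw i _ (hF m), ← Real.dist_eq]
          exact (hm i ξ hξ).le
      _ < ε := by
          rw [Finset.sum_const, Finset.card_univ, nsmul_eq_mul, ← mul_div_assoc, div_lt_iff₀ hN]
          nlinarith

end Words

/-! ### Density of polynomials in the smooth topology -/

section Density

variable {n : ℕ}

/-- Landau kernels: normalized powers of 1 - |z|²/M concentrate at their unique maximum z = 0. -/
theorem exists_polynomial_peak (R : ℝ) (hR : 0 < R) : ∃ q : ℕ → MvPolynomial (Fin n) ℝ,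
    (∀ m, ∀ z ∈ Metric.closedBall (0 : Fin n → ℝ) R, 0 ≤ polyFn (q m) z) ∧
    (∀ m, ∫ z in Metric.closedBall (0 : Fin n → ℝ) R, polyFn (q m) z = 1) ∧
    Tendsto (fun m => ∫ z in Metric.closedBall (0 : Fin n → ℝ) R, polyFn (q m) z * ‖z‖)
      atTop (𝓝 0) := by
  set Q := Metric.closedBall (0 : Fin n → ℝ) R with hQ
  -- On the sup-norm ball ∑ z_i² ≤ n R², so this M keeps the base 1 - ∑ z_i² / M at least 1/2.
  set M : ℝ := 2 * (n * R ^ 2) + 1 with hM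
  have hMpos : 0 < M := by positivity
  let c : MvPolynomial (Fin n) ℝ := 1 - MvPolynomial.C M⁻¹ * ∑ i, MvPolynomial.X i ^ 2
  have hc : ∀ z, polyFn c z = 1 - M⁻¹ * ∑ i, z i ^ 2 := fun z => by
    simp only [c, polyFn, map_sub, map_mul, map_sum, map_pow, map_one, MvPolynomial.eval_C,
      MvPolynomial.eval_X]
  have hcont : Continuous (polyFn c) := (contDiff_polyFn c).continuous
  have hhalf : ∀ z ∈ Q, 1 / 2 ≤ polyFn c z := fun z hz => by
    have h1 : ∑ i, z i ^ 2 ≤ n * R ^ 2 := by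
      calc _ ≤ ∑ _i : Fin n, R ^ 2 := Finset.sum_le_sum fun i _ => by
            rw [← sq_abs]
            exact pow_le_pow_left₀ (abs_nonneg _) ((norm_le_pi_norm z i).trans (by simpa [hQ] using hz)) 2
        _ = n * R ^ 2 := by simp
    rw [hc, inv_mul_eq_div, le_sub_comm, div_le_iff₀ hMpos]
    linarith
  have hvol : 0 < volume.real Q :=
    ENNReal.toReal_pos (Metric.measure_closedBall_pos volume _ hR).ne'
      (isCompact_closedBall _ _).measure_lt_top.ne
  have hint : ∀ f : Fn n, Continuous f → IntegrableOn f Q := fun f hf =>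
    hf.continuousOn.integrableOn_compact (isCompact_closedBall _ _)
  have hpos : ∀ m, 0 < ∫ z in Q, polyFn c z ^ m := fun m => by
    refine lt_of_lt_of_le ?_ (setIntegral_mono_on (f := fun _ => (1 / 2 : ℝ) ^ m)
      (hint _ continuous_const) (hint _ (hcont.pow m)) measurableSet_closedBall
      fun z hz => pow_le_pow_left₀ (by norm_num) (hhalf z hz) m)
    rw [setIntegral_const, smul_eq_mul]
    positivity
  let q : ℕ → MvPolynomial (Fin n) ℝ := fun m => MvPolynomial.C (∫ z in Q, polyFn c z ^ m)⁻¹ * c ^ m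
  have hq : ∀ m z, polyFn (q m) z = (∫ z in Q, polyFn c z ^ m)⁻¹ * polyFn c z ^ m := fun m z => by
    simp only [q, polyFn, map_mul, map_pow, MvPolynomial.eval_C]
  refine ⟨q, fun m z hz => ?_, fun m => ?_, ?_⟩
  · rw [hq]
    exact mul_nonneg (inv_nonneg.2 (hpos m).le) (pow_nonneg (le_trans (by norm_num) (hhalf z hz)) m)
  · simp only [hq]
    rw [integral_const_mul, inv_mul_cancel₀ (hpos m).ne']
  · have h := tendsto_setIntegral_pow_smul_of_unique_maximum_of_isCompact_of_continuousOn
      (μ := volume) (s := Q) (x₀ := (0 : Fin n → ℝ)) (c := polyFn c) (g := fun z => ‖z‖)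
      (isCompact_closedBall _ _) hcont.continuousOn (fun y _ hy => ?_)
      (fun z hz => le_trans (by norm_num) (hhalf z hz)) ?_ ?_ continuous_norm.continuousOn
    · rw [norm_zero] at h
      refine h.congr fun m => ?_
      simp only [hq, smul_eq_mul]
      rw [← integral_const_mul]
      simp only [mul_assoc]
    · obtain ⟨i, hi⟩ : ∃ i, y i ≠ 0 := by
        by_contra! h
        exact hy (funext h)
      rw [hc, hc]
      have : 0 < ∑ i, y i ^ 2 := Finset.sum_pos' (fun _ _ => sq_nonneg _)
        ⟨i, Finset.mem_univ _, by positivity⟩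
      have h2 : 0 < M⁻¹ * ∑ i, y i ^ 2 := by positivity
      simpa using h2
    · rw [hc]; simp
    · refine subset_closure (mem_interior.2 ⟨_, Metric.ball_subset_closedBall, Metric.isOpen_ball, ?_⟩)
      exact Metric.mem_ball_self hR

/-- A factor x_i - y_i of q(x - y) splits: x_i leaves the integral and y_i is absorbed into g. Hence
the induction runs over all g at once. -/
theorem exists_polynomial_convolution (q : MvPolynomial (Fin n) ℝ) {g : Fn n} (hg : Continuous g)
    (hgc : HasCompactSupport g) :
    ∃ p : MvPolynomial (Fin n) ℝ, ∀ x, polyFn p x = ∫ y, polyFn q (x - y) * g y := by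
  have hint : ∀ (q : MvPolynomial (Fin n) ℝ) {g : Fn n}, Continuous g → HasCompactSupport g →
      ∀ x, Integrable fun y => polyFn q (x - y) * g y := fun q g hg hgc x =>
    (((contDiff_polyFn q).continuous.comp (continuous_const.sub continuous_id)).mul
      hg).integrable_of_hasCompactSupport hgc.mul_left
  induction q using MvPolynomial.induction_on generalizing g with
  | C a =>
    refine ⟨MvPolynomial.C (a * ∫ y, g y), fun x => ?_⟩
    simp only [polyFn, MvPolynomial.eval_C]
    rw [integral_const_mul]
  | add q q' h h' =>
    obtain ⟨p, hp⟩ := h hg hgc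
    obtain ⟨p', hp'⟩ := h' hg hgc
    refine ⟨p + p', fun x => ?_⟩
    have h1 : polyFn (p + p') x = polyFn p x + polyFn p' x := map_add _ _ _
    rw [h1, hp, hp', ← integral_add (hint q hg hgc x) (hint q' hg hgc x)]
    refine integral_congr_ae (Eventually.of_forall fun y => ?_)
    simp only [polyFn, map_add]
    ring
  | mul_X q i h =>
    have hg' : Continuous fun y => y i * g y := (continuous_apply i).mul hg
    have hgc' : HasCompactSupport fun y => y i * g y := hgc.mul_left
    obtain ⟨p, hp⟩ := h hg hgc
    obtain ⟨p', hp'⟩ := h hg' hgc'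
    refine ⟨MvPolynomial.X i * p - p', fun x => ?_⟩
    have h1 : polyFn (MvPolynomial.X i * p - p') x = x i * polyFn p x - polyFn p' x := by
      simp [polyFn]
    rw [h1, hp, hp', ← integral_const_mul, ← integral_sub ((hint q hg hgc x).const_mul _)
      (hint q hg' hgc' x)]
    refine integral_congr_ae (Eventually.of_forall fun y => ?_)
    simp only [polyFn, map_mul, MvPolynomial.eval_X, Pi.sub_apply]
    ring

theorem hasCompactSupport_pderiv {g : Fn n} (hgc : HasCompactSupport g) (i : Fin n) :
    HasCompactSupport (pderiv i g) :=
  hgc.of_isClosed_subset (isClosed_tsupport _) (tsupport_pderiv_subset g i)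

/-- The derivative is put on g, since the kernel will be a polynomial cut off at the boundary of a
ball and is only locally integrable. -/
theorem pderiv_convolution {k g : Fn n} (hk : LocallyIntegrable k) (hg : ContDiff ℝ ∞ g)
    (hgc : HasCompactSupport g) (i : Fin n) :
    pderiv i (convolution k g (ContinuousLinearMap.mul ℝ ℝ) volume) =
      convolution k (pderiv i g) (ContinuousLinearMap.mul ℝ ℝ) volume := by
  ext x
  have hg1 : ContDiff ℝ 1 g := hg.of_le (by exact_mod_cast le_top)
  rw [pderiv, (hgc.hasFDerivAt_convolution_right _ hk hg1 x).fderiv,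
    convolution_precompR_apply _ hk (hgc.fderiv ℝ) (hg1.continuous_fderiv one_ne_zero)]
  rfl

theorem wordDeriv_convolution {k g : Fn n} (hk : LocallyIntegrable k) (hg : ContDiff ℝ ∞ g)
    (hgc : HasCompactSupport g) (w : List (Fin n)) :
    wordDeriv w (convolution k g (ContinuousLinearMap.mul ℝ ℝ) volume) =
      convolution k (wordDeriv w g) (ContinuousLinearMap.mul ℝ ℝ) volume := by
  induction w generalizing g with
  | nil => rfl
  | cons i w ih =>
    rw [wordDeriv_cons, pderiv_convolution hk hg hgc,
      ih (contDiff_pderiv hg i) (hasCompactSupport_pderiv hgc i)]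
    rfl

theorem hasCompactSupport_wordDeriv {g : Fn n} (hgc : HasCompactSupport g) (w : List (Fin n)) :
    HasCompactSupport (wordDeriv w g) := by
  induction w generalizing g with
  | nil => exact hgc
  | cons i w ih => exact ih (hasCompactSupport_pderiv hgc i)

/-- A compactly supported smooth function is approximated on a ball by polynomials, together with
its derivatives. -/
theorem exists_polynomial_near {g : Fn n} (hg : ContDiff ℝ ∞ g) {R : ℝ} (hR : 0 < R)
    (hgR : tsupport g ⊆ Metric.ball 0 R) {W : Set (List (Fin n))} (hW : W.Finite) {ε : ℝ}
    (hε : 0 < ε) : ∃ p : MvPolynomial (Fin n) ℝ, ∀ w ∈ W, ∀ x ∈ Metric.ball (0 : Fin n → ℝ) R,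
      |wordDeriv w (polyFn p) x - wordDeriv w g x| < ε := by
  have hgc : HasCompactSupport g := (isCompact_closedBall (0 : Fin n → ℝ) R).of_isClosed_subset
    (isClosed_tsupport g) (hgR.trans Metric.ball_subset_closedBall)
  -- The radius 2R contains every difference y - z with y in the ball of radius R and z in the
  -- support of g. On the ball the cut-off kernel therefore gives the same convolution as the
  -- polynomial itself.
  obtain ⟨q, hq0, hq1, hqt⟩ := exists_polynomial_peak (n := n) (2 * R) (by positivity)
  set Q := Metric.closedBall (0 : Fin n → ℝ) (2 * R)
  have hQm : MeasurableSet Q := measurableSet_closedBall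
  have hint : ∀ f : Fn n, Continuous f → IntegrableOn f Q := fun f hf =>
    hf.continuousOn.integrableOn_compact (isCompact_closedBall _ _)
  have hqc : ∀ m, Continuous (polyFn (q m)) := fun m => (contDiff_polyFn _).continuous
  let k : ℕ → Fn n := fun m => Q.indicator (polyFn (q m))
  have hk : ∀ m, LocallyIntegrable (k m) := fun m =>
    ((integrable_indicator_iff hQm).2 (hint _ (hqc m))).locallyIntegrable
  choose C hC using fun w => ContDiff.lipschitzWith_of_hasCompactSupport (hasCompactSupport_wordDeriv hgc w)
    (contDiff_wordDeriv hg w) (by simp)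
  -- The kernel has mass 1, so the error is at most the Lipschitz constant of the derivative times
  -- the first moment of the kernel.
  have hbound : ∀ m w x, |convolution (k m) (wordDeriv w g) (ContinuousLinearMap.mul ℝ ℝ) volume x
      - wordDeriv w g x| ≤ C w * ∫ z in Q, polyFn (q m) z * ‖z‖ := by
    intro m w x
    set u := wordDeriv w g
    have hu : Continuous u := (contDiff_wordDeriv hg w).continuous
    have h1 : convolution (k m) u (ContinuousLinearMap.mul ℝ ℝ) volume x =
        ∫ z in Q, polyFn (q m) z * u (x - z) := by
      rw [convolution_def, ← integral_indicator hQm]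
      refine integral_congr_ae (Eventually.of_forall fun z => ?_)
      simp only [k, ContinuousLinearMap.mul_apply', Set.indicator]
      split_ifs <;> simp
    have h2 : u x = ∫ z in Q, polyFn (q m) z * u x := by
      rw [integral_mul_const, hq1, one_mul]
    have hi : IntegrableOn (fun z => polyFn (q m) z * u (x - z)) Q :=
      hint _ ((hqc m).mul (hu.comp (continuous_const.sub continuous_id)))
    have hi' : IntegrableOn (fun z => polyFn (q m) z * u x) Q :=
      hint _ ((hqc m).mul continuous_const)
    rw [h1]
    conv_lhs => rw [h2]
    rw [← integral_sub hi hi', ← integral_const_mul,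
      ← Real.norm_eq_abs]
    refine norm_integral_le_of_norm_le (hint _ (continuous_const.mul ((hqc m).mul continuous_norm))) ?_
    refine (ae_restrict_iff' hQm).2 (Eventually.of_forall fun z hz => ?_)
    rw [← mul_sub, norm_mul, Real.norm_of_nonneg (hq0 m z hz)]
    have h3 := (hC w).dist_le_mul (x - z) x
    rw [dist_eq_norm, dist_eq_norm, sub_sub_cancel_left, norm_neg] at h3
    calc _ ≤ polyFn (q m) z * (C w * ‖z‖) := mul_le_mul_of_nonneg_left h3 (hq0 m z hz)
      _ = _ := by ring
  have hev : ∀ᶠ m in atTop, ∀ w ∈ W, (C w : ℝ) * ∫ z in Q, polyFn (q m) z * ‖z‖ < ε := by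
    rw [hW.eventually_all]
    intro w _
    have := hqt.const_mul (C w : ℝ)
    rw [mul_zero] at this
    exact this.eventually_lt_const hε
  obtain ⟨m, hm⟩ := hev.exists
  obtain ⟨p, hp⟩ := exists_polynomial_convolution (q m) hg.continuous hgc
  refine ⟨p, fun w hw x hx => ?_⟩
  have hloc : polyFn p =ᶠ[𝓝 x] convolution (k m) g (ContinuousLinearMap.mul ℝ ℝ) volume := by
    filter_upwards [Metric.isOpen_ball.mem_nhds hx] with y hy
    rw [hp, convolution_eq_swap]
    refine integral_congr_ae (Eventually.of_forall fun z => ?_)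
    simp only [ContinuousLinearMap.mul_apply']
    by_cases hz : z ∈ tsupport g
    · have : y - z ∈ Q := by
        have hz' := hgR hz
        rw [mem_ball_zero_iff] at hy hz'
        rw [mem_closedBall_zero_iff]
        exact (norm_sub_le _ _).trans (by linarith)
      simp only [k, Set.indicator_of_mem this]
    · rw [image_eq_zero_of_notMem_tsupport hz, mul_zero, mul_zero]
  rw [(wordDeriv_congr hloc w).eq_of_nhds, wordDeriv_convolution (hk m) hg hgc]
  exact (hbound m w x).trans_lt (hm w hw)

/-- The polynomials are dense in the smooth functions. -/
theorem exists_polynomial_smoothTendsto {f : Fn n} (hf : ContDiff ℝ ∞ f) :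
    ∃ p : ℕ → MvPolynomial (Fin n) ℝ, SmoothTendsto (fun m => polyFn (p m)) f := by
  have key : ∀ N : ℕ, ∃ p : MvPolynomial (Fin n) ℝ, ∀ w ∈ {w : List (Fin n) | w.length ≤ N},
      ∀ x ∈ Metric.closedBall (0 : Fin n → ℝ) N,
        |wordDeriv w (polyFn p) x - wordDeriv w f x| < 1 / ((N : ℝ) + 1) := fun N => by
    -- χ equals 1 near the ball of radius N, so f and χ f have the same derivatives there. Letting N
    -- bound the radius, the order of derivatives and the reciprocal of the error yields one
    -- sequence for all seminorms.
    let χ : ContDiffBump (0 : Fin n → ℝ) := ⟨N + 1, N + 2, by positivity, by linarith⟩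
    have hχ : tsupport (fun x => χ x * f x) ⊆ Metric.ball 0 ((N : ℝ) + 3) := by
      refine (tsupport_mul_subset_left (f := χ) (g := f)).trans ?_
      rw [χ.tsupport_eq]
      exact Metric.closedBall_subset_ball (by change (N : ℝ) + 2 < _; linarith)
    obtain ⟨p, hp⟩ := exists_polynomial_near (χ.contDiff.mul hf) (by positivity) hχ
      (List.finite_length_le (Fin n) N) (ε := 1 / ((N : ℝ) + 1)) (by positivity)
    refine ⟨p, fun w hw x hx => ?_⟩
    have hx' : x ∈ Metric.ball (0 : Fin n → ℝ) (N + 1) :=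
      Metric.closedBall_subset_ball (by linarith) hx
    have hloc : (fun x => χ x * f x) =ᶠ[𝓝 x] f := by
      filter_upwards [Metric.isOpen_ball.mem_nhds hx'] with y hy
      rw [χ.one_of_mem_closedBall (Metric.ball_subset_closedBall hy), one_mul]
    rw [← (wordDeriv_congr hloc w).eq_of_nhds]
    exact hp w hw x (Metric.ball_subset_ball (by linarith) hx')
  choose p hp using key
  refine ⟨p, (smoothTendsto_iff (fun m => contDiff_polyFn _) hf).2 fun w K hK => ?_⟩
  rw [Metric.tendstoUniformlyOn_iff]
  intro ε hε
  obtain ⟨r, hr⟩ := hK.isBounded.subset_closedBall 0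
  obtain ⟨N, hN⟩ := exists_nat_gt r
  filter_upwards [eventually_ge_atTop (max N w.length),
    tendsto_one_div_add_atTop_nhds_zero_nat.eventually_lt_const hε] with m hm hm' x hx
  rw [dist_comm, Real.dist_eq]
  refine (hp m w (le_trans (le_max_right _ _) hm) x ?_).trans hm'
  refine Metric.closedBall_subset_closedBall ?_ (hr hx)
  have : (N : ℝ) ≤ m := by exact_mod_cast le_trans (le_max_left _ _) hm
  linarith

end Density

/-! ### Part (a): traces and invariant functionals -/

section Traces

variable {n : ℕ} {g : Type*} [LieRing g] [LieAlgebra ℝ g] (b : Module.Basis (Fin n) ℝ g)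

theorem smooth_sum {ι : Type*} {s : Finset ι} {F : ι → Fn n} (h : ∀ i ∈ s, ContDiff ℝ ∞ (F i)) :
    ContDiff ℝ ∞ (∑ i ∈ s, F i) :=
  (smoothFn n).sum_mem h

theorem iteratedFDeriv_add_fn {f h : Fn n} (hf : ContDiff ℝ ∞ f) (hh : ContDiff ℝ ∞ h) (k : ℕ)
    (ξ : Fin n → ℝ) :
    iteratedFDeriv ℝ k (f + h) ξ = iteratedFDeriv ℝ k f ξ + iteratedFDeriv ℝ k h ξ :=
  iteratedFDeriv_add_apply (hf.of_le (by exact_mod_cast le_top)).contDiffAt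
    (hh.of_le (by exact_mod_cast le_top)).contDiffAt

theorem iteratedFDeriv_smul_fn {f : Fn n} (hf : ContDiff ℝ ∞ f) (c : ℝ) (k : ℕ) (ξ : Fin n → ℝ) :
    iteratedFDeriv ℝ k (c • f) ξ = c • iteratedFDeriv ℝ k f ξ :=
  iteratedFDeriv_const_smul_apply (hf.of_le (by exact_mod_cast le_top)).contDiffAt

theorem taylorPoly_add {f h : Fn n} (hf : ContDiff ℝ ∞ f) (hh : ContDiff ℝ ∞ h) (r : ℕ)
    (ξ : Fin n → ℝ) : taylorPoly r ξ (f + h) = taylorPoly r ξ f + taylorPoly r ξ h := by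
  simp only [taylorPoly, iteratedFDeriv_add_fn hf hh, add_apply, mul_add,
    map_add, add_mul, Finset.sum_add_distrib]

theorem taylorPoly_smul {f : Fn n} (hf : ContDiff ℝ ∞ f) (c : ℝ) (r : ℕ) (ξ : Fin n → ℝ) :
    taylorPoly r ξ (c • f) = c • taylorPoly r ξ f := by
  simp only [taylorPoly, iteratedFDeriv_smul_fn hf, smul_apply,
    Finset.smul_sum, MvPolynomial.smul_eq_C_mul, smul_eq_mul, map_mul]
  refine Finset.sum_congr rfl fun k _ => Finset.sum_congr rfl fun i _ => ?_
  ring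

theorem bchCoeff_add_left {f f' : Fn n} (hf : ContDiff ℝ ∞ f) (hf' : ContDiff ℝ ∞ f') (r : ℕ)
    (h : Fn n) : bchCoeff b r (f + f') h = bchCoeff b r f h + bchCoeff b r f' h := by
  ext ξ
  simp only [Pi.add_apply, bchCoeff_apply, taylorPoly_add hf hf', polyCoeff_add_left, map_add]
  rfl

theorem bchCoeff_add_right {f f' : Fn n} (hf : ContDiff ℝ ∞ f) (hf' : ContDiff ℝ ∞ f') (r : ℕ)
    (h : Fn n) : bchCoeff b r h (f + f') = bchCoeff b r h f + bchCoeff b r h f' := by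
  ext ξ
  simp only [Pi.add_apply, bchCoeff_apply, taylorPoly_add hf hf', polyCoeff_add_right, map_add]
  rfl

theorem bchCoeff_smul_left {f : Fn n} (hf : ContDiff ℝ ∞ f) (c : ℝ) (r : ℕ)
    (h : Fn n) : bchCoeff b r (c • f) h = c • bchCoeff b r f h := by
  ext ξ
  simp only [Pi.smul_apply, bchCoeff_apply, taylorPoly_smul hf, polyCoeff_smul_left, map_smul]
  rfl

theorem bchCoeff_smul_right {f : Fn n} (hf : ContDiff ℝ ∞ f) (c : ℝ) (r : ℕ)
    (h : Fn n) : bchCoeff b r h (c • f) = c • bchCoeff b r h f := by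
  ext ξ
  simp only [Pi.smul_apply, bchCoeff_apply, taylorPoly_smul hf, polyCoeff_smul_right, map_smul]
  rfl

variable {b} {D : Submodule ℝ (Fn n)}

theorem isSmoothSeries_C {f : Fn n} (hf : ContDiff ℝ ∞ f) : IsSmoothSeries (PowerSeries.C f) := by
  intro m
  rw [PowerSeries.coeff_C]
  split_ifs
  · exact hf
  · exact contDiff_const

theorem IsStarIdeal.bchCoeff_mem (hD : IsStarIdeal b D) {f h : Fn n} (hf : ContDiff ℝ ∞ f)
    (hh : h ∈ D) (r : ℕ) : bchCoeff b r f h ∈ D ∧ bchCoeff b r h f ∈ D := by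
  have := hD.2 _ (isSmoothSeries_C hf) _ (const D h hh).2
  refine ⟨?_, ?_⟩
  · rw [← coeff_star_C]
    exact this.1 r
  · rw [← coeff_star_C]
    exact this.2 r

/-- Operator series that preserve `D` in each order. -/
def Preserves (D : Submodule ℝ (Fn n)) (E : PowerSeries (Module.End ℝ (smoothFn n))) : Prop :=
  ∀ h : smoothFn n, (h : Fn n) ∈ D → ∀ r, ((PowerSeries.coeff r E h : smoothFn n) : Fn n) ∈ D

theorem Preserves.one : Preserves D 1 := fun h hh r => by
  rw [PowerSeries.coeff_one]
  split_ifs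
  · exact hh
  · exact D.zero_mem

theorem preserves_sum {ι : Type*} {s : Finset ι} {E : ι → PowerSeries (Module.End ℝ (smoothFn n))}
    (hE : ∀ i ∈ s, Preserves D (E i)) : Preserves D (∑ i ∈ s, E i) := fun h hh r => by
  rw [map_sum, LinearMap.sum_apply, AddSubmonoidClass.coe_finsetSum]
  exact D.sum_mem fun i hi => hE i hi h hh r

theorem Preserves.mul {E E' : PowerSeries (Module.End ℝ (smoothFn n))} (hE : Preserves D E)
    (hE' : Preserves D E') : Preserves D (E * E') := fun h hh r => by
  rw [PowerSeries.coeff_mul, LinearMap.sum_apply, AddSubmonoidClass.coe_finsetSum]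
  exact D.sum_mem fun p _ => hE _ (hE' h hh _) _

theorem Preserves.pow {E : PowerSeries (Module.End ℝ (smoothFn n))} (hE : Preserves D E) (m : ℕ) :
    Preserves D (E ^ m) := by
  induction m with
  | zero => exact Preserves.one
  | succ m ih => exact ih.mul hE

theorem IsStarIdeal.preserves_leftOp (hD : IsStarIdeal b D) (y : g) :
    Preserves D (leftOp b y) := fun h hh r => by
  have h1 := leftSeries_pow b y 1
  rw [pow_one, pow_one] at h1
  rw [← h1, ← bchCoeff_polyFn_left]
  exact (hD.bchCoeff_mem (contDiff_polyFn _) hh r).1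

theorem IsStarIdeal.preserves_rightOp (hD : IsStarIdeal b D) (y : g) :
    Preserves D (rightOp b y) := fun h hh r => by
  have h1 := rightSeries_pow b y 1
  rw [pow_one, pow_one] at h1
  rw [← h1, ← bchCoeff_polyFn_right]
  exact (hD.bchCoeff_mem (contDiff_polyFn _) hh r).2

/-- The star commutator with `ŷ^m` is `ν {ŷ, ·}` of an element of `D[[ν]]`. -/
theorem IsStarIdeal.exists_bchCoeff_pow_sub (hD : IsStarIdeal b D) (y : g) (m s : ℕ) {h : Fn n}
    (hh : h ∈ D) : ∃ k ∈ D, bchCoeff b s (polyFn (linPoly b y ^ m)) h -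
      bchCoeff b s h (polyFn (linPoly b y ^ m)) = poisson b (linearFn b y) k := by
  let h' : smoothFn n := ⟨h, hD.1 h hh⟩
  set G := ∑ i ∈ Finset.range m, leftOp b y ^ i * rightOp b y ^ (m - 1 - i) with hG
  have hGD : Preserves D G := preserves_sum fun i _ =>
    ((hD.preserves_leftOp y).pow i).mul ((hD.preserves_rightOp y).pow _)
  -- L^m - R^m = (L - R) G because L and R commute, and L - R = -ν T_1(y) = ν{ŷ,·}. G preserves D in
  -- each order because L and R do.
  have h1 : leftOp b y ^ m - rightOp b y ^ m =
      PowerSeries.X * (PowerSeries.C (-adDerivPow b pderivOp (linOp b) 1 y) * G) := by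
    have hc := commute_leftOp_rightOp b y
    rw [← hc.mul_geom_sum₂ m, ← mul_assoc, ← hG]
    congr 1
    rw [rightOp, map_neg, mul_neg]
    abel
  have h2 := bchCoeff_pow_sub b y m s h'
  rw [show bchCoeff b s (polyFn (linPoly b y ^ m)) h - bchCoeff b s h (polyFn (linPoly b y ^ m)) =
    _ from h2, h1]
  cases s with
  | zero =>
    refine ⟨0, D.zero_mem, ?_⟩
    rw [show poisson b (linearFn b y) 0 = _ from poisson_linearFn b y 0, map_zero, neg_zero,
      PowerSeries.coeff_zero_X_mul, LinearMap.zero_apply]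
  | succ s =>
    refine ⟨_, hGD h' hh s, ?_⟩
    rw [poisson_linearFn, PowerSeries.coeff_succ_X_mul, PowerSeries.coeff_C_mul]
    rfl

/-- `f ↦ τ (f)` on `D`. -/
def traceConst (τ : formal D →ₗ[PowerSeries ℝ] PowerSeries ℝ) : D →ₗ[ℝ] PowerSeries ℝ where
  toFun f := τ (const D f f.2)
  map_add' f h := by
    rw [← map_add]
    congr 1
    exact Subtype.ext (map_add PowerSeries.C (f : Fn n) h)
  map_smul' c f := by
    have : const D (c • f : D) (c • f).2 = (PowerSeries.C c : PowerSeries ℝ) • const D f f.2 := by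
      refine Subtype.ext ?_
      change PowerSeries.C (c • (f : Fn n)) = (PowerSeries.C c : PowerSeries ℝ) • PowerSeries.C (f : Fn n)
      have h : algebraMap (PowerSeries ℝ) (PowerSeries (Fn n)) (PowerSeries.C c) =
          PowerSeries.C (algebraMap ℝ (Fn n) c) := PowerSeries.map_C _ _
      rw [Algebra.smul_def (PowerSeries.C c : PowerSeries ℝ), h, ← map_mul, Algebra.smul_def]
    rw [this, map_smul, RingHom.id_apply, smul_eq_mul]
    ext m
    rw [PowerSeries.coeff_C_mul]
    rfl

theorem traceConst_apply (τ : formal D →ₗ[PowerSeries ℝ] PowerSeries ℝ) (f : Fn n) (hf : f ∈ D) :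
    traceConst τ ⟨f, hf⟩ = τ (const D f hf) := rfl

theorem coeff_X_smul (F : PowerSeries (Fn n)) (m : ℕ) :
    PowerSeries.coeff (m + 1) ((PowerSeries.X : PowerSeries ℝ) • F) = PowerSeries.coeff m F ∧
      PowerSeries.coeff 0 ((PowerSeries.X : PowerSeries ℝ) • F) = 0 := by
  have h : algebraMap (PowerSeries ℝ) (PowerSeries (Fn n)) PowerSeries.X = PowerSeries.X :=
    PowerSeries.map_X _
  rw [Algebra.smul_def, h]
  exact ⟨PowerSeries.coeff_succ_X_mul _ _, PowerSeries.coeff_zero_X_mul _⟩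

/-- Peeling off one power of ν at a time determines each coefficient of τ F from values on D by
ℝ[[ν]]-linearity alone; no ν-adic continuity is needed. -/
theorem eq_const_add_X_smul (F : formal D) : ∃ F' : formal D,
    (∀ j, PowerSeries.coeff j (F' : PowerSeries (Fn n)) = PowerSeries.coeff (j + 1) (F : PowerSeries (Fn n))) ∧
      F = const D _ (F.2 0) + (PowerSeries.X : PowerSeries ℝ) • F' := by
  let F' : formal D := ⟨PowerSeries.mk fun j => PowerSeries.coeff (j + 1) (F : PowerSeries (Fn n)),
    fun j => by rw [PowerSeries.coeff_mk]; exact F.2 _⟩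
  have hF' : ∀ j, PowerSeries.coeff j (F' : PowerSeries (Fn n)) =
      PowerSeries.coeff (j + 1) (F : PowerSeries (Fn n)) := fun j => by
    change PowerSeries.coeff j (PowerSeries.mk fun j =>
      PowerSeries.coeff (j + 1) (F : PowerSeries (Fn n))) = _
    rw [PowerSeries.coeff_mk]
  refine ⟨F', hF', Subtype.ext ?_⟩
  · change (F : PowerSeries (Fn n)) = PowerSeries.C (PowerSeries.coeff 0 (F : PowerSeries (Fn n))) +
      (PowerSeries.X : PowerSeries ℝ) • (F' : PowerSeries (Fn n))
    ext1 m
    cases m with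
    | zero => rw [map_add, (coeff_X_smul _ 0).2, PowerSeries.coeff_zero_C, add_zero]
    | succ m => rw [map_add, (coeff_X_smul _ m).1, hF', PowerSeries.coeff_C,
        if_neg (Nat.succ_ne_zero m), zero_add]

/-- `τ` is determined by its values on `D`. -/
theorem trace_eq_zero (τ : formal D →ₗ[PowerSeries ℝ] PowerSeries ℝ) (F : formal D)
    (h : ∀ j, traceConst τ ⟨_, F.2 j⟩ = 0) : τ F = 0 := by
  ext m
  induction m generalizing F with
  | zero =>
    obtain ⟨F', -, hF⟩ := eq_const_add_X_smul F
    rw [hF, map_add, map_smul, ← traceConst_apply, h 0, zero_add, smul_eq_mul,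
      PowerSeries.coeff_zero_X_mul, map_zero]
  | succ m ih =>
    obtain ⟨F', hF', hF⟩ := eq_const_add_X_smul F
    rw [hF, map_add, map_smul, ← traceConst_apply, h 0, zero_add, smul_eq_mul,
      PowerSeries.coeff_succ_X_mul, ih F', map_zero]
    · rw [map_zero]
    · intro j
      rw [← h (j + 1)]
      congr 1
      exact Subtype.ext (hF' j)

theorem coeff_starComm (A B : PowerSeries (Fn n)) (m : ℕ) :
    PowerSeries.coeff m (starComm b A B) = ∑ p ∈ Finset.HasAntidiagonal.antidiagonal m,
      ∑ q ∈ Finset.HasAntidiagonal.antidiagonal p.2,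
        (bchCoeff b p.1 (PowerSeries.coeff q.1 A) (PowerSeries.coeff q.2 B) -
          bchCoeff b p.1 (PowerSeries.coeff q.2 B) (PowerSeries.coeff q.1 A)) := by
  rw [starComm, map_sub, star, star, PowerSeries.coeff_mk, PowerSeries.coeff_mk,
    ← Finset.sum_sub_distrib]
  refine Finset.sum_congr rfl fun p _ => ?_
  rw [Finset.sum_sub_distrib]
  exact congrArg _ (Finset.Nat.sum_antidiagonal_swap (n := p.2) (f := fun q =>
    bchCoeff b p.1 (PowerSeries.coeff q.2 B) (PowerSeries.coeff q.1 A)))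

theorem IsStarIdeal.comm_mem (hD : IsStarIdeal b D) {f h : Fn n} (hf : ContDiff ℝ ∞ f)
    (hh : h ∈ D) (r : ℕ) : bchCoeff b r f h - bchCoeff b r h f ∈ D :=
  D.sub_mem (hD.bchCoeff_mem hf hh r).1 (hD.bchCoeff_mem hf hh r).2

theorem isStarTrace_of_comm (hD : IsStarIdeal b D) (τ : formal D →ₗ[PowerSeries ℝ] PowerSeries ℝ)
    (h0 : ∀ f (hf : ContDiff ℝ ∞ f) h (hh : h ∈ D) r, traceConst τ ⟨_, hD.comm_mem hf hh r⟩ = 0) :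
    IsStarTrace b D τ := by
  refine ⟨hD, fun A hA B hB => ?_⟩
  have hmem : starComm b A B ∈ formal D :=
    (formal D).sub_mem (hD.2 A hA B hB).1 (hD.2 A hA B hB).2
  refine ⟨hmem, trace_eq_zero τ _ fun j => ?_⟩
  have : (⟨_, hmem j⟩ : D) = ∑ p ∈ Finset.HasAntidiagonal.antidiagonal j,
      ∑ q ∈ Finset.HasAntidiagonal.antidiagonal p.2,
        ⟨_, hD.comm_mem (hA q.1) (hB q.2) p.1⟩ := by
    refine Subtype.ext ?_
    rw [AddSubmonoidClass.coe_finsetSum]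
    simp only [AddSubmonoidClass.coe_finsetSum]
    exact coeff_starComm A B j
  rw [this, map_sum]
  refine Finset.sum_eq_zero fun p _ => ?_
  rw [map_sum]
  exact Finset.sum_eq_zero fun q _ => h0 _ (hA q.1) _ (hB q.2) p.1

/-- [x̂, k]_⋆ equals ν{x̂, k} with no higher terms, so ν τ({x̂, k}) = 0, and ν can be cancelled in
ℝ[[ν]]. -/
theorem IsStarTrace.isLieInvariant {τ : formal D →ₗ[PowerSeries ℝ] PowerSeries ℝ}
    (h : IsStarTrace b D τ) : IsLieInvariant b D τ := by
  intro x k hk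
  have hD := h.1
  have hx : ContDiff ℝ ∞ (linearFn b x) := by
    rw [← polyFn_linPoly]; exact contDiff_polyFn _
  have hmem : poisson b (linearFn b x) k ∈ D := by
    rw [← bchCoeff_one_sub b hx (hD.1 k hk)]
    exact hD.comm_mem hx hk 1
  refine ⟨hmem, ?_⟩
  obtain ⟨hAB, h0⟩ := h.2 _ (isSmoothSeries_C hx) _ (const D k hk).2
  have key : (⟨_, hAB⟩ : formal D) = (PowerSeries.X : PowerSeries ℝ) • const D _ hmem := by
    refine Subtype.ext (PowerSeries.ext fun m => ?_)
    change PowerSeries.coeff m (starComm b (PowerSeries.C (linearFn b x)) (PowerSeries.C k)) =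
      PowerSeries.coeff m ((PowerSeries.X : PowerSeries ℝ) • PowerSeries.C _)
    rw [coeff_starComm_C]
    have h2 := bchCoeff_pow_sub b x 1 m ⟨k, hD.1 k hk⟩
    rw [pow_one, polyFn_linPoly] at h2
    rw [show bchCoeff b m (linearFn b x) k - bchCoeff b m k (linearFn b x) = _ from h2, pow_one,
      pow_one, rightOp, sub_add_cancel_left, map_neg]
    cases m with
    | zero =>
      rw [(coeff_X_smul _ 0).2, PowerSeries.coeff_zero_X_mul, neg_zero]
      rfl
    | succ m =>
      rw [(coeff_X_smul _ m).1, PowerSeries.coeff_succ_X_mul, PowerSeries.coeff_C,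
        PowerSeries.coeff_C]
      split_ifs
      · exact (poisson_linearFn b x ⟨k, hD.1 k hk⟩).symm
      · rw [neg_zero]; rfl
  rw [key, map_smul, smul_eq_mul] at h0
  exact (mul_eq_zero.1 h0).resolve_left PowerSeries.X_ne_zero

theorem IsPoissonTrace.isLieInvariant {τ : formal D →ₗ[PowerSeries ℝ] PowerSeries ℝ}
    (h : IsPoissonTrace b D τ) : IsLieInvariant b D τ := fun x k hk =>
  h.2 _ (by rw [← polyFn_linPoly]; exact contDiff_polyFn _) k hk

/-- The heart of part (a). On a power ŷ^m each coefficient of the commutator is {ŷ, k'} with k' in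
D, which an invariant functional kills; linearity gives all polynomials without any continuity. -/
theorem IsLieInvariant.traceConst_polyFn {τ : formal D →ₗ[PowerSeries ℝ] PowerSeries ℝ}
    (h : IsLieInvariant b D τ) (hD : IsStarIdeal b D) (p : MvPolynomial (Fin n) ℝ) {k : Fn n}
    (hk : k ∈ D) (s : ℕ) : traceConst τ ⟨_, hD.comm_mem (contDiff_polyFn p) hk s⟩ = 0 := by
  induction p using polynomial_linPoly_induction b with
  | pow y m =>
    obtain ⟨k', hk', he⟩ := hD.exists_bchCoeff_pow_sub y m s hk
    obtain ⟨h1, h2⟩ := h y k' hk'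
    rw [← h2, ← traceConst_apply]
    congr 1
    exact Subtype.ext he
  | zero =>
    convert map_zero (traceConst τ)
    have : polyFn (0 : MvPolynomial (Fin n) ℝ) = 0 := by ext; simp [polyFn]
    rw [this, bchCoeff_zero_left, bchCoeff_zero_right, sub_zero]
    rfl
  | add p q hp hq =>
    have := congrArg₂ (· + ·) hp hq
    rw [add_zero] at this
    rw [← this, ← map_add]
    congr 1
    refine Subtype.ext ?_
    have hpq : polyFn (p + q) = polyFn p + polyFn q := by ext; simp [polyFn]
    simp only [hpq, bchCoeff_add_left b (contDiff_polyFn p) (contDiff_polyFn q),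
      bchCoeff_add_right b (contDiff_polyFn p) (contDiff_polyFn q), Submodule.coe_add]
    abel
  | smul c p hp =>
    have := congrArg (c • ·) hp
    simp only [smul_zero] at this
    rw [← this, ← map_smul]
    congr 1
    refine Subtype.ext ?_
    have hpq : polyFn (c • p) = c • polyFn p := by ext; simp [polyFn, MvPolynomial.smul_eval]
    simp only [hpq, bchCoeff_smul_left b (contDiff_polyFn p),
      bchCoeff_smul_right b (contDiff_polyFn p), Submodule.coe_smul, smul_sub]

/-- The value is a limit of values at polynomials, all of which are zero. -/
theorem IsLieInvariant.traceConst_comm {τ : formal D →ₗ[PowerSeries ℝ] PowerSeries ℝ}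
    (h : IsLieInvariant b D τ) (hD : IsStarIdeal b D) (hc : HasPolyContinuity b D τ) (f : Fn n)
    (hf : ContDiff ℝ ∞ f) (k : Fn n) (hk : k ∈ D) (s : ℕ) :
    traceConst τ ⟨_, hD.comm_mem hf hk s⟩ = 0 := by
  obtain ⟨p, hp⟩ := exists_polynomial_smoothTendsto hf
  ext r
  have hmem : ∀ f, ContDiff ℝ ∞ f →
      PowerSeries.coeff s (starComm b (PowerSeries.C f) (PowerSeries.C k)) ∈ D := fun f hf => by
    rw [coeff_starComm_C]
    exact hD.comm_mem hf hk s
  have hcomp : ∀ f (hf : ContDiff ℝ ∞ f), component D τ r _ (hmem f hf) =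
      PowerSeries.coeff r (traceConst τ ⟨_, hD.comm_mem hf hk s⟩) := fun f hf => by
    rw [component, ← traceConst_apply]
    congr 3
    exact coeff_starComm_C b f k s
  have := hc f hf k hk p hp r s (fun m => hmem _ (contDiff_polyFn _)) (hmem f hf)
  rw [hcomp f hf] at this
  have h0 : ∀ m, component D τ r _ (hmem _ (contDiff_polyFn (p m))) = 0 := fun m => by
    rw [hcomp _ (contDiff_polyFn (p m)), h.traceConst_polyFn hD (p m) hk s, map_zero]
  rw [map_zero]
  exact tendsto_nhds_unique this (tendsto_const_nhds.congr fun m => (h0 m).symm)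

theorem IsLieInvariant.isStarTrace {τ : formal D →ₗ[PowerSeries ℝ] PowerSeries ℝ}
    (h : IsLieInvariant b D τ) (hD : IsStarIdeal b D) (hc : HasPolyContinuity b D τ) :
    IsStarTrace b D τ :=
  isStarTrace_of_comm hD τ fun f hf k hk s => h.traceConst_comm hD hc f hf k hk s

/-- C_0 is the product and the antisymmetrized C_1 is the bracket, so a star ideal is a Poisson
ideal, and the order-one commutators are the Poisson brackets. -/
theorem IsLieInvariant.isPoissonTrace {τ : formal D →ₗ[PowerSeries ℝ] PowerSeries ℝ}
    (h : IsLieInvariant b D τ) (hD : IsStarIdeal b D) (hc : HasPolyContinuity b D τ) :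
    IsPoissonTrace b D τ := by
  have hmem : ∀ f, ContDiff ℝ ∞ f → ∀ k ∈ D, poisson b f k ∈ D := fun f hf k hk => by
    rw [← bchCoeff_one_sub b hf (hD.1 k hk)]
    exact hD.comm_mem hf hk 1
  refine ⟨⟨hD.1, fun f hf k hk => ⟨?_, hmem f hf k hk⟩⟩, fun f hf k hk => ⟨hmem f hf k hk, ?_⟩⟩
  · rw [← bchCoeff_zero b]
    exact (hD.bchCoeff_mem hf hk 0).1
  · rw [← h.traceConst_comm hD hc f hf k hk 1, ← traceConst_apply]
    congr 1
    exact Subtype.ext (bchCoeff_one_sub b hf (hD.1 k hk)).symm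

end Traces

/-! ### C_r with explicit smooth coefficients: smoothness, supports, continuity -/

section Bidiff

variable {n : ℕ}

theorem tsupport_wordDeriv_subset (f : Fn n) (w : List (Fin n)) :
    tsupport (wordDeriv w f) ⊆ tsupport f := by
  induction w generalizing f with
  | nil => exact subset_rfl
  | cons i w ih => exact (ih _).trans (tsupport_pderiv_subset f i)

/-- Locally uniform convergence of all iterated partial derivatives. -/
def WordTendsto (F : ℕ → Fn n) (f : Fn n) : Prop :=
  ∀ w : List (Fin n), ∀ K, IsCompact K →
    TendstoUniformlyOn (fun m => wordDeriv w (F m)) (wordDeriv w f) atTop K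

theorem WordTendsto.iterate {F : ℕ → Fn n} {f : Fn n} (h : WordTendsto F f)
    (w : List (Fin n)) : WordTendsto (fun m => wordDeriv w (F m)) (wordDeriv w f) := by
  induction w generalizing F f with
  | nil => exact h
  | cons i w ih => exact ih fun w' => h (i :: w')

theorem WordTendsto.add {F F' : ℕ → Fn n} {f f' : Fn n} (h : WordTendsto F f)
    (h' : WordTendsto F' f') (hF : ∀ m, ContDiff ℝ ∞ (F m)) (hF' : ∀ m, ContDiff ℝ ∞ (F' m))
    (hf : ContDiff ℝ ∞ f) (hf' : ContDiff ℝ ∞ f') :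
    WordTendsto (fun m => F m + F' m) (f + f') := fun w K hK => by
  rw [wordDeriv_add hf hf']
  simp only [wordDeriv_add (hF _) (hF' _)]
  exact (h w K hK).add (h' w K hK)

theorem tendstoUniformlyOn_mul_left {F : ℕ → Fn n} {f a : Fn n} {K : Set (Fin n → ℝ)}
    (h : TendstoUniformlyOn F f atTop K) (hK : IsCompact K) (ha : Continuous a) :
    TendstoUniformlyOn (fun m => a * F m) (a * f) atTop K := by
  obtain ⟨C, hC⟩ := hK.exists_bound_of_continuousOn ha.continuousOn
  rw [Metric.tendstoUniformlyOn_iff] at h ⊢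
  intro ε hε
  have hC' : 0 < |C| + 1 := by positivity
  filter_upwards [h _ (div_pos hε hC')] with m hm ξ hξ
  have h1 := hm ξ hξ
  rw [lt_div_iff₀ hC'] at h1
  rw [dist_eq_norm] at h1 ⊢
  rw [Pi.mul_apply, Pi.mul_apply, ← mul_sub, norm_mul]
  have h2 := hC ξ hξ
  have h3 := le_abs_self C
  nlinarith [norm_nonneg (f ξ - F m ξ)]

theorem WordTendsto.mul_left {F : ℕ → Fn n} {f a : Fn n} (h : WordTendsto F f)
    (hF : ∀ m, ContDiff ℝ ∞ (F m)) (hf : ContDiff ℝ ∞ f) (ha : ContDiff ℝ ∞ a) :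
    WordTendsto (fun m => a * F m) (a * f) := fun w => by
  induction w generalizing F f a with
  | nil => exact fun K hK => tendstoUniformlyOn_mul_left (h [] K hK) hK ha.continuous
  | cons i w ih =>
    intro K hK
    have h1 := ih h hF hf (contDiff_pderiv ha i) K hK
    have h2 := ih (fun w => h (i :: w)) (fun m => contDiff_pderiv (hF m) i)
      (contDiff_pderiv hf i) ha K hK
    have h3 := h1.add h2
    simp only [wordDeriv_cons, pderiv_mul ha (hF _), pderiv_mul ha hf]
    have e : ∀ u : Fn n, ContDiff ℝ ∞ u → wordDeriv w (pderiv i a * u + a * pderiv i u) =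
        wordDeriv w (pderiv i a * u) + wordDeriv w (a * pderiv i u) := fun u hu =>
      wordDeriv_add ((contDiff_pderiv ha i).mul hu) (ha.mul (contDiff_pderiv hu i)) w
    simp only [e _ (hF _), e f hf]
    exact h3

theorem WordTendsto.sum {ι : Type*} (s : Finset ι) {F : ι → ℕ → Fn n} {f : ι → Fn n}
    (h : ∀ i, WordTendsto (F i) (f i)) (hF : ∀ i m, ContDiff ℝ ∞ (F i m))
    (hf : ∀ i, ContDiff ℝ ∞ (f i)) :
    WordTendsto (fun m => ∑ i ∈ s, F i m) (∑ i ∈ s, f i) := by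
  classical
  induction s using Finset.induction_on with
  | empty =>
    intro w K _
    simp only [Finset.sum_empty]
    exact Metric.tendstoUniformlyOn_iff.2 fun ε hε => Eventually.of_forall fun m ξ _ => by
      rwa [dist_self]
  | insert i s hi ih =>
    simp only [Finset.sum_insert hi]
    exact (h i).add ih (hF i) (fun m => smooth_sum fun i _ => hF i m) (hf i)
      (smooth_sum fun i _ => hf i)

/-- Polynomials depending on a parameter with smooth coefficients. -/
def smoothFamily (n : ℕ) : Submodule ℝ ((Fin n → ℝ) → MvPolynomial (Fin n) ℝ) :=
  Submodule.span ℝ {P | ∃ a : Fn n, ContDiff ℝ ∞ a ∧ ∃ p, P = fun ξ => a ξ • p}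

theorem mul_sub_mem_smoothFamily (i : Fin n) {P : (Fin n → ℝ) → MvPolynomial (Fin n) ℝ}
    (hP : P ∈ smoothFamily n) :
    (fun ξ => (MvPolynomial.X i - MvPolynomial.C (ξ i)) * P ξ) ∈ smoothFamily n := by
  induction hP using Submodule.span_induction with
  | mem P hP =>
    obtain ⟨a, ha, p, rfl⟩ := hP
    have : (fun ξ : Fin n → ℝ => (MvPolynomial.X i - MvPolynomial.C (ξ i)) * a ξ • p) =
        (fun ξ => a ξ • (MvPolynomial.X i * p)) - fun ξ => (ξ i * a ξ) • p := by
      ext1 ξ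
      simp only [Pi.sub_apply, MvPolynomial.smul_eq_C_mul, map_mul]
      ring
    rw [this]
    exact Submodule.sub_mem _ (Submodule.subset_span ⟨a, ha, _, rfl⟩)
      (Submodule.subset_span ⟨_, (contDiff_apply ℝ ℝ i).mul ha, _, rfl⟩)
  | zero =>
    simp only [Pi.zero_apply, mul_zero]
    exact (smoothFamily n).zero_mem
  | add P Q _ _ hP hQ =>
    simp only [Pi.add_apply, mul_add]
    exact (smoothFamily n).add_mem hP hQ
  | smul c P _ hP =>
    simp only [Pi.smul_apply, mul_smul_comm]
    exact (smoothFamily n).smul_mem c hP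

theorem prod_mem_smoothFamily {k : ℕ} (i : Fin k → Fin n) :
    (fun ξ : Fin n → ℝ => ∏ j, (MvPolynomial.X (i j) - MvPolynomial.C (ξ (i j)) :
      MvPolynomial (Fin n) ℝ)) ∈ smoothFamily n := by
  generalize (Finset.univ : Finset (Fin k)) = s
  induction s using Finset.induction_on with
  | empty =>
    refine Submodule.subset_span ⟨fun _ => 1, contDiff_const, 1, ?_⟩
    simp
  | insert j s hj ih =>
    simp only [Finset.prod_insert hj]
    exact mul_sub_mem_smoothFamily (i j) ih

variable {g : Type*} [LieRing g] [LieAlgebra ℝ g] (b : Module.Basis (Fin n) ℝ g)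

/-- By bilinearity the smooth coefficients leave C_r, and C_r of two fixed polynomials is a
polynomial. -/
theorem contDiff_eval_polyCoeff (r : ℕ) {P Q : (Fin n → ℝ) → MvPolynomial (Fin n) ℝ}
    (hP : P ∈ smoothFamily n) (hQ : Q ∈ smoothFamily n) :
    ContDiff ℝ ∞ fun ξ => MvPolynomial.eval ξ (polyCoeff b r (P ξ) (Q ξ)) := by
  induction hP using Submodule.span_induction with
  | mem P hP =>
    obtain ⟨a, ha, p, rfl⟩ := hP
    simp only [polyCoeff_smul_left, MvPolynomial.smul_eval]
    refine ha.mul ?_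
    induction hQ using Submodule.span_induction with
    | mem Q hQ =>
      obtain ⟨a', ha', q, rfl⟩ := hQ
      simp only [polyCoeff_smul_right, MvPolynomial.smul_eval]
      exact ha'.mul (contDiff_polyFn _)
    | zero => simpa [polyCoeff_zero_right] using contDiff_const
    | add Q Q' _ _ h h' =>
      simp only [Pi.add_apply, polyCoeff_add_right, map_add]
      exact h.add h'
    | smul c Q _ h =>
      simp only [Pi.smul_apply, polyCoeff_smul_right, MvPolynomial.smul_eval]
      exact contDiff_const.mul h
  | zero => simpa [polyCoeff_zero_left] using contDiff_const
  | add P P' _ _ h h' =>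
    simp only [Pi.add_apply, polyCoeff_add_left, map_add]
    exact h.add h'
  | smul c P _ h =>
    simp only [Pi.smul_apply, polyCoeff_smul_left, MvPolynomial.smul_eval]
    exact contDiff_const.mul h

/-- `C_r` is a bidifferential operator with smooth coefficients. -/
theorem exists_bchCoeff_eq_sum (r : ℕ) : ∃ (ι : Type) (_ : Fintype ι) (a : ι → ι → Fn n)
    (w : ι → List (Fin n)), (∀ s t, ContDiff ℝ ∞ (a s t)) ∧
      ∀ f h, ContDiff ℝ ∞ f → ContDiff ℝ ∞ h →
        bchCoeff b r f h = ∑ s, ∑ t, a s t * wordDeriv (w s) f * wordDeriv (w t) h := by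
  choose w hw using fun (k : ℕ) (i : Fin k → Fin n) => exists_wordDeriv_eq k i
  -- Taylor polynomials at ξ are combinations of these monomials centred at ξ, with derivatives as
  -- coefficients; the values of C_r on pairs of them are the coefficients of the bidifferential
  -- operator.
  let e : (k : ℕ) → (Fin k → Fin n) → (Fin n → ℝ) → MvPolynomial (Fin n) ℝ := fun k i ξ =>
    ((k.factorial : ℝ))⁻¹ • ∏ j, (MvPolynomial.X (i j) - MvPolynomial.C (ξ (i j)))
  have he : ∀ k i, e k i ∈ smoothFamily n := fun k i =>
    (smoothFamily n).smul_mem _ (prod_mem_smoothFamily i)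
  have ht : ∀ f, ContDiff ℝ ∞ f → ∀ ξ, taylorPoly r ξ f =
      ∑ s : (Σ k : Fin (r + 1), Fin k → Fin n), wordDeriv (w s.1 s.2) f ξ • e s.1 s.2 ξ := by
    intro f hf ξ
    rw [taylorPoly, Finset.sum_range, Fintype.sum_sigma]
    refine Finset.sum_congr rfl fun k _ => Finset.sum_congr rfl fun i _ => ?_
    simp only [e, hw _ _ f hf, MvPolynomial.smul_eq_C_mul, map_mul]
    ring
  refine ⟨Σ k : Fin (r + 1), Fin k → Fin n, inferInstance,
    fun s t ξ => MvPolynomial.eval ξ (polyCoeff b r (e s.1 s.2 ξ) (e t.1 t.2 ξ)),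
    fun s => w s.1 s.2, fun s t => contDiff_eval_polyCoeff b r (he _ _) (he _ _),
    fun f h hf hh => ?_⟩
  ext ξ
  have hl : ∀ q, polyCoeff b r (taylorPoly r ξ f) q = ∑ s : (Σ k : Fin (r + 1), Fin k → Fin n),
      wordDeriv (w s.1 s.2) f ξ • polyCoeff b r (e s.1 s.2 ξ) q := fun q => by
    let L : MvPolynomial (Fin n) ℝ →ₗ[ℝ] MvPolynomial (Fin n) ℝ :=
      { toFun := fun p => polyCoeff b r p q
        map_add' := fun p p' => polyCoeff_add_left b r p p' q
        map_smul' := fun c p => polyCoeff_smul_left b r c p q }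
    change L _ = _
    rw [ht f hf, map_sum]
    simp only [map_smul]
    rfl
  have hr : ∀ p, polyCoeff b r p (taylorPoly r ξ h) = ∑ s : (Σ k : Fin (r + 1), Fin k → Fin n),
      wordDeriv (w s.1 s.2) h ξ • polyCoeff b r p (e s.1 s.2 ξ) := fun p => by
    let L : MvPolynomial (Fin n) ℝ →ₗ[ℝ] MvPolynomial (Fin n) ℝ :=
      { toFun := fun q => polyCoeff b r p q
        map_add' := fun q q' => polyCoeff_add_right b r p q q'
        map_smul' := fun c q => polyCoeff_smul_right b r c p q }
    change L _ = _
    rw [ht h hh, map_sum]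
    simp only [map_smul]
    rfl
  change MvPolynomial.eval ξ (polyCoeff b r _ _) = _
  simp only [hl, hr, map_sum, MvPolynomial.smul_eval, Finset.sum_apply, Pi.mul_apply,
    Finset.mul_sum]
  refine Finset.sum_congr rfl fun s _ => Finset.sum_congr rfl fun t _ => ?_
  ring

theorem contDiff_bchCoeff (r : ℕ) {f h : Fn n} (hf : ContDiff ℝ ∞ f) (hh : ContDiff ℝ ∞ h) :
    ContDiff ℝ ∞ (bchCoeff b r f h) := by
  obtain ⟨ι, _, a, w, ha, he⟩ := exists_bchCoeff_eq_sum b r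
  rw [he f h hf hh]
  exact smooth_sum fun s _ => smooth_sum fun t _ =>
    ((ha s t).mul (contDiff_wordDeriv hf _)).mul (contDiff_wordDeriv hh _)

theorem tsupport_bchCoeff_subset (r : ℕ) {f h : Fn n} (hf : ContDiff ℝ ∞ f)
    (hh : ContDiff ℝ ∞ h) : tsupport (bchCoeff b r f h) ⊆ tsupport f ∩ tsupport h := by
  obtain ⟨ι, _, a, w, ha, he⟩ := exists_bchCoeff_eq_sum b r
  have h0 : ∀ u : Fn n, ∀ ξ, ξ ∉ tsupport u → ∀ w, wordDeriv w u ξ = 0 := fun u ξ hξ w =>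
    image_eq_zero_of_notMem_tsupport fun h => hξ (tsupport_wordDeriv_subset u w h)
  refine closure_minimal (fun ξ hξ => ?_) ((isClosed_tsupport f).inter (isClosed_tsupport h))
  rw [Function.mem_support, he f h hf hh] at hξ
  simp only [Finset.sum_apply, Pi.mul_apply] at hξ
  refine ⟨?_, ?_⟩ <;> by_contra hn <;> refine hξ ?_ <;> simp [h0 _ ξ hn]

theorem wordTendsto_bchCoeff_left (r : ℕ) {F : ℕ → Fn n} {f h : Fn n} (hF : ∀ m, ContDiff ℝ ∞ (F m))
    (hf : ContDiff ℝ ∞ f) (hh : ContDiff ℝ ∞ h) (hFf : WordTendsto F f) :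
    WordTendsto (fun m => bchCoeff b r (F m) h) (bchCoeff b r f h) := by
  obtain ⟨ι, _, a, w, ha, he⟩ := exists_bchCoeff_eq_sum b r
  have e : ∀ u, ContDiff ℝ ∞ u → bchCoeff b r u h =
      ∑ s, ∑ t, (a s t * wordDeriv (w t) h) * wordDeriv (w s) u := fun u hu => by
    rw [he u h hu hh]
    simp only [mul_right_comm]
  have hc : ∀ s t, ContDiff ℝ ∞ (a s t * wordDeriv (w t) h) := fun s t =>
    (ha s t).mul (contDiff_wordDeriv hh _)
  simp only [e _ (hF _), e f hf]
  have hs : ∀ s t u, ContDiff ℝ ∞ u →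
      ContDiff ℝ ∞ ((a s t * wordDeriv (w t) h) * wordDeriv (w s) u) := fun s t u hu =>
    (hc s t).mul (contDiff_wordDeriv hu _)
  exact WordTendsto.sum _ (fun s => WordTendsto.sum _ (fun t => (hFf.iterate _).mul_left
    (fun m => contDiff_wordDeriv (hF m) _) (contDiff_wordDeriv hf _) (hc s t))
    (fun t m => hs s t _ (hF m)) fun t => hs s t f hf)
    (fun s m => smooth_sum fun t _ => hs s t _ (hF m)) fun s => smooth_sum fun t _ => hs s t f hf

theorem wordTendsto_bchCoeff_right (r : ℕ) {F : ℕ → Fn n} {f h : Fn n}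
    (hF : ∀ m, ContDiff ℝ ∞ (F m)) (hf : ContDiff ℝ ∞ f) (hh : ContDiff ℝ ∞ h)
    (hFf : WordTendsto F f) :
    WordTendsto (fun m => bchCoeff b r h (F m)) (bchCoeff b r h f) := by
  obtain ⟨ι, _, a, w, ha, he⟩ := exists_bchCoeff_eq_sum b r
  have hc : ∀ s t, ContDiff ℝ ∞ (a s t * wordDeriv (w s) h) := fun s t =>
    (ha s t).mul (contDiff_wordDeriv hh _)
  simp only [he h _ hh (hF _), he h f hh hf]
  have hs : ∀ s t u, ContDiff ℝ ∞ u →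
      ContDiff ℝ ∞ ((a s t * wordDeriv (w s) h) * wordDeriv (w t) u) := fun s t u hu =>
    (hc s t).mul (contDiff_wordDeriv hu _)
  exact WordTendsto.sum _ (fun s => WordTendsto.sum _ (fun t => (hFf.iterate _).mul_left
    (fun m => contDiff_wordDeriv (hF m) _) (contDiff_wordDeriv hf _) (hc s t))
    (fun t m => hs s t _ (hF m)) fun t => hs s t f hf)
    (fun s m => smooth_sum fun t _ => hs s t _ (hF m)) fun s => smooth_sum fun t _ => hs s t f hf

/-- C_r(f, h) is supported in supp f ∩ supp h, so compactness of the intersection with O is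
inherited from either factor. -/
theorem isStarIdeal_compactOn (O : Set (Fin n → ℝ)) : IsStarIdeal b (compactOn O) := by
  have key : ∀ f h, ContDiff ℝ ∞ f → ContDiff ℝ ∞ h → ∀ r u, u ∈ compactOn O →
      tsupport (bchCoeff b r f h) ⊆ tsupport u → bchCoeff b r f h ∈ compactOn O := by
    intro f h hf hh r u hu hs
    refine ⟨contDiff_bchCoeff b r hf hh, ?_⟩
    rw [← Set.inter_eq_self_of_subset_right hs, ← Set.inter_assoc]
    exact hu.2.inter_right (isClosed_tsupport _)
  refine ⟨fun f hf => hf.1, fun A hA B hB => ⟨fun m => ?_, fun m => ?_⟩⟩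
  · rw [star, PowerSeries.coeff_mk]
    exact Submodule.sum_mem _ fun p _ => Submodule.sum_mem _ fun q _ =>
      key _ _ (hA _) (hB _).1 _ _ (hB _)
        ((tsupport_bchCoeff_subset b _ (hA _) (hB _).1).trans Set.inter_subset_right)
  · rw [star, PowerSeries.coeff_mk]
    exact Submodule.sum_mem _ fun p _ => Submodule.sum_mem _ fun q _ =>
      key _ _ (hB _).1 (hA _) _ _ (hB _)
        ((tsupport_bchCoeff_subset b _ (hB _).1 (hA _)).trans Set.inter_subset_left)

end Bidiff

/-! ### Linear algebra of the Kirillov–Kostant–Souriau form -/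

section KirillovForm

open Matrix

variable {n : ℕ} {g : Type*} [LieRing g] [LieAlgebra ℝ g] (b : Module.Basis (Fin n) ℝ g)

/-- The functional on `g` with coordinates `ξ`. -/
def functional (ξ : Fin n → ℝ) : g →ₗ[ℝ] ℝ := ∑ i, ξ i • b.coord i

theorem functional_apply (ξ : Fin n → ℝ) (x : g) : functional b ξ x = linearFn b x ξ := by
  simp [functional, linearFn, mul_comm]

/-- The matrix `ξ ([e_i, e_j])`. -/
def lieMatrix (ξ : Fin n → ℝ) : Matrix (Fin n) (Fin n) ℝ :=
  Matrix.of fun i j => linearFn b ⁅b i, b j⁆ ξ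

theorem continuous_lieMatrix : Continuous (lieMatrix b) := by
  refine continuous_matrix fun i j => ?_
  change Continuous (linearFn b _)
  rw [← polyFn_linPoly]
  exact (contDiff_polyFn _).continuous

theorem lieMatrix_transpose (ξ : Fin n → ℝ) : (lieMatrix b ξ)ᵀ = -lieMatrix b ξ := by
  ext i j
  simp only [transpose_apply, lieMatrix, of_apply, Matrix.neg_apply, ← functional_apply]
  rw [← lie_skew, map_neg]

theorem lieMatrix_mulVec (ξ : Fin n → ℝ) (x : g) : lieMatrix b ξ *ᵥ b.repr x = coad b x ξ := by
  ext i
  rw [coad, ← functional_apply, ← map_neg, lie_skew]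
  conv_rhs => rw [← b.sum_repr x, lie_sum, map_sum]
  simp only [mulVec, dotProduct, lieMatrix, of_apply, lie_smul, map_smul, functional_apply,
    smul_eq_mul, mul_comm]

theorem linearFn_lie (x y : g) (ξ : Fin n → ℝ) :
    linearFn b ⁅x, y⁆ ξ = b.repr x ⬝ᵥ coad b y ξ := by
  rw [← functional_apply]
  conv_lhs => rw [← b.sum_repr x, sum_lie, map_sum]
  refine Finset.sum_congr rfl fun i _ => ?_
  rw [smul_lie, map_smul, smul_eq_mul, coad, ← functional_apply, ← map_neg, lie_skew]

/-- Well-definedness of the form: it depends only on the tangent vectors, so the arbitrary choice in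
`OrbitChart.generator` is harmless. -/
theorem kks_congr {x x' y y' : g} {ξ : Fin n → ℝ} (hx : coad b x ξ = coad b x' ξ)
    (hy : coad b y ξ = coad b y' ξ) : linearFn b ⁅x, y⁆ ξ = linearFn b ⁅x', y'⁆ ξ := by
  rw [linearFn_lie, hy, ← linearFn_lie, ← functional_apply, ← functional_apply, ← lie_skew,
    ← lie_skew x', map_neg, map_neg, functional_apply, functional_apply, linearFn_lie, hx,
    ← linearFn_lie]

/-- Change of frame for the form. X and Y need be related only after multiplication by B, since
elements of g are determined by tangent vectors only up to the kernel of B. -/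
theorem transpose_kks_mul {d e : Type*} [Fintype d] [Fintype e] {B : Matrix (Fin n) (Fin n) ℝ} (hB : Bᵀ = -B)
    {X : Matrix (Fin n) d ℝ} {Y : Matrix (Fin n) e ℝ} {T : Matrix e d ℝ}
    (h : B * X = B * Y * T) : Xᵀ * B * X = Tᵀ * (Yᵀ * B * Y) * T := by
  have h2 : Xᵀ * B = Tᵀ * (Yᵀ * B) := by
    have := congrArg Matrix.transpose h
    simp only [transpose_mul, hB, Matrix.mul_neg] at this
    exact neg_injective this
  rw [h2, Matrix.mul_assoc, Matrix.mul_assoc, h]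
  simp only [Matrix.mul_assoc]

theorem det_transpose_mul_self_ne_zero {d : ℕ} {J : Matrix (Fin n) (Fin d) ℝ}
    (hJ : Function.Injective (J *ᵥ ·)) : (Jᵀ * J).det ≠ 0 := by
  intro h
  obtain ⟨v, hv, h0⟩ := Matrix.exists_mulVec_eq_zero_iff.2 h
  have h1 : (J *ᵥ v) ⬝ᵥ (J *ᵥ v) = 0 := by
    rw [dotProduct_mulVec, vecMul_mulVec, ← mulVec_transpose, transpose_mul, transpose_transpose,
      h0, zero_dotProduct]
  refine hv (hJ ?_)
  simp only [mulVec_zero]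
  exact dotProduct_self_eq_zero.1 h1

/-- The determinant of the Kirillov form on the range of `J`, computed from `J` alone. -/
theorem abs_det_kks {d : ℕ} {B : Matrix (Fin n) (Fin n) ℝ} (hB : Bᵀ = -B)
    {X J : Matrix (Fin n) (Fin d) ℝ} (hX : B * X = J) (hJ : Function.Injective (J *ᵥ ·))
    (hr : ∀ v, ∃ t, B *ᵥ v = J *ᵥ t) : (Jᵀ * B * J).det ≠ 0 ∧
      |(Xᵀ * B * X).det| = (Jᵀ * J).det ^ 2 / |(Jᵀ * B * J).det| := by
  have hD := det_transpose_mul_self_ne_zero hJ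
  choose t ht using fun j => hr (J.col j)
  -- N is the matrix of B restricted to the range of J, which B preserves. It eliminates X, whose
  -- columns are chosen without any continuity.
  let N : Matrix (Fin d) (Fin d) ℝ := Matrix.of fun i j => t j i
  have hN : B * J = J * N := by
    ext i j
    exact congrFun (ht j) i
  have hJt : Jᵀ = -(Xᵀ * B) := by
    rw [← hX, transpose_mul, hB, Matrix.mul_neg]
  have h1 : (Jᵀ * B * J).det = (Jᵀ * J).det * N.det := by
    rw [Matrix.mul_assoc, hN, ← Matrix.mul_assoc, det_mul]
  have h2 : |(Xᵀ * B * X).det| * |N.det| = |(Jᵀ * J).det| := by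
    have : Jᵀ * J = -((Xᵀ * B * X) * N) := by
      conv_lhs => rw [hJt]
      rw [Matrix.neg_mul, Matrix.mul_assoc, hN, ← hX]
      simp only [Matrix.mul_assoc]
    rw [this, det_neg, det_mul, abs_mul, abs_pow, abs_neg, abs_one, one_pow, one_mul, abs_mul]
  have hN0 : N.det ≠ 0 := by
    intro h
    rw [h, abs_zero, mul_zero] at h2
    exact hD (abs_eq_zero.1 h2.symm)
  have h3 : (Jᵀ * B * J).det ≠ 0 := h1 ▸ mul_ne_zero hD hN0
  refine ⟨h3, ?_⟩
  rw [eq_div_iff (abs_pos.2 h3).ne', h1, abs_mul, mul_left_comm, h2, ← sq, sq_abs]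

end KirillovForm

/-! ### Comparison of the local Liouville measures -/

namespace OrbitChart

open Matrix

variable {n : ℕ} {g : Type*} [LieRing g] [LieAlgebra ℝ g] {b : Module.Basis (Fin n) ℝ g}
  {O : Set (Fin n → ℝ)} (c : OrbitChart b O)

/-- The Jacobian matrix of a local parametrization. -/
def jac (u : Fin c.dim → ℝ) : Matrix (Fin n) (Fin c.dim) ℝ :=
  Matrix.of fun a i => fderiv ℝ c.toFun u (Pi.single i 1) a

theorem jac_mulVec (u v : Fin c.dim → ℝ) : c.jac u *ᵥ v = fderiv ℝ c.toFun u v := by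
  have : v = ∑ i, v i • (Pi.single i 1 : Fin c.dim → ℝ) := by
    ext j
    simp [Finset.sum_apply, Pi.single_apply]
  conv_rhs => rw [this, map_sum]
  ext a
  simp [mulVec, dotProduct, jac, mul_comm]

theorem det_comp_fderiv (P : Matrix (Fin c.dim) (Fin n) ℝ) (u : Fin c.dim → ℝ) :
    ((LinearMap.toContinuousLinearMap P.mulVecLin).comp (fderiv ℝ c.toFun u)).det =
      (P * c.jac u).det := by
  rw [← LinearMap.det_toLin', ContinuousLinearMap.det]
  congr 1
  ext1 i
  ext j
  simp
  rfl

theorem continuousOn_jac : ContinuousOn c.jac c.source := by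
  have h : ContinuousOn (fderiv ℝ c.toFun) c.source :=
    c.contDiffOn.continuousOn_fderiv_of_isOpen c.isOpen_source (by simp)
  refine continuousOn_pi.2 fun a => continuousOn_pi.2 fun i => ?_
  exact (continuous_apply a).comp_continuousOn (h.clm_apply continuousOn_const)

theorem mapsTo : Set.MapsTo c.toFun c.source O := by
  obtain ⟨V, -, hV⟩ := c.open_image c.source subset_rfl c.isOpen_source
  intro u hu
  exact (hV ▸ Set.mem_image_of_mem _ hu : c.toFun u ∈ O ∩ V).1

/-- The coordinates of the generators. -/
def genMatrix (u : Fin c.dim → ℝ) : Matrix (Fin n) (Fin c.dim) ℝ :=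
  Matrix.of fun a i => b.repr (c.generator u i) a

theorem coad_generator {u : Fin c.dim → ℝ} (hu : u ∈ c.source) (i : Fin c.dim) :
    coad b (c.generator u i) (c.toFun u) = fderiv ℝ c.toFun u (Pi.single i 1) := by
  refine Function.invFun_eq (f := fun x : g => coad b x (c.toFun u)) ?_
  have := Set.mem_range_self (f := fderiv ℝ c.toFun u) (Pi.single i 1)
  rw [c.range_fderiv u hu] at this
  exact this

theorem lieMatrix_mul_genMatrix {u : Fin c.dim → ℝ} (hu : u ∈ c.source) :
    lieMatrix b (c.toFun u) * c.genMatrix u = c.jac u := by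
  ext a i
  rw [jac, of_apply, ← c.coad_generator hu, ← lieMatrix_mulVec]
  rfl

theorem kksMatrix_eq {u : Fin c.dim → ℝ} (hu : u ∈ c.source) : c.kksMatrix u =
    (c.genMatrix u)ᵀ * lieMatrix b (c.toFun u) * c.genMatrix u := by
  rw [Matrix.mul_assoc, c.lieMatrix_mul_genMatrix hu]
  ext i j
  rw [kksMatrix, of_apply, linearFn_lie, c.coad_generator hu]
  rfl

theorem jac_injective {u : Fin c.dim → ℝ} (hu : u ∈ c.source) :
    Function.Injective (c.jac u *ᵥ ·) := by
  simp only [jac_mulVec]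
  exact c.injective_fderiv u hu

theorem exists_lieMatrix_mulVec_eq {u : Fin c.dim → ℝ} (hu : u ∈ c.source) (v : Fin n → ℝ) :
    ∃ t, lieMatrix b (c.toFun u) *ᵥ v = c.jac u *ᵥ t := by
  have : coad b (b.equivFun.symm v) (c.toFun u) ∈ Set.range (fderiv ℝ c.toFun u) := by
    rw [c.range_fderiv u hu]
    exact Set.mem_range_self _
  obtain ⟨t, ht⟩ := this
  refine ⟨t, ?_⟩
  rw [jac_mulVec, ht, ← lieMatrix_mulVec]
  congr 1
  exact (b.equivFun.apply_symm_apply v).symm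

/-- At a common point both tangent spaces are {ad*_x η}, so one frame is expressed in the other
pointwise; no smooth transition map is required. -/
theorem exists_jac_eq_mul (c c' : OrbitChart b O) {u : Fin c.dim → ℝ} {w : Fin c'.dim → ℝ}
    (hu : u ∈ c.source) (hw : w ∈ c'.source) (h : c.toFun u = c'.toFun w) :
    ∃ T : Matrix (Fin c'.dim) (Fin c.dim) ℝ, c.jac u = c'.jac w * T := by
  have : ∀ i, ∃ t, fderiv ℝ c.toFun u (Pi.single i 1) = c'.jac w *ᵥ t := fun i => by
    rw [← c.coad_generator hu, h, ← lieMatrix_mulVec]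
    exact c'.exists_lieMatrix_mulVec_eq hw _
  choose t ht using this
  refine ⟨Matrix.of fun j i => t i j, ?_⟩
  ext a i
  exact congrFun (ht i) a

theorem dim_le (c c' : OrbitChart b O) {u : Fin c.dim → ℝ} {w : Fin c'.dim → ℝ}
    (hu : u ∈ c.source) (hw : w ∈ c'.source) (h : c.toFun u = c'.toFun w) : c.dim ≤ c'.dim := by
  obtain ⟨T, hT⟩ := c.exists_jac_eq_mul c' hu hw h
  have hi : Function.Injective (T.mulVecLin) := fun x y hxy => c.jac_injective hu (by
    simp only [hT, ← mulVec_mulVec]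
    exact congrArg _ hxy)
  simpa using LinearMap.finrank_le_finrank_of_injective hi

theorem kksMatrix_eq_mul (c c' : OrbitChart b O) {u : Fin c.dim → ℝ} {w : Fin c'.dim → ℝ}
    (hu : u ∈ c.source) (hw : w ∈ c'.source) (h : c.toFun u = c'.toFun w)
    {T : Matrix (Fin c'.dim) (Fin c.dim) ℝ} (hT : c.jac u = c'.jac w * T) :
    c.kksMatrix u = Tᵀ * c'.kksMatrix w * T := by
  rw [c.kksMatrix_eq hu, c'.kksMatrix_eq hw, h]
  refine transpose_kks_mul (lieMatrix_transpose b _) ?_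
  rw [c'.lieMatrix_mul_genMatrix hw, ← hT, ← h, c.lieMatrix_mul_genMatrix hu]

/-- The density of the Liouville measure. -/
def density (u : Fin c.dim → ℝ) : ENNReal :=
  ENNReal.ofReal (Real.sqrt (c.kksMatrix u).det)

theorem aemeasurable_toFun : AEMeasurable c.toFun ((volume.restrict c.source).withDensity c.density) :=
  (c.contDiffOn.continuousOn.aemeasurable c.isOpen_source.measurableSet).mono_ac
    (withDensity_absolutelyContinuous _ _)

theorem measurableSet_preimage {S : Set (Fin n → ℝ)} (hS : MeasurableSet S) :
    MeasurableSet (c.source ∩ c.toFun ⁻¹' S) := by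
  have h : Measurable fun u : c.source => c.toFun u :=
    (continuousOn_iff_continuous_domRestrict.1 c.contDiffOn.continuousOn).measurable
  have := c.isOpen_source.measurableSet.subtype_image (h hS)
  convert this using 1
  ext u
  simp [and_comm]

theorem measure_apply {S : Set (Fin n → ℝ)} (hS : MeasurableSet S) :
    c.measure S = ∫⁻ u in c.source ∩ c.toFun ⁻¹' S, c.density u := by
  change (((volume.restrict c.source).withDensity c.density).map c.toFun) S = _
  rw [Measure.map_apply_of_aemeasurable c.aemeasurable_toFun hS, withDensity_apply',
    Measure.restrict_restrict' c.isOpen_source.measurableSet, Set.inter_comm]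

theorem measure_eq_zero {S : Set (Fin n → ℝ)} (hS : MeasurableSet S) (hO : Disjoint O S) :
    c.measure S = 0 := by
  rw [c.measure_apply hS]
  have : c.source ∩ c.toFun ⁻¹' S = ∅ :=
    Set.eq_empty_of_forall_notMem fun u hu => Set.disjoint_left.1 hO (c.mapsTo hu.1) hu.2
  rw [this, Measure.restrict_empty, lintegral_zero_measure]

/-- The generators need not vary continuously with u. The bound comes from the formula of
`abs_det_kks`, which involves only the Jacobian and `lieMatrix` and is continuous. -/
theorem exists_density_le {C : Set (Fin c.dim → ℝ)} (hC : IsCompact C) (hCs : C ⊆ c.source) :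
    ∃ M : ℝ, ∀ u ∈ C, c.density u ≤ ENNReal.ofReal M := by
  let ρ : (Fin c.dim → ℝ) → ℝ := fun u => √(((c.jac u)ᵀ * c.jac u).det ^ 2 /
    |((c.jac u)ᵀ * lieMatrix b (c.toFun u) * c.jac u).det|)
  have key := fun u (hu : u ∈ c.source) => abs_det_kks (lieMatrix_transpose b (c.toFun u))
    (c.lieMatrix_mul_genMatrix hu) (c.jac_injective hu) (c.exists_lieMatrix_mulVec_eq hu)
  have hJ : ContinuousOn c.jac C := c.continuousOn_jac.mono hCs
  have hB : ContinuousOn (fun u => lieMatrix b (c.toFun u)) C :=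
    (continuous_lieMatrix b).comp_continuousOn (c.contDiffOn.continuousOn.mono hCs)
  have hJt : ContinuousOn (fun u => (c.jac u)ᵀ) C :=
    continuous_id.matrix_transpose.comp_continuousOn hJ
  have hmul : ∀ {k l m : ℕ} {P : (Fin c.dim → ℝ) → Matrix (Fin k) (Fin l) ℝ}
      {Q : (Fin c.dim → ℝ) → Matrix (Fin l) (Fin m) ℝ}, ContinuousOn P C → ContinuousOn Q C →
      ContinuousOn (fun u => P u * Q u) C := fun hP hQ =>
    (Continuous.matrix_mul continuous_fst continuous_snd).comp_continuousOn (hP.prodMk hQ)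
  have hdet : ∀ {k : ℕ} {P : (Fin c.dim → ℝ) → Matrix (Fin k) (Fin k) ℝ}, ContinuousOn P C →
      ContinuousOn (fun u => (P u).det) C := fun hP =>
    continuous_id.matrix_det.comp_continuousOn hP
  have hρ : ContinuousOn ρ C := by
    refine Real.continuous_sqrt.comp_continuousOn (ContinuousOn.div ((hdet (hmul hJt hJ)).pow 2)
      (hdet (hmul (hmul hJt hB) hJ)).abs fun u hu => (abs_pos.2 (key u (hCs hu)).1).ne')
  obtain ⟨M, hM⟩ := hC.exists_bound_of_continuousOn hρ
  refine ⟨M, fun u hu => ENNReal.ofReal_le_ofReal ?_⟩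
  refine le_trans (Real.sqrt_le_sqrt (le_abs_self _)) (le_trans (le_of_eq ?_)
    (le_trans (le_abs_self _) (hM u hu)))
  rw [c.kksMatrix_eq (hCs hu), (key u (hCs hu)).2]

/-- The local Liouville measure as the image of a measure on `ℝ^d` under a linear projection. -/
theorem measure_eq_lintegral_image {d : ℕ} (hd : c.dim = d) (P : Matrix (Fin d) (Fin n) ℝ)
    {S : Set (Fin n → ℝ)} (hS : MeasurableSet S)
    (hinj : Set.InjOn (fun u => P *ᵥ c.toFun u) (c.source ∩ c.toFun ⁻¹' S))
    (G : (Fin d → ℝ) → ENNReal)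
    (hG : ∀ u ∈ c.source ∩ c.toFun ⁻¹' S, ∃ (K : Matrix (Fin d) (Fin d) ℝ)
      (J : Matrix (Fin n) (Fin d) ℝ) (T : Matrix (Fin d) (Fin c.dim) ℝ),
      c.jac u = J * T ∧ c.kksMatrix u = Tᵀ * K * T ∧ (P * J).det ≠ 0 ∧
        G (P *ᵥ c.toFun u) = ENNReal.ofReal (√K.det / |(P * J).det|)) :
    c.measure S = ∫⁻ y in (fun u => P *ᵥ c.toFun u) '' (c.source ∩ c.toFun ⁻¹' S), G y := by
  subst hd
  let L : (Fin n → ℝ) →L[ℝ] (Fin c.dim → ℝ) := LinearMap.toContinuousLinearMap P.mulVecLin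
  have hder : ∀ u ∈ c.source ∩ c.toFun ⁻¹' S, HasFDerivWithinAt (fun u => P *ᵥ c.toFun u)
      (L.comp (fderiv ℝ c.toFun u)) (c.source ∩ c.toFun ⁻¹' S) u := fun u hu =>
    (L.hasFDerivAt.comp u ((c.contDiffOn.contDiffAt
      (c.isOpen_source.mem_nhds hu.1)).differentiableAt (by simp)).hasFDerivAt).hasFDerivWithinAt
  have hdet : ∀ u, (L.comp (fderiv ℝ c.toFun u)).det = (P * c.jac u).det := c.det_comp_fderiv P
  rw [lintegral_image_eq_lintegral_abs_det_fderiv_mul volume (c.measurableSet_preimage hS) hder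
    hinj, c.measure_apply hS]
  refine setLIntegral_congr_fun (c.measurableSet_preimage hS) fun u hu => ?_
  obtain ⟨K, J, T, hJ, hK, h0, hGu⟩ := hG u hu
  simp only [hGu, hdet, density]
  -- The Jacobian |det (P J)| |det T| times G leaves |det T| √(det K), which is the Liouville
  -- density of the chart.
  rw [hJ, hK, ← Matrix.mul_assoc, det_mul, det_mul, det_mul, det_transpose,
    ← ENNReal.ofReal_mul (abs_nonneg _)]
  congr 1
  have : T.det * K.det * T.det = T.det ^ 2 * K.det := by ring
  rw [this, Real.sqrt_mul (sq_nonneg _), Real.sqrt_sq_eq_abs, abs_mul]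
  have := (abs_pos.2 h0).ne'
  field_simp

/-- Near a point of the image of a local parametrization, its Liouville measure dominates those of
the other parametrizations. -/
theorem exists_open_measure_le {u₀ : Fin c.dim → ℝ} (hu₀ : u₀ ∈ c.source) :
    ∃ V, IsOpen V ∧ c.toFun u₀ ∈ V ∧ c.measure V < ⊤ ∧
      ∀ (c' : OrbitChart b O) (S : Set (Fin n → ℝ)), MeasurableSet S → S ⊆ V →
        c'.measure S ≤ c.measure S := by
  -- P is the transposed Jacobian at u₀, so P times the Jacobian is a Gram matrix, invertible at u₀.
  -- By the inverse function theorem P gives linear coordinates on the orbit near this point, usable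
  -- for every chart at once.
  set P : Matrix (Fin c.dim) (Fin n) ℝ := (c.jac u₀)ᵀ with hP
  let L : (Fin n → ℝ) →L[ℝ] (Fin c.dim → ℝ) := LinearMap.toContinuousLinearMap P.mulVecLin
  have hstrict : HasStrictFDerivAt (fun u => L (c.toFun u)) (L.comp (fderiv ℝ c.toFun u₀)) u₀ :=
    L.hasStrictFDerivAt.comp u₀ ((c.contDiffOn.contDiffAt
      (c.isOpen_source.mem_nhds hu₀)).hasStrictFDerivAt (by simp))
  have hdet : (L.comp (fderiv ℝ c.toFun u₀)).det ≠ 0 := by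
    rw [c.det_comp_fderiv, hP]
    exact det_transpose_mul_self_ne_zero (c.jac_injective hu₀)
  have hstrict' : HasStrictFDerivAt (fun u => L (c.toFun u))
      ((L.comp (fderiv ℝ c.toFun u₀)).toContinuousLinearEquivOfDetNeZero hdet :
        (Fin c.dim → ℝ) →L[ℝ] (Fin c.dim → ℝ)) u₀ := by
    rw [ContinuousLinearMap.coe_toContinuousLinearEquivOfDetNeZero]
    exact hstrict
  let e := hstrict'.toOpenPartialHomeomorph (fun u => L (c.toFun u))
  have he : Set.InjOn (fun u => L (c.toFun u)) e.source := e.injOn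
  obtain ⟨ε, hε, hball⟩ := Metric.nhds_basis_closedBall.mem_iff.1 (c.isOpen_source.mem_nhds hu₀)
  have hopen : IsOpen (c.source ∩ {u | (P * c.jac u).det ≠ 0}) := by
    have hc : ContinuousOn (fun u => (P * c.jac u).det) c.source :=
      (Continuous.matrix_det (Continuous.matrix_mul continuous_const continuous_id)).comp_continuousOn
        c.continuousOn_jac
    exact hc.isOpen_inter_preimage c.isOpen_source isOpen_compl_singleton
  -- On W the projected chart is injective, the density is bounded and P stays transversal to the
  -- kernel of projection on tangent spaces.
  let W := (e.source ∩ Metric.ball u₀ ε) ∩ (c.source ∩ {u | (P * c.jac u).det ≠ 0})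
  have hWo : IsOpen W := (e.open_source.inter Metric.isOpen_ball).inter hopen
  have hu₀W : u₀ ∈ W := ⟨⟨hstrict'.mem_toOpenPartialHomeomorph_source, Metric.mem_ball_self hε⟩,
    hu₀, det_transpose_mul_self_ne_zero (c.jac_injective hu₀)⟩
  have hWs : W ⊆ c.source := fun u hu => hu.2.1
  obtain ⟨V, hV, hWV⟩ := c.open_image W hWs hWo
  have hVW : ∀ {η}, η ∈ O → η ∈ V → ∃ w ∈ W, c.toFun w = η := fun {η} h h' => by
    have : η ∈ c.toFun '' W := hWV ▸ ⟨h, h'⟩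
    exact this
  refine ⟨V, hV, ((hWV ▸ Set.mem_image_of_mem _ hu₀W : c.toFun u₀ ∈ O ∩ V)).2, ?_, ?_⟩
  · rw [c.measure_apply hV.measurableSet]
    obtain ⟨M, hM⟩ := c.exists_density_le (isCompact_closedBall u₀ ε) hball
    have hsub : c.source ∩ c.toFun ⁻¹' V ⊆ Metric.closedBall u₀ ε := fun u hu => by
      obtain ⟨w, hw, hwu⟩ := hVW (c.mapsTo hu.1) hu.2
      rw [← c.injOn (hWs hw) hu.1 hwu]
      exact Metric.ball_subset_closedBall hw.1.2
    calc _ ≤ ∫⁻ u in Metric.closedBall u₀ ε, c.density u := lintegral_mono_set hsub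
      _ ≤ ∫⁻ _u in Metric.closedBall u₀ ε, ENNReal.ofReal M :=
        setLIntegral_mono measurable_const hM
      _ < ⊤ := by
        rw [setLIntegral_const]
        exact ENNReal.mul_lt_top ENNReal.ofReal_lt_top (isCompact_closedBall _ _).measure_lt_top
  · intro c' S hS hSV
    by_cases hne : (c'.source ∩ c'.toFun ⁻¹' S).Nonempty
    swap
    · rw [c'.measure_apply hS, Set.not_nonempty_iff_eq_empty.1 hne, Measure.restrict_empty,
        lintegral_zero_measure]
      exact zero_le
    have hd : c'.dim = c.dim := by
      obtain ⟨u, hu, huS⟩ := hne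
      obtain ⟨w, hw, hwu⟩ := hVW (c'.mapsTo hu) (hSV huS)
      exact le_antisymm (c'.dim_le c hu (hWs hw) hwu.symm) (c.dim_le c' (hWs hw) hu hwu)
    let f : (Fin c.dim → ℝ) → (Fin c.dim → ℝ) := fun u => P *ᵥ c.toFun u
    have hf : Set.InjOn f W := he.mono fun u hu => hu.1.1
    let G : (Fin c.dim → ℝ) → ENNReal := fun y =>
      ENNReal.ofReal (√(c.kksMatrix (Function.invFunOn f W y)).det /
        |(P * c.jac (Function.invFunOn f W y)).det|)
    have hGf : ∀ w ∈ W, G (f w) = ENNReal.ofReal (√(c.kksMatrix w).det / |(P * c.jac w).det|) :=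
      fun w hw => by
        simp only [G]
        rw [hf.leftInvOn_invFunOn hw]
    have key : ∀ c'' : OrbitChart b O, c''.dim = c.dim → c''.measure S =
        ∫⁻ y in (fun u => P *ᵥ c''.toFun u) '' (c''.source ∩ c''.toFun ⁻¹' S), G y := by
      intro c'' hd
      refine c''.measure_eq_lintegral_image hd P hS ?_ G ?_
      · intro u hu v hv huv
        obtain ⟨w, hw, hwu⟩ := hVW (c''.mapsTo hu.1) (hSV hu.2)
        obtain ⟨z, hz, hzv⟩ := hVW (c''.mapsTo hv.1) (hSV hv.2)
        simp only [← hwu, ← hzv] at huv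
        have : w = z := hf hw hz huv
        refine c''.injOn hu.1 hv.1 ?_
        rw [← hwu, this, hzv]
      · intro u hu
        obtain ⟨w, hw, hwu⟩ := hVW (c''.mapsTo hu.1) (hSV hu.2)
        obtain ⟨T, hT⟩ := c''.exists_jac_eq_mul c hu.1 (hWs hw) hwu.symm
        refine ⟨c.kksMatrix w, c.jac w, T, hT, c''.kksMatrix_eq_mul c hu.1 (hWs hw) hwu.symm hT,
          hw.2.2, ?_⟩
        rw [← hwu]
        exact hGf w hw
    rw [key c' hd, key c rfl]
    -- Both measures of S are now integrals of the same G, and every point of S reached by c' is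
    -- reached by c. Only an inequality results, as c' need not cover S.
    refine lintegral_mono_set ?_
    rintro y ⟨u, hu, rfl⟩
    obtain ⟨w, hw, hwu⟩ := hVW (c'.mapsTo hu.1) (hSV hu.2)
    refine ⟨w, ⟨hWs hw, ?_⟩, ?_⟩
    · rw [Set.mem_preimage, hwu]
      exact hu.2
    · simp only [hwu]

end OrbitChart

/-! ### The Liouville measure: concentration on the orbit and local finiteness -/

section Liouville

variable {n : ℕ} {g : Type*} [LieRing g] [LieAlgebra ℝ g] {b : Module.Basis (Fin n) ℝ g}
  {O : Set (Fin n → ℝ)}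

theorem OrbitChart.measure_le_liouville (c : OrbitChart b O) : c.measure ≤ liouville b O :=
  le_iSup (fun c : OrbitChart b O => c.measure) c

/-- A supremum of measures is not computed set by set, so a measure vanishing on S is exhibited that
dominates all local measures. -/
theorem liouville_eq_zero {S : Set (Fin n → ℝ)} (hS : MeasurableSet S) (hO : Disjoint O S) :
    liouville b O S = 0 := by
  have h : liouville b O ≤ (liouville b O).restrict Sᶜ := by
    refine iSup_le fun c => Measure.le_iff.2 fun T hT => ?_
    rw [Measure.restrict_apply hT]
    calc c.measure T ≤ c.measure (T ∩ Sᶜ ∪ S) := measure_mono fun x hx => by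
          by_cases h : x ∈ S
          · exact Or.inr h
          · exact Or.inl ⟨hx, h⟩
      _ ≤ c.measure (T ∩ Sᶜ) + c.measure S := measure_union_le _ _
      _ = c.measure (T ∩ Sᶜ) := by rw [c.measure_eq_zero hS hO, add_zero]
      _ ≤ _ := c.measure_le_liouville _
  refine le_antisymm ((h S).trans (le_of_eq ?_)) zero_le
  rw [Measure.restrict_apply hS, Set.inter_compl_self, measure_empty]

/-- Again by an upper bound of the family: inside V one chart dominates the others, and outside V
the Liouville measure itself serves. -/
theorem exists_open_liouville_lt_top (hO : IsEmbeddedOrbit b O) {ξ : Fin n → ℝ} (hξ : ξ ∈ O) :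
    ∃ V, IsOpen V ∧ ξ ∈ V ∧ liouville b O V < ⊤ := by
  obtain ⟨c, u, hu, rfl⟩ := hO ξ hξ
  obtain ⟨V, hV, huV, hfin, hle⟩ := c.exists_open_measure_le hu
  have h : liouville b O ≤ c.measure + (liouville b O).restrict Vᶜ := by
    refine iSup_le fun c' => Measure.le_iff.2 fun T hT => ?_
    rw [Measure.add_apply, Measure.restrict_apply hT]
    calc c'.measure T ≤ c'.measure (T ∩ V) + c'.measure (T ∩ Vᶜ) := by
          rw [← Set.sdiff_eq]
          exact measure_le_inter_add_sdiff _ _ _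
      _ ≤ c.measure (T ∩ V) + liouville b O (T ∩ Vᶜ) := add_le_add
          (hle c' _ (hT.inter hV.measurableSet) Set.inter_subset_right) (c'.measure_le_liouville _)
      _ ≤ _ := add_le_add (measure_mono Set.inter_subset_left) le_rfl
  refine ⟨V, hV, huV, ((h V).trans (le_of_eq ?_)).trans_lt hfin⟩
  rw [Measure.add_apply, Measure.restrict_apply hV.measurableSet, Set.inter_compl_self,
    measure_empty, add_zero]

theorem liouville_lt_top (hO : IsEmbeddedOrbit b O) {K : Set (Fin n → ℝ)} (hK : IsCompact K)
    (hKO : K ⊆ O) : liouville b O K < ⊤ := by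
  refine hK.measure_lt_top_of_nhdsWithin fun ξ hξ => ?_
  obtain ⟨V, hV, hξV, hfin⟩ := exists_open_liouville_lt_top hO (hKO hξ)
  exact ⟨V, mem_nhdsWithin_of_mem_nhds (hV.mem_nhds hξV), hfin⟩

/-- Continuous functions which vanish off a closed set that meets the orbit in a compact set. -/
theorem integrable_and_integral_eq (hO : IsEmbeddedOrbit b O) {u : Fn n} (hu : Continuous u)
    {Z : Set (Fin n → ℝ)} (hZ : IsClosed Z) (hK : IsCompact (O ∩ Z)) (h0 : ∀ ξ ∉ Z, u ξ = 0) :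
    IntegrableOn u (O ∩ Z) (liouville b O) ∧ Integrable u (liouville b O) ∧
      ∫ ξ, u ξ ∂(liouville b O) = ∫ ξ in O ∩ Z, u ξ ∂(liouville b O) := by
  have hKm : MeasurableSet (O ∩ Z) := hK.isClosed.measurableSet
  have hae : u =ᵐ[liouville b O] (O ∩ Z).indicator u := by
    -- O itself is not assumed measurable, but this difference is measurable and disjoint from O.
    have hnull : liouville b O (Z \ (O ∩ Z)) = 0 := by
      refine liouville_eq_zero (hZ.measurableSet.diff hKm) ?_
      exact Set.disjoint_left.2 fun ξ h h' => h'.2 ⟨h, h'.1⟩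
    filter_upwards [measure_eq_zero_iff_ae_notMem.1 hnull] with ξ hξ
    by_cases h : ξ ∈ Z
    · rw [Set.indicator_of_mem]
      by_contra h'
      exact hξ ⟨h, h'⟩
    · rw [Set.indicator_of_notMem fun h' => h h'.2, h0 ξ h]
  obtain ⟨M, hM⟩ := hK.exists_bound_of_continuousOn hu.continuousOn
  have hint : IntegrableOn u (O ∩ Z) (liouville b O) :=
    Measure.integrableOn_of_bounded (liouville_lt_top hO hK Set.inter_subset_left).ne
      hu.aestronglyMeasurable (M := M) ((ae_restrict_iff' hKm).2 (Eventually.of_forall hM))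
  refine ⟨hint, (integrable_congr hae).2 ((integrable_indicator_iff hKm).2 hint), ?_⟩
  rw [integral_congr_ae hae, integral_indicator hKm]

end Liouville

/-! ### Coadjoint action and invariance of the Liouville measure -/

section Coadjoint

open Matrix

variable {n : ℕ} {g : Type*} [LieRing g] [LieAlgebra ℝ g] (b : Module.Basis (Fin n) ℝ g)

/-- The transpose `ξ ↦ ξ ∘ γ` of a linear map, in coordinates. -/
def dualMap (γ : g →ₗ[ℝ] g) : (Fin n → ℝ) →L[ℝ] (Fin n → ℝ) :=
  LinearMap.toContinuousLinearMap (LinearMap.toMatrix b b γ).vecMulLinear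

theorem dualMap_apply (γ : g →ₗ[ℝ] g) (ξ : Fin n → ℝ) :
    dualMap b γ ξ = ξ ᵥ* LinearMap.toMatrix b b γ := rfl

theorem dualMap_coord (γ : g →ₗ[ℝ] g) (ξ : Fin n → ℝ) (i : Fin n) :
    dualMap b γ ξ i = linearFn b (γ (b i)) ξ := by
  simp [dualMap_apply, vecMul, dotProduct, linearFn, LinearMap.toMatrix_apply, mul_comm]

theorem linearFn_eq_sum (L : g →ₗ[ℝ] ℝ) (x : g) {η : Fin n → ℝ} (h : ∀ i, η i = L (b i)) :
    linearFn b x η = L x := by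
  conv_rhs => rw [← b.sum_repr x, map_sum]
  simp [linearFn, h]

theorem linearFn_dualMap (γ : g →ₗ[ℝ] g) (x : g) (ξ : Fin n → ℝ) :
    linearFn b x (dualMap b γ ξ) = linearFn b (γ x) ξ := by
  rw [linearFn_eq_sum b (functional b ξ ∘ₗ γ) x fun i => ?_]
  · exact functional_apply b ξ _
  · rw [dualMap_coord, ← functional_apply]
    rfl

theorem linearFn_coad (x y : g) (ξ : Fin n → ℝ) :
    linearFn b y (coad b x ξ) = -linearFn b ⁅x, y⁆ ξ := by
  rw [linearFn_eq_sum b (-(functional b ξ ∘ₗ (LieAlgebra.ad ℝ g x : g →ₗ[ℝ] g))) y fun i => ?_]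
  · rw [← functional_apply]
    rfl
  · rw [coad, ← functional_apply]
    rfl

theorem dualMap_dualMap (γ δ : g →ₗ[ℝ] g) (ξ : Fin n → ℝ) :
    dualMap b γ (dualMap b δ ξ) = dualMap b (δ ∘ₗ γ) ξ := by
  ext i
  rw [dualMap_coord, linearFn_dualMap, dualMap_coord]
  rfl

theorem dualMap_id (ξ : Fin n → ℝ) : dualMap b LinearMap.id ξ = ξ := by
  rw [dualMap_apply, LinearMap.toMatrix_id, vecMul_one]

theorem coad_dualMap {γ : g →ₗ[ℝ] g} (hγ : ∀ x y, γ ⁅x, y⁆ = ⁅γ x, γ y⁆) (x : g)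
    (ξ : Fin n → ℝ) : coad b x (dualMap b γ ξ) = dualMap b γ (coad b (γ x) ξ) := by
  ext i
  rw [coad, linearFn_dualMap, hγ, dualMap_coord, linearFn_coad]

variable {b} {O : Set (Fin n → ℝ)}

/-- Local parametrizations are transported by automorphisms that preserve the orbit. -/
def OrbitChart.transport (c : OrbitChart b O) (γ γ' : g →ₗ[ℝ] g) (h : γ ∘ₗ γ' = LinearMap.id)
    (h' : γ' ∘ₗ γ = LinearMap.id) (hγ : ∀ x y, γ ⁅x, y⁆ = ⁅γ x, γ y⁆)
    (hO : Set.MapsTo (dualMap b γ) O O) (hO' : Set.MapsTo (dualMap b γ') O O) :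
    OrbitChart b O where
  dim := c.dim
  source := c.source
  toFun u := dualMap b γ (c.toFun u)
  isOpen_source := c.isOpen_source
  contDiffOn := (dualMap b γ).contDiff.comp_contDiffOn c.contDiffOn
  injOn := fun u hu v hv huv => c.injOn hu hv (by
    have := congrArg (dualMap b γ') huv
    simpa only [dualMap_dualMap, h, dualMap_id] using this)
  injective_fderiv := fun u hu => by
    have hd : fderiv ℝ (fun u => dualMap b γ (c.toFun u)) u =
        (dualMap b γ).comp (fderiv ℝ c.toFun u) :=
      ((dualMap b γ).hasFDerivAt.comp u ((c.contDiffOn.contDiffAt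
        (c.isOpen_source.mem_nhds hu)).differentiableAt (by simp)).hasFDerivAt).fderiv
    rw [hd, ContinuousLinearMap.coe_comp]
    refine Function.Injective.comp (fun ξ η hξη => ?_) (c.injective_fderiv u hu)
    have := congrArg (dualMap b γ') hξη
    simpa only [dualMap_dualMap, h, dualMap_id] using this
  range_fderiv := fun u hu => by
    have hd : fderiv ℝ (fun u => dualMap b γ (c.toFun u)) u =
        (dualMap b γ).comp (fderiv ℝ c.toFun u) :=
      ((dualMap b γ).hasFDerivAt.comp u ((c.contDiffOn.contDiffAt
        (c.isOpen_source.mem_nhds hu)).differentiableAt (by simp)).hasFDerivAt).fderiv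
    rw [hd, ContinuousLinearMap.coe_comp, Set.range_comp, c.range_fderiv u hu]
    simp only [coad_dualMap b hγ]
    ext η
    constructor
    · rintro ⟨_, ⟨x, rfl⟩, rfl⟩
      refine ⟨γ' x, ?_⟩
      simp only [show γ (γ' x) = x from LinearMap.congr_fun h x]
    · rintro ⟨x, rfl⟩
      exact ⟨_, ⟨γ x, rfl⟩, rfl⟩
  open_image := fun W hW hWo => by
    obtain ⟨V, hV, hWV⟩ := c.open_image W hW hWo
    refine ⟨dualMap b γ' ⁻¹' V, hV.preimage (dualMap b γ').continuous, ?_⟩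
    rw [← Set.image_image (dualMap b γ), hWV]
    ext η
    constructor
    · rintro ⟨ξ, ⟨hξ, hξV⟩, rfl⟩
      refine ⟨hO hξ, ?_⟩
      rwa [Set.mem_preimage, dualMap_dualMap, h, dualMap_id]
    · rintro ⟨hη, hηV⟩
      refine ⟨dualMap b γ' η, ⟨hO' hη, hηV⟩, ?_⟩
      rw [dualMap_dualMap, h', dualMap_id]

/-- The generators of the transported chart may be taken to be the γ'-images of the old ones, since
the form depends only on tangent vectors. As γ is an automorphism inverse to γ', the Kirillov matrix
is unchanged. -/
theorem OrbitChart.measure_transport (c : OrbitChart b O) (γ γ' : g →ₗ[ℝ] g)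
    (h : γ ∘ₗ γ' = LinearMap.id) (h' : γ' ∘ₗ γ = LinearMap.id)
    (hγ : ∀ x y, γ ⁅x, y⁆ = ⁅γ x, γ y⁆) (hO : Set.MapsTo (dualMap b γ) O O)
    (hO' : Set.MapsTo (dualMap b γ') O O) :
    (c.transport γ γ' h h' hγ hO hO').measure = c.measure.map (dualMap b γ) := by
  set c' := c.transport γ γ' h h' hγ hO hO'
  have hk : ∀ u ∈ c.source, c'.kksMatrix u = c.kksMatrix u := by
    intro u hu
    have hd : fderiv ℝ c'.toFun u = (dualMap b γ).comp (fderiv ℝ c.toFun u) :=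
      ((dualMap b γ).hasFDerivAt.comp u ((c.contDiffOn.contDiffAt
        (c.isOpen_source.mem_nhds hu)).differentiableAt (by simp)).hasFDerivAt).fderiv
    have hgen : ∀ i, coad b (c'.generator u i) (c'.toFun u) =
        coad b (γ' (c.generator u i)) (c'.toFun u) := fun i => by
      rw [c'.coad_generator (u := u) hu, hd, show c'.toFun u = dualMap b γ (c.toFun u) from rfl,
        coad_dualMap b hγ, show γ (γ' (c.generator u i)) = _ from LinearMap.congr_fun h _,
        LinearMap.id_apply]
      exact congrArg (dualMap b γ) (c.coad_generator hu i).symm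
    ext i j
    change linearFn b ⁅c'.generator u i, c'.generator u j⁆ (c'.toFun u) = _
    rw [kks_congr b (hgen i) (hgen j), show c'.toFun u = dualMap b γ (c.toFun u) from rfl,
      linearFn_dualMap, hγ, show ∀ x, γ (γ' x) = x from LinearMap.congr_fun h,
      show ∀ x, γ (γ' x) = x from LinearMap.congr_fun h]
    rfl
  change ((volume.restrict c.source).withDensity c'.density).map
    (dualMap b γ ∘ c.toFun) = (((volume.restrict c.source).withDensity c.density).map
      c.toFun).map (dualMap b γ)
  rw [AEMeasurable.map_map_of_aemeasurable (dualMap b γ).continuous.measurable.aemeasurable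
    c.aemeasurable_toFun]
  congr 1
  refine withDensity_congr_ae ((ae_restrict_iff' c.isOpen_source.measurableSet).2
    (Eventually.of_forall fun u hu => ?_))
  change ENNReal.ofReal (Real.sqrt (c'.kksMatrix u).det) = _
  rw [hk u hu]
  rfl

variable {Γ : Subgroup (g ≃ₗ[ℝ] g)} {ξ₀ : Fin n → ℝ}

theorem mem_coadjointOrbit {η : Fin n → ℝ} : η ∈ coadjointOrbit b Γ ξ₀ ↔
    ∃ γ ∈ Γ, η = dualMap b (γ : g →ₗ[ℝ] g) ξ₀ := by
  simp only [coadjointOrbit, Set.mem_ofPred_eq, funext_iff, dualMap_coord]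
  rfl

theorem mapsTo_dualMap {γ : g ≃ₗ[ℝ] g} (hγ : γ ∈ Γ) :
    Set.MapsTo (dualMap b (γ : g →ₗ[ℝ] g)) (coadjointOrbit b Γ ξ₀) (coadjointOrbit b Γ ξ₀) := by
  intro η hη
  obtain ⟨δ, hδ, rfl⟩ := mem_coadjointOrbit.1 hη
  exact mem_coadjointOrbit.2 ⟨δ * γ, Γ.mul_mem hδ hγ, dualMap_dualMap b _ _ _⟩

/-- Each chart measure is the γ-image of the measure of the chart transported by γ⁻¹. Applied to γ⁻¹
as well, this inequality becomes an equality. -/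
theorem liouville_le_map (hΓ : IsAdjointGroup b Γ) {γ : g ≃ₗ[ℝ] g} (hγ : γ ∈ Γ) :
    liouville b (coadjointOrbit b Γ ξ₀) ≤
      (liouville b (coadjointOrbit b Γ ξ₀)).map (dualMap b (γ : g →ₗ[ℝ] g)) := by
  have hγ' : γ⁻¹ ∈ Γ := Γ.inv_mem hγ
  have h : (γ : g →ₗ[ℝ] g) ∘ₗ ((γ⁻¹ : g ≃ₗ[ℝ] g) : g →ₗ[ℝ] g) = LinearMap.id :=
    LinearMap.ext fun x => γ.apply_symm_apply x
  have h' : ((γ⁻¹ : g ≃ₗ[ℝ] g) : g →ₗ[ℝ] g) ∘ₗ (γ : g →ₗ[ℝ] g) = LinearMap.id :=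
    LinearMap.ext fun x => γ.symm_apply_apply x
  have hm : Measurable (dualMap b (γ : g →ₗ[ℝ] g)) := (dualMap b _).continuous.measurable
  refine iSup_le fun c => ?_
  let c' := c.transport _ _ h' h (hΓ.map_lie _ hγ') (mapsTo_dualMap hγ') (mapsTo_dualMap hγ)
  have hc : c.measure = c'.measure.map (dualMap b (γ : g →ₗ[ℝ] g)) := by
    rw [c.measure_transport, Measure.map_map hm (dualMap b _).continuous.measurable]
    have : dualMap b (γ : g →ₗ[ℝ] g) ∘ dualMap b ((γ⁻¹ : g ≃ₗ[ℝ] g) : g →ₗ[ℝ] g) = id := by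
      funext ξ
      rw [Function.comp_apply, dualMap_dualMap, h', dualMap_id, id]
    rw [this, Measure.map_id]
  rw [hc]
  exact Measure.map_mono c'.measure_le_liouville hm

/-- The Liouville measure is invariant under the coadjoint action. -/
theorem liouville_map (hΓ : IsAdjointGroup b Γ) {γ : g ≃ₗ[ℝ] g} (hγ : γ ∈ Γ) :
    (liouville b (coadjointOrbit b Γ ξ₀)).map (dualMap b (γ : g →ₗ[ℝ] g)) =
      liouville b (coadjointOrbit b Γ ξ₀) := by
  refine le_antisymm ?_ (liouville_le_map hΓ hγ)
  have hm : Measurable (dualMap b (γ : g →ₗ[ℝ] g)) := (dualMap b _).continuous.measurable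
  refine (Measure.map_mono (liouville_le_map hΓ (Γ.inv_mem hγ)) hm).trans (le_of_eq ?_)
  rw [Measure.map_map hm (dualMap b _).continuous.measurable]
  have : dualMap b (γ : g →ₗ[ℝ] g) ∘ dualMap b ((γ⁻¹ : g ≃ₗ[ℝ] g) : g →ₗ[ℝ] g) = id := by
    funext ξ
    rw [Function.comp_apply, dualMap_dualMap]
    have : ((γ⁻¹ : g ≃ₗ[ℝ] g) : g →ₗ[ℝ] g) ∘ₗ (γ : g →ₗ[ℝ] g) = LinearMap.id :=
      LinearMap.ext fun x => γ.symm_apply_apply x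
    rw [this, dualMap_id, id]
  rw [this, Measure.map_id]

end Coadjoint

/-! ### The linear flow of a matrix -/

section Flow

open Matrix

attribute [local instance] Matrix.linftyOpNormedRing Matrix.linftyOpNormedAlgebra

variable {n : ℕ}

theorem hasDerivAt_vecMul_exp (M : Matrix (Fin n) (Fin n) ℝ) (ξ : Fin n → ℝ) (t : ℝ) :
    HasDerivAt (fun t : ℝ => ξ ᵥ* NormedSpace.exp (t • M)) ((ξ ᵥ* NormedSpace.exp (t • M)) ᵥ* M)
      t := by
  let L : Matrix (Fin n) (Fin n) ℝ →ₗ[ℝ] (Fin n → ℝ) :=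
    { toFun := fun N => ξ ᵥ* N
      map_add' := fun N N' => vecMul_add N N' ξ
      map_smul' := fun a N => vecMul_smul ξ a N }
  rw [vecMul_vecMul]
  exact (LinearMap.toContinuousLinearMap L).hasFDerivAt.comp_hasDerivAt t
    (hasDerivAt_exp_smul_const M t)

theorem continuous_vecMul_exp (M : Matrix (Fin n) (Fin n) ℝ) :
    Continuous fun p : ℝ × (Fin n → ℝ) => p.2 ᵥ* NormedSpace.exp (p.1 • M) := by
  have h : Continuous fun p : ℝ × (Fin n → ℝ) => NormedSpace.exp (p.1 • M) :=
    NormedSpace.exp_continuous.comp (continuous_fst.smul continuous_const)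
  exact continuous_snd.matrix_vecMul h

end Flow

/-! ### Vanishing of the orbit integral on {x̂, h} -/

section Invariance

open Matrix

variable {n : ℕ} {g : Type*} [LieRing g] [LieAlgebra ℝ g] {b : Module.Basis (Fin n) ℝ g}

theorem pderiv_linearFn (x : g) (i : Fin n) (ξ : Fin n → ℝ) :
    pderiv i (linearFn b x) ξ = b.repr x i := by
  let L : (Fin n → ℝ) →L[ℝ] ℝ := ∑ j, b.repr x j • ContinuousLinearMap.proj j
  have : linearFn b x = L := by
    ext η
    simp [L, linearFn]
  rw [pderiv, this, L.fderiv]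
  simp [L, Pi.single_apply]

/-- The Hamiltonian vector field of x̂ is linear, ξ ↦ ξ ∘ ad x, so its flow is ξ ↦ ξ ∘ e^{t ad x}.
-/
theorem poisson_linearFn_eq_fderiv (x : g) (h : Fn n) (ξ : Fin n → ℝ) :
    poisson b (linearFn b x) h ξ =
      fderiv ℝ h ξ (ξ ᵥ* LinearMap.toMatrix b b (LieAlgebra.ad ℝ g x)) := by
  have h1 : ∀ v : Fin n → ℝ, fderiv ℝ h ξ v = ∑ j, v j * pderiv j h ξ := fun v => by
    have : v = ∑ j, v j • (Pi.single j 1 : Fin n → ℝ) := by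
      ext j
      simp [Finset.sum_apply, Pi.single_apply]
    conv_lhs => rw [this, map_sum]
    simp [pderiv]
  have h2 : ∀ j, (ξ ᵥ* LinearMap.toMatrix b b (LieAlgebra.ad ℝ g x)) j =
      ∑ i, ∑ k, b.repr x i * (ξ k * b.repr ⁅b i, b j⁆ k) := fun j => by
    have := dualMap_coord b (LieAlgebra.ad ℝ g x) ξ j
    rw [dualMap_apply] at this
    rw [this, LieAlgebra.ad_apply, ← functional_apply]
    conv_lhs => rw [← b.sum_repr x, sum_lie, map_sum]
    refine Finset.sum_congr rfl fun i _ => ?_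
    rw [smul_lie, map_smul, functional_apply, linearFn, smul_eq_mul, Finset.mul_sum]
    exact Finset.sum_congr rfl fun k _ => by ring
  rw [h1, poisson, Finset.sum_comm]
  refine Finset.sum_congr rfl fun j _ => ?_
  rw [h2, Finset.sum_mul]
  refine Finset.sum_congr rfl fun i _ => ?_
  rw [Finset.sum_mul]
  refine Finset.sum_congr rfl fun k _ => ?_
  rw [pderiv_linearFn]
  ring

variable {Γ : Subgroup (g ≃ₗ[ℝ] g)} {ξ₀ : Fin n → ℝ}

/-- The flow of `{x̂, ·}` consists of coadjoint transformations. -/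
theorem IsAdjointGroup.exists_dualMap_eq (hΓ : IsAdjointGroup b Γ) (x : g) (t : ℝ) :
    ∃ γ ∈ Γ, ∀ ξ : Fin n → ℝ, dualMap b (γ : g →ₗ[ℝ] g) ξ =
      ξ ᵥ* NormedSpace.exp (t • LinearMap.toMatrix b b (LieAlgebra.ad ℝ g x)) := by
  obtain ⟨γ, hγ, h⟩ := hΓ.exp_ad (t • x)
  refine ⟨γ, hγ, fun ξ => ?_⟩
  rw [dualMap_apply, h, map_smul, map_smul]

/-- The integral over the orbit vanishes on `{x̂, h}`. -/
theorem integral_poisson_linearFn_eq_zero (hΓ : IsAdjointGroup b Γ)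
    (hO : IsEmbeddedOrbit b (coadjointOrbit b Γ ξ₀)) (x : g) {h : Fn n}
    (hh : h ∈ compactOn (coadjointOrbit b Γ ξ₀)) :
    ∫ ξ, poisson b (linearFn b x) h ξ ∂(liouville b (coadjointOrbit b Γ ξ₀)) = 0 := by
  set O := coadjointOrbit b Γ ξ₀
  set M := LinearMap.toMatrix b b (LieAlgebra.ad ℝ g x)
  let a : ℝ → (Fin n → ℝ) → (Fin n → ℝ) := fun t ξ => ξ ᵥ* NormedSpace.exp (t • M)
  have hac : Continuous fun p : ℝ × (Fin n → ℝ) => a p.1 p.2 := continuous_vecMul_exp M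
  have hat : ∀ t, Continuous (a t) := fun t => hac.comp (Continuous.prodMk_right t)
  have ha0 : ∀ ξ, a 0 ξ = ξ := fun ξ => by
    simp only [a, zero_smul, NormedSpace.exp_zero, vecMul_one]
  have haO : ∀ t, Set.MapsTo (a t) O O := fun t ξ hξ => by
    obtain ⟨γ, hγ, he⟩ := hΓ.exists_dualMap_eq x t
    change ξ ᵥ* _ ∈ O
    rw [← he]
    exact mapsTo_dualMap hγ hξ
  have hamap : ∀ t, (liouville b O).map (a t) = liouville b O := fun t => by
    obtain ⟨γ, hγ, he⟩ := hΓ.exists_dualMap_eq x t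
    rw [show a t = dualMap b (γ : g →ₗ[ℝ] g) from funext fun ξ => (he ξ).symm]
    exact liouville_map hΓ hγ
  have hinv : ∀ t, ∀ ξ, a (-t) (a t ξ) = ξ := fun t ξ => by
    simp only [a]
    rw [vecMul_vecMul, ← Matrix.exp_add_of_commute, neg_smul, add_neg_cancel, NormedSpace.exp_zero,
      vecMul_one]
    rw [neg_smul]
    exact (Commute.refl _).neg_right
  have hp : Continuous (poisson b (linearFn b x) h) := by
    have := (poisson_linearFn b x ⟨h, hh.1⟩)
    rw [show poisson b (linearFn b x) h = _ from this]
    exact (Subtype.prop _ : ContDiff ℝ ∞ _).continuous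
  have hpz : ∀ ξ ∉ tsupport h, poisson b (linearFn b x) h ξ = 0 := fun ξ hξ => by
    rw [poisson_linearFn_eq_fderiv]
    have : fderiv ℝ h ξ = 0 := by
      by_contra hne
      exact hξ (support_fderiv_subset ℝ hne)
    rw [this]
    rfl
  have hder : ∀ ξ t, HasDerivAt (fun t => h (a t ξ)) (poisson b (linearFn b x) h (a t ξ)) t :=
    fun ξ t => by
      rw [poisson_linearFn_eq_fderiv]
      exact ((hh.1.differentiable (by simp)) (a t ξ)).hasFDerivAt.comp_hasDerivAt t
        (hasDerivAt_vecMul_exp M ξ t)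
  have hconst : ∀ t, ∫ ξ, h (a t ξ) ∂(liouville b O) = ∫ ξ, h ξ ∂(liouville b O) := fun t => by
    conv_rhs => rw [← hamap t]
    rw [integral_map (hat t).aemeasurable hh.1.continuous.aestronglyMeasurable]
  let I : Set ℝ := Set.Icc (-1) 1
  -- Z is the set of points that the flow carries into supp h at some time in [-1, 1]. It is closed
  -- because the time interval is compact, and O ∩ Z is compact as the image of a compact set under
  -- the flow; its indicator carries the dominating function.
  let Z : Set (Fin n → ℝ) := Prod.snd '' {p : I × (Fin n → ℝ) | a p.1 p.2 ∈ tsupport h}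
  have hZ : IsClosed Z := by
    refine isClosedMap_snd_of_compactSpace _ ((isClosed_tsupport h).preimage ?_)
    exact hac.comp (continuous_subtype_val.prodMap continuous_id)
  have hK : IsCompact (O ∩ Z) := by
    have he : O ∩ Z = (fun p : ℝ × (Fin n → ℝ) => a p.1 p.2) '' (I ×ˢ (O ∩ tsupport h)) := by
      ext ξ
      constructor
      · rintro ⟨hξ, ⟨⟨t, ht⟩, η⟩, hη, rfl⟩
        exact ⟨(-t, a t η), ⟨⟨neg_le_neg ht.2, neg_le.1 ht.1⟩, haO t hξ, hη⟩, hinv t η⟩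
      · rintro ⟨⟨t, η⟩, ⟨ht, hη, hη'⟩, rfl⟩
        refine ⟨haO t hη, ⟨⟨⟨-t, neg_le_neg ht.2, neg_le.1 ht.1⟩, a t η⟩, ?_, rfl⟩⟩
        change a (-t) (a t η) ∈ tsupport h
        rwa [hinv]
    rw [he]
    exact (isCompact_Icc.prod hh.2).image hac
  obtain ⟨C, hC⟩ := hh.2.exists_bound_of_continuousOn hp.continuousOn
  have hKm : MeasurableSet (O ∩ Z) := hK.isClosed.measurableSet
  have hnull : liouville b O (Z \ (O ∩ Z)) = 0 :=
    liouville_eq_zero (hZ.measurableSet.diff hKm)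
      (Set.disjoint_left.2 fun ξ (h : ξ ∈ O) (h' : ξ ∈ Z \ (O ∩ Z)) => h'.2 ⟨h, h'.1⟩)
  have hbound : ∀ᵐ ξ ∂(liouville b O), ∀ t ∈ I,
      ‖poisson b (linearFn b x) h (a t ξ)‖ ≤ (O ∩ Z).indicator (fun _ => |C|) ξ := by
    filter_upwards [measure_eq_zero_iff_ae_notMem.1 hnull] with ξ hξ t ht
    by_cases hmem : a t ξ ∈ tsupport h
    · have hξZ : ξ ∈ Z := ⟨(⟨t, ht⟩, ξ), hmem, rfl⟩
      have hξK : ξ ∈ O ∩ Z := by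
        by_contra hn
        exact hξ ⟨hξZ, hn⟩
      rw [Set.indicator_of_mem hξK]
      exact (hC _ ⟨haO t hξK.1, hmem⟩).trans (le_abs_self C)
    · rw [hpz _ hmem, norm_zero]
      exact Set.indicator_nonneg (fun _ _ => abs_nonneg C) ξ
  have hres := (hasDerivAt_integral_of_dominated_loc_of_deriv_le (μ := liouville b O)
    (F := fun t ξ => h (a t ξ)) (F' := fun t ξ => poisson b (linearFn b x) h (a t ξ)) (x₀ := 0)
    (s := I) (Icc_mem_nhds (by norm_num) (by norm_num))
    (Eventually.of_forall fun t => (hh.1.continuous.comp (hat t)).aestronglyMeasurable)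
    (by
      simp only [ha0]
      exact (integrable_and_integral_eq hO hh.1.continuous (isClosed_tsupport h) hh.2
        fun ξ hξ => image_eq_zero_of_notMem_tsupport hξ).2.1)
    (hp.comp (hat 0)).aestronglyMeasurable hbound
    ((integrable_indicator_iff hKm).2 (integrableOn_const
      (liouville_lt_top hO hK Set.inter_subset_left).ne))
    (Eventually.of_forall fun ξ t _ => hder ξ t)).2
  -- By invariance of the measure the integral does not depend on t, so its derivative at 0 is both
  -- zero and the integral of {x̂, h}.
  simp only [hconst, ha0] at hres
  exact hres.unique (hasDerivAt_const _ _)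

end Invariance

/-! ### Part (b): integration over the orbit as a star trace -/

section IntegralTrace

variable {n : ℕ} {g : Type*} [LieRing g] [LieAlgebra ℝ g] {b : Module.Basis (Fin n) ℝ g}

theorem IsDiffOp.exists_eq_sum {Δ : Fn n → Fn n} (hΔ : IsDiffOp Δ) :
    ∃ (ι : Type) (_ : Fintype ι) (a : ι → Fn n) (w : ι → List (Fin n)),
      (∀ s, ContDiff ℝ ∞ (a s)) ∧
        ∀ f, ContDiff ℝ ∞ f → Δ f = ∑ s, a s * wordDeriv (w s) f := by
  obtain ⟨N, a, ha, he⟩ := hΔ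
  choose w hw using fun (k : ℕ) (i : Fin k → Fin n) => exists_wordDeriv_eq k i
  refine ⟨Σ k : Fin (N + 1), Fin k → Fin n, inferInstance, fun s => a s.1 s.2,
    fun s => w s.1 s.2, fun s => ha _ _, fun f hf => ?_⟩
  ext ξ
  rw [he f hf, Finset.sum_range, Fintype.sum_sigma, Finset.sum_apply]
  refine Finset.sum_congr rfl fun k _ => ?_
  rw [Finset.sum_apply]
  refine Finset.sum_congr rfl fun i _ => ?_
  rw [hw _ _ f hf]
  rfl

theorem IsDiffOp.id : IsDiffOp (id : Fn n → Fn n) :=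
  ⟨0, fun _ _ _ => 1, fun _ _ => contDiff_const, fun f _ ξ => by simp⟩

namespace IsDiffOp

variable {Δ : Fn n → Fn n} (hΔ : IsDiffOp Δ) {f h : Fn n}

include hΔ

theorem contDiff (hf : ContDiff ℝ ∞ f) : ContDiff ℝ ∞ (Δ f) := by
  obtain ⟨ι, _, a, w, ha, he⟩ := hΔ.exists_eq_sum
  rw [he f hf]
  exact smooth_sum fun s _ => (ha s).mul (contDiff_wordDeriv hf _)

theorem eq_zero_of_notMem (hf : ContDiff ℝ ∞ f) {ξ : Fin n → ℝ} (hξ : ξ ∉ tsupport f) :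
    Δ f ξ = 0 := by
  obtain ⟨ι, _, a, w, ha, he⟩ := hΔ.exists_eq_sum
  rw [he f hf, Finset.sum_apply]
  refine Finset.sum_eq_zero fun s _ => ?_
  rw [Pi.mul_apply, image_eq_zero_of_notMem_tsupport fun h =>
    hξ (tsupport_wordDeriv_subset f _ h), mul_zero]

theorem add (hf : ContDiff ℝ ∞ f) (hh : ContDiff ℝ ∞ h) : Δ (f + h) = Δ f + Δ h := by
  obtain ⟨ι, _, a, w, ha, he⟩ := hΔ.exists_eq_sum
  rw [he f hf, he h hh, he (f + h) (hf.add hh), ← Finset.sum_add_distrib]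
  exact Finset.sum_congr rfl fun s _ => by rw [wordDeriv_add hf hh, mul_add]

theorem smul (hf : ContDiff ℝ ∞ f) (c : ℝ) : Δ (c • f) = c • Δ f := by
  obtain ⟨ι, _, a, w, ha, he⟩ := hΔ.exists_eq_sum
  rw [he f hf, he (c • f) (contDiff_const.smul hf), Finset.smul_sum]
  exact Finset.sum_congr rfl fun s _ => by rw [wordDeriv_smul hf, mul_smul_comm]

theorem mem_compactOn {O : Set (Fin n → ℝ)} (hf : f ∈ compactOn O) : Δ f ∈ compactOn O := by
  refine ⟨hΔ.contDiff hf.1, ?_⟩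
  have hs : tsupport (Δ f) ⊆ tsupport f := closure_minimal (fun ξ hξ => by
    by_contra h
    exact hξ (hΔ.eq_zero_of_notMem hf.1 h)) (isClosed_tsupport f)
  rw [← Set.inter_eq_self_of_subset_right hs, ← Set.inter_assoc]
  exact hf.2.inter_right (isClosed_tsupport _)

theorem tendstoUniformlyOn {F : ℕ → Fn n} (hF : ∀ m, ContDiff ℝ ∞ (F m)) (hf : ContDiff ℝ ∞ f)
    (hFf : WordTendsto F f) {K : Set (Fin n → ℝ)} (hK : IsCompact K) :
    TendstoUniformlyOn (fun m => Δ (F m)) (Δ f) atTop K := by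
  obtain ⟨ι, _, a, w, ha, he⟩ := hΔ.exists_eq_sum
  simp only [he _ (hF _), he f hf]
  exact WordTendsto.sum _ (fun s => (hFf.iterate _).mul_left
    (fun m => contDiff_wordDeriv (hF m) _) (contDiff_wordDeriv hf _) (ha s))
    (fun s m => (ha s).mul (contDiff_wordDeriv (hF m) _))
    (fun s => (ha s).mul (contDiff_wordDeriv hf _)) [] K hK

end IsDiffOp

variable {Δ : Fn n → Fn n} {O : Set (Fin n → ℝ)}

theorem integrable_diffOp (hO : IsEmbeddedOrbit b O) (hΔ : IsDiffOp Δ) {f : Fn n}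
    (hf : f ∈ compactOn O) : Integrable (Δ f) (liouville b O) :=
  (integrable_and_integral_eq hO (hΔ.contDiff hf.1).continuous (isClosed_tsupport f) hf.2
    fun _ hξ => hΔ.eq_zero_of_notMem hf.1 hξ).2.1

/-- The functional `f ↦ ∫ Δ f`. -/
def integralFunctional (hO : IsEmbeddedOrbit b O) (hΔ : IsDiffOp Δ) : compactOn O →ₗ[ℝ] ℝ where
  toFun f := ∫ ξ, Δ f ξ ∂(liouville b O)
  map_add' f h := by
    rw [← integral_add (integrable_diffOp hO hΔ f.2) (integrable_diffOp hO hΔ h.2),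
      Submodule.coe_add, hΔ.add f.2.1 h.2.1]
    rfl
  map_smul' c f := by
    rw [RingHom.id_apply, smul_eq_mul, ← integral_const_mul, Submodule.coe_smul,
      hΔ.smul f.2.1]
    rfl

theorem coeff_smul_formal (r : PowerSeries ℝ) (F : PowerSeries (Fn n)) (m : ℕ) :
    PowerSeries.coeff m (r • F) = ∑ p ∈ Finset.HasAntidiagonal.antidiagonal m,
      PowerSeries.coeff p.1 r • PowerSeries.coeff p.2 F := by
  rw [Algebra.smul_def, PowerSeries.coeff_mul]
  refine Finset.sum_congr rfl fun p _ => ?_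
  rw [show PowerSeries.coeff p.1 (algebraMap (PowerSeries ℝ) (PowerSeries (Fn n)) r) =
    algebraMap ℝ (Fn n) (PowerSeries.coeff p.1 r) from
      PowerSeries.coeff_map (algebraMap ℝ (Fn n)) p.1 r, ← Algebra.smul_def]

/-- The `ℝ[[ν]]`-linear extension of a functional. -/
def formalExtension {D : Submodule ℝ (Fn n)} (φ : D →ₗ[ℝ] ℝ) :
    formal D →ₗ[PowerSeries ℝ] PowerSeries ℝ where
  toFun F := PowerSeries.mk fun m => φ ⟨_, F.2 m⟩
  map_add' F H := by
    ext m
    rw [map_add, PowerSeries.coeff_mk, PowerSeries.coeff_mk, PowerSeries.coeff_mk, ← map_add]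
    congr 1
  map_smul' r F := by
    ext m
    rw [RingHom.id_apply, smul_eq_mul, PowerSeries.coeff_mul, PowerSeries.coeff_mk]
    simp only [PowerSeries.coeff_mk, ← smul_eq_mul, ← map_smul, ← map_sum]
    congr 1
    refine Subtype.ext ?_
    rw [AddSubmonoidClass.coe_finsetSum]
    exact coeff_smul_formal r (F : PowerSeries (Fn n)) m

theorem coeff_formalExtension {D : Submodule ℝ (Fn n)} (φ : D →ₗ[ℝ] ℝ) (F : formal D) (m : ℕ) :
    PowerSeries.coeff m (formalExtension φ F) = φ ⟨_, F.2 m⟩ :=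
  PowerSeries.coeff_mk m fun m => φ ⟨_, F.2 m⟩

theorem formalExtension_const {D : Submodule ℝ (Fn n)} (φ : D →ₗ[ℝ] ℝ) (f : Fn n) (hf : f ∈ D) :
    formalExtension φ (const D f hf) = PowerSeries.C (φ ⟨f, hf⟩) := by
  ext m
  rw [coeff_formalExtension, PowerSeries.coeff_C]
  split_ifs with h
  · subst h
    congr 1
    exact Subtype.ext (PowerSeries.coeff_zero_C f)
  · convert map_zero φ
    change PowerSeries.coeff m (PowerSeries.C f) = 0
    rw [PowerSeries.coeff_C, if_neg h]

/-- All commutators with h are supported in supp h, and they converge uniformly, even after Δ, on O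
∩ supp h, which is compact and of finite measure. Only r = 0 matters, as the functional takes D to
constants. -/
theorem hasPolyContinuity_integral (hO : IsEmbeddedOrbit b O) (hΔ : IsDiffOp Δ) :
    HasPolyContinuity b (compactOn O) (formalExtension (integralFunctional hO hΔ)) := by
  intro f hf h hh p hpf r s hp hfm
  simp only [component, formalExtension_const, PowerSeries.coeff_C]
  split_ifs with hr
  swap
  · exact tendsto_const_nhds
  simp only [integralFunctional, LinearMap.coe_mk, AddHom.coe_mk]
  let B : Fn n → Fn n := fun u => bchCoeff b s u h - bchCoeff b s h u
  have hBe : ∀ u, PowerSeries.coeff s (starComm b (PowerSeries.C u) (PowerSeries.C h)) = B u :=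
    fun u => coeff_starComm_C b u h s
  have hBs : ∀ u, ContDiff ℝ ∞ u → ContDiff ℝ ∞ (B u) := fun u hu =>
    (contDiff_bchCoeff b s hu hh.1).sub (contDiff_bchCoeff b s hh.1 hu)
  have hBz : ∀ u, ContDiff ℝ ∞ u → tsupport (B u) ⊆ tsupport h := fun u hu =>
    (tsupport_sub _ _).trans (Set.union_subset
      ((tsupport_bchCoeff_subset b s hu hh.1).trans Set.inter_subset_right)
      ((tsupport_bchCoeff_subset b s hh.1 hu).trans Set.inter_subset_left))
  have hP : ∀ m, ContDiff ℝ ∞ (polyFn (p m)) := fun m => contDiff_polyFn _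
  have hw : WordTendsto (fun m => polyFn (p m)) f := (smoothTendsto_iff hP hf).1 hpf
  have hBw : WordTendsto (fun m => B (polyFn (p m))) (B f) := by
    have h1 := wordTendsto_bchCoeff_left b s hP hf hh.1 hw
    have h2 := (wordTendsto_bchCoeff_right b s hP hf hh.1 hw).mul_left
      (fun m => contDiff_bchCoeff b s hh.1 (hP m)) (contDiff_bchCoeff b s hh.1 hf)
      (a := fun _ => -1) contDiff_const
    have h3 := h1.add h2 (fun m => contDiff_bchCoeff b s (hP m) hh.1)
      (fun m => contDiff_const.mul (contDiff_bchCoeff b s hh.1 (hP m)))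
      (contDiff_bchCoeff b s hf hh.1) (contDiff_const.mul (contDiff_bchCoeff b s hh.1 hf))
    have e : ∀ u v : Fn n, u + (fun _ => (-1 : ℝ)) * v = u - v := fun u v => by
      ext ξ
      simp [sub_eq_add_neg]
    simp only [e] at h3
    exact h3
  simp only [hBe]
  set μ := liouville b O
  have hK := hh.2
  have hint := fun u (hu : ContDiff ℝ ∞ u) => integrable_and_integral_eq hO
    (hΔ.contDiff (hBs u hu)).continuous (isClosed_tsupport h) hK fun ξ hξ =>
      hΔ.eq_zero_of_notMem (hBs u hu) fun h' => hξ (hBz u hu h')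
  rw [(hint f hf).2.2]
  refine (tendsto_congr fun m => (hint _ (hP m)).2.2).2 ?_
  have hu := hΔ.tendstoUniformlyOn (fun m => hBs _ (hP m)) (hBs f hf) hBw hK
  have hfin : μ (O ∩ tsupport h) < ⊤ := liouville_lt_top hO hK Set.inter_subset_left
  rw [Metric.tendsto_atTop]
  rw [Metric.tendstoUniformlyOn_iff] at hu
  intro ε hε
  have hpos : 0 < μ.real (O ∩ tsupport h) + 1 := by positivity
  obtain ⟨N, hN⟩ := eventually_atTop.1 (hu _ (div_pos hε hpos))
  refine ⟨N, fun m hm => ?_⟩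
  rw [dist_comm, dist_eq_norm, ← integral_sub (hint f hf).1 (hint _ (hP m)).1]
  refine (norm_setIntegral_le_of_norm_le_const hfin fun ξ hξ => ?_).trans_lt
    (b := ε / (μ.real (O ∩ tsupport h) + 1) * μ.real (O ∩ tsupport h)) ?_
  · rw [← dist_eq_norm]
    exact (hN m hm ξ hξ).le
  · rw [div_mul_eq_mul_div, div_lt_iff₀ hpos]
    nlinarith

/-- Invariance of Δ gives ∫ Δ{x̂, h} = ∫ {x̂, Δh} = 0, so the functional is g-invariant and part (a)
applies. -/
theorem integralIsTrace {Γ : Subgroup (g ≃ₗ[ℝ] g)} {ξ₀ : Fin n → ℝ} (hΓ : IsAdjointGroup b Γ)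
    (hO : IsEmbeddedOrbit b (coadjointOrbit b Γ ξ₀)) (hΔ : IsDiffOp Δ)
    (hinv : IsInvariantOp b Δ) : IntegralIsTrace b (compactOn (coadjointOrbit b Γ ξ₀))
      (liouville b (coadjointOrbit b Γ ξ₀)) Δ := by
  refine ⟨fun f hf => integrable_diffOp hO hΔ hf, formalExtension (integralFunctional hO hΔ),
    coeff_formalExtension _, ?_⟩
  have hI := isStarIdeal_compactOn b (coadjointOrbit b Γ ξ₀)
  refine IsLieInvariant.isStarTrace (fun x h hh => ?_) hI (hasPolyContinuity_integral hO hΔ)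
  have hx : ContDiff ℝ ∞ (linearFn b x) := by
    rw [← polyFn_linPoly]
    exact contDiff_polyFn _
  have hmem : poisson b (linearFn b x) h ∈ compactOn (coadjointOrbit b Γ ξ₀) := by
    rw [← bchCoeff_one_sub b hx hh.1]
    exact hI.comm_mem hx hh 1
  refine ⟨hmem, ?_⟩
  rw [formalExtension_const]
  have : integralFunctional hO hΔ ⟨_, hmem⟩ = 0 := by
    change ∫ ξ, Δ (poisson b (linearFn b x) h) ξ ∂_ = 0
    rw [hinv x h hh.1]
    exact integral_poisson_linearFn_eq_zero hΓ hO x (hΔ.mem_compactOn hh)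
  rw [this, map_zero]

end IntegralTrace

end BCHStar

end

theorem mainTheorem1 {n : ℕ} {g : Type*} [LieRing g] [LieAlgebra ℝ g]
    (b : Module.Basis (Fin n) ℝ g) :
    (∀ D : Submodule ℝ (BCHStar.Fn n), BCHStar.IsStarIdeal b D →
      ∀ τ : BCHStar.formal D →ₗ[PowerSeries ℝ] PowerSeries ℝ,
        BCHStar.HasPolyContinuity b D τ →
          (BCHStar.IsStarTrace b D τ ↔ BCHStar.IsPoissonTrace b D τ) ∧
          (BCHStar.IsPoissonTrace b D τ ↔ BCHStar.IsLieInvariant b D τ)) ∧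
    (∀ Γ : Subgroup (g ≃ₗ[ℝ] g), BCHStar.IsAdjointGroup b Γ →
      ∀ ξ : Fin n → ℝ, BCHStar.IsEmbeddedOrbit b (BCHStar.coadjointOrbit b Γ ξ) →
        BCHStar.IntegralIsTrace b (BCHStar.compactOn (BCHStar.coadjointOrbit b Γ ξ))
          (BCHStar.liouville b (BCHStar.coadjointOrbit b Γ ξ)) id ∧
        ∀ Δ : BCHStar.Fn n → BCHStar.Fn n, BCHStar.IsDiffOp Δ → BCHStar.IsInvariantOp b Δ →
          BCHStar.IntegralIsTrace b (BCHStar.compactOn (BCHStar.coadjointOrbit b Γ ξ))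
            (BCHStar.liouville b (BCHStar.coadjointOrbit b Γ ξ)) Δ) := by
  exact ⟨fun D hD τ hτ =>
    ⟨⟨fun h => h.isLieInvariant.isPoissonTrace hD hτ, fun h => h.isLieInvariant.isStarTrace hD hτ⟩,
      ⟨fun h => h.isLieInvariant, fun h => h.isPoissonTrace hD hτ⟩⟩,
    fun Γ hΓ ξ hO => ⟨BCHStar.integralIsTrace hΓ hO BCHStar.IsDiffOp.id fun _ _ _ => rfl,
      fun _ hΔ hinv => BCHStar.integralIsTrace hΓ hO hΔ hinv⟩⟩
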